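/- **Theorem (Hybrid Prange).** All logarithms are binary, $\mathrm H(x)=-x\log x-(1-x)\log(1-x)$ is the binary entropy function, and for $k\le n$ and $\omega\le n-k$ let $T_{\mathrm C}=\binom{n}{\omega}/\binom{n-k}{\omega}$ (the running time of Prange's classical algorithm up to polynomial factors). The syndrome decoding problem $\mathrm{SD}(n,k,\omega)$ asks, given $H\in\mathbb F_2^{(n-k)\times n}$ and $s\in\mathbb F_2^{n-k}$, for a vector $e\in\mathbb F_2^n$ of Hamming weight $\omega$ with $He=s$. For $\delta\in[0,1]$, *Hybrid-Prange* puts $R=k/n$, $\alpha=(1-\delta)R$ and repeats the following pass until it finds a solution. It draws a uniformly random permutation matrix $P$, guessing that the last $\alpha n$ coordinates (rounded up to an integer) of $P^{-1}e$ are zero. It removes the corresponding columns of $HP$, which leaves an instance for a shortened $[(1-\alpha)n,(R-\alpha)n]$ code. It brings this instance into systematic form $(I_{n-k}\mid H')$ by classical Gaussian elimination, discarding the guess if the rank is less than $n-k$. It then runs the quantum Prange circuit: only $H'$ and the syndrome are loaded into qubits; the uniform superposition over all size-$(n-k)$ subsets of the columns is created; and amplitude amplification is applied to the subsets whose columns are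 linearly independent and whose linear system has a solution of weight $\omega$. The number of amplification steps is drawn uniformly from $\{0,\dots,\lceil \pi/(4a)\rceil\}$, where $a^2=\binom{n-k}{\omega}/\binom{(1-\alpha)n}{\omega}$. Finally the subset is measured, its linear system is solved classically, and the solution is extended by zeros and permuted back by $P$. The resulting vector is accepted if it has weight $\omega$ and syndrome $s$. Time counts the bit operations of the classical part plus the gates of the sequentially executed circuit, a gate with $c$ controls counting $c+1$. There are absolute constants $C,d\in\mathbb N$ such that the following holds. 1. (Qubits.) Let $n\ge1$, $k=Rn\le n$ and $\delta\in[0,1]$. Then Hybrid-Prange represents the matrix with at most $\delta(1-R)Rn^2$ qubits, and with exactly $\delta(1-R)Rn^2$ qubits if $(1-\delta)Rn$ is an integer. It uses at most $Cn$ further qubits. 2. (Correctness and time.) For all $\eta,\varepsilon>0$ there is an $n_0$ such that for all integers $n\ge n_0$, $k=Rn$ and $\omega=\tau n$ with $R\ge\eta$, $\tau>0$ and $\tau+R\le1-\eta$, all $\delta\in[0,1]$, and all $e\in\mathbb F_2^n$ of weight $\omega$: for at least a fraction $1-\varepsilon$ of the matrices $H\in\mathbb F_2^{(n-k)\times n}$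 of rank $n-k$, Hybrid-Prange on the instance $(H,He,\omega)$ of $\mathrm{SD}(n,k,\omega)$ halts almost surely, returns only solutions, and has expected running time at most $$C\,n^{d}\,(T_{\mathrm C})^{t(\delta)},\qquad t(\delta)=1-\frac{\frac12\left((1-\alpha)\mathrm H\!\left(\frac{\tau}{1-\alpha}\right)-(1-R)\,\mathrm H\!\left(\frac{\tau}{1-R}\right)\right)}{\mathrm H(\tau)-(1-R)\,\mathrm H\!\left(\frac{\tau}{1-R}\right)},\qquad \alpha=(1-\delta)R .$$ -/

import Mathlib

open scoped BigOperators ENNReal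

namespace ISD

/-! ## Quantum circuits: gates, semantics, cost, measurement -/

/-- The one-qubit gates that may be applied under controls. -/
inductive Base where
  | X : Base
  | Z : Base
  | Ry : ℝ → Base

namespace Base

/-- The `2 × 2` unitary matrix of a one-qubit gate (`false` is `|0⟩`, `true` is `|1⟩`). -/
noncomputable def mat : Base → Bool → Bool → ℂ
  | X, i, j => if i = j then 0 else 1
  | Z, i, j => if i = j then (if i then -1 else 1) else 0
  | Ry θ, false, false => (Real.cos (θ / 2) : ℂ)
  | Ry θ, false, true => -(Real.sin (θ / 2) : ℂ)
  | Ry θ, true, false => (Real.sin (θ / 2) : ℂ)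
  | Ry θ, true, true => (Real.cos (θ / 2) : ℂ)

/-- The inverse one-qubit gate. -/
noncomputable def inv : Base → Base
  | X => X
  | Z => Z
  | Ry θ => Ry (-θ)

end Base

/-- A multi-controlled one-qubit gate on the qubits `Q`. A control `(q, v)` requires qubit `q` to
be in the basis state `v`. -/
structure Gate (Q : Type) where
  base : Base
  ctrl : List (Q × Bool)
  target : Q

/-- Pure states of the qubits `Q`: amplitudes of the computational basis states. -/
abbrev QState (Q : Type) := (Q → Bool) → ℂ

/-- A circuit is a sequence of gates, the head of the list being applied first. -/
abbrev Circuit (Q : Type) := List (Gate Q)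

namespace Gate

variable {Q : Type} [DecidableEq Q]

/-- All controls are satisfied (a control on the target itself would be disregarded; no circuit
below has one). -/
def Active (g : Gate Q) (x : Q → Bool) : Prop :=
  ∀ p ∈ g.ctrl, p.1 ≠ g.target → x p.1 = p.2

instance (g : Gate Q) (x : Q → Bool) : Decidable (g.Active x) := by
  unfold Active; infer_instance

/-- The action of a gate on a state. -/
noncomputable def apply (g : Gate Q) (ψ : QState Q) : QState Q := fun x =>
  if g.Active x then
    ∑ b : Bool, g.base.mat (x g.target) b * ψ (Function.update x g.target b)
  else ψ x

/-- The inverse gate. -/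
noncomputable def inv (g : Gate Q) : Gate Q := ⟨g.base.inv, g.ctrl, g.target⟩

/-- The cost of a gate is linear in its number of controls: this is the cost of its decomposition
into Toffoli gates and (at most twice controlled) one-qubit gates. -/
def cost (g : Gate Q) : ℕ := g.ctrl.length + 1

end Gate

namespace Circuit

variable {Q : Type} [DecidableEq Q]

/-- The action of a circuit on a state. -/
noncomputable def run (c : Circuit Q) (ψ : QState Q) : QState Q :=
  c.foldl (fun φ g => g.apply φ) ψ

/-- The inverse circuit. -/
noncomputable def inv (c : Circuit Q) : Circuit Q := (c.map Gate.inv).reverse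

/-- The time taken by a circuit: the gates are executed one after the other. -/
def cost (c : Circuit Q) : ℕ := (c.map Gate.cost).sum

end Circuit

/-- The all-zero basis state. -/
noncomputable def zeroState (Q : Type) [Fintype Q] : QState Q := by
  classical exact fun x => if x = fun _ => false then 1 else 0

section Norm

variable {Q : Type} [DecidableEq Q]

theorem Base.mat_norm (u : Base) (a b : ℂ) :
    ‖u.mat false false * a + u.mat false true * b‖ ^ 2
      + ‖u.mat true false * a + u.mat true true * b‖ ^ 2 = ‖a‖ ^ 2 + ‖b‖ ^ 2 := by
  cases u with
  | X => simp [Base.mat, add_comm]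
  | Z => simp [Base.mat]
  | Ry θ =>
    have h := Real.sin_sq_add_cos_sq (θ / 2)
    simp only [Base.mat, ← Complex.normSq_eq_norm_sq, Complex.normSq_apply, Complex.add_re,
      Complex.add_im, Complex.mul_re, Complex.mul_im, Complex.ofReal_re, Complex.ofReal_im,
      Complex.neg_re, Complex.neg_im]
    linear_combination (a.re * a.re + a.im * a.im + b.re * b.re + b.im * b.im) * h

theorem Gate.active_update (g : Gate Q) (x : Q → Bool) (b : Bool) :
    g.Active (Function.update x g.target b) ↔ g.Active x := by
  unfold Gate.Active
  refine forall₂_congr fun p _ => forall_congr' fun hne => ?_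
  rw [Function.update_of_ne hne]

variable [Fintype Q]

theorem Gate.apply_norm (g : Gate Q) (ψ : QState Q) :
    ∑ x, ‖g.apply ψ x‖ ^ 2 = ∑ x, ‖ψ x‖ ^ 2 := by
  have hflip : Function.Involutive
      (fun x : Q → Bool => Function.update x g.target (!x g.target)) := by
    intro x; simp
  have hsum : ∀ F : (Q → Bool) → ℝ,
      ∑ x, F x + ∑ x, F x
        = ∑ x, (F x + F (Function.update x g.target (!x g.target))) := by
    intro F
    rw [Finset.sum_add_distrib]
    congr 1
    exact (Equiv.sum_comp hflip.toPerm F).symm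
  have key : ∀ x, ‖g.apply ψ x‖ ^ 2
        + ‖g.apply ψ (Function.update x g.target (!x g.target))‖ ^ 2
      = ‖ψ x‖ ^ 2 + ‖ψ (Function.update x g.target (!x g.target))‖ ^ 2 := by
    intro x
    by_cases h : g.Active x
    · have h' := (g.active_update x (!x g.target)).2 h
      have hm := g.base.mat_norm (ψ (Function.update x g.target false))
        (ψ (Function.update x g.target true))
      simp only [Gate.apply, h, h', if_true, Fintype.sum_bool, Function.update_self,
        Function.update_idem]
      cases hx : x g.target
      · have hx' : Function.update x g.target false = x := by rw [← hx]; simp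
        rw [hx'] at hm ⊢
        simp only [Bool.not_false]
        rw [add_comm (g.base.mat false true * _), add_comm (g.base.mat true true * _)]
        exact hm
      · have hx' : Function.update x g.target true = x := by rw [← hx]; simp
        rw [hx'] at hm ⊢
        simp only [Bool.not_true]
        rw [add_comm (g.base.mat false true * _), add_comm (g.base.mat true true * _),
          add_comm, hm, add_comm]
    · have h' : ¬ g.Active (Function.update x g.target (!x g.target)) :=
        fun h2 => h ((g.active_update x _).1 h2)
      simp [Gate.apply, h, h']
  have h1 := hsum (fun x => ‖g.apply ψ x‖ ^ 2)
  have h2 := hsum (fun x => ‖ψ x‖ ^ 2)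
  have h3 := Finset.sum_congr rfl (fun x (_ : x ∈ Finset.univ) => key x)
  linarith

theorem Circuit.run_norm (c : Circuit Q) (ψ : QState Q) :
    ∑ x, ‖c.run ψ x‖ ^ 2 = ∑ x, ‖ψ x‖ ^ 2 := by
  induction c generalizing ψ with
  | nil => rfl
  | cons g c ih =>
    have : Circuit.run (g :: c) ψ = Circuit.run c (g.apply ψ) := rfl
    rw [this, ih, g.apply_norm]

theorem zeroState_norm : ∑ x, ‖zeroState Q x‖ ^ 2 = 1 := by
  classical
  have h : ∀ x : Q → Bool, ‖zeroState Q x‖ ^ 2 = if x = (fun _ => false) then 1 else 0 := by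
    intro x
    unfold zeroState
    by_cases hx : x = fun _ => false <;> simp [hx]
  simp [h]

/-- Run a circuit on `|0…0⟩` and measure all qubits in the computational basis. -/
noncomputable def Circuit.measure (c : Circuit Q) : PMF (Q → Bool) :=
  PMF.ofFintype (fun x => ENNReal.ofReal (‖c.run (zeroState Q) x‖ ^ 2)) (by
    rw [← ENNReal.ofReal_sum_of_nonneg (fun _ _ => by positivity), c.run_norm, zeroState_norm,
      ENNReal.ofReal_one])

end Norm

/-! ## The width-reduced quantum circuit for information set decoding

The instance is in systematic form `(I_m | H')`, with `H'` an `m × κ` matrix and a syndrome of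
length `m`. Only `H'` and the syndrome are loaded into qubits. The columns of `(I_m | H')` are
indexed by `Fin m ⊕ Fin κ`. -/

/-- The qubits of the circuit. -/
inductive Wire (m κ : ℕ) : Type where
  /-- the selected subset of columns -/
  | sel : Fin m ⊕ Fin κ → Wire m κ
  /-- the matrix `H'` -/
  | mat : Fin m → Fin κ → Wire m κ
  /-- the syndrome -/
  | syn : Fin m → Wire m κ
  /-- one-hot counter used to create the superposition -/
  | cnt : Fin (m + 1) → Wire m κ
  /-- rows that already belong to a selected column -/
  | taken : Fin m → Wire m κ
  /-- rows that have been assigned to a selected column of `H'` -/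
  | used : Fin m → Wire m κ
  /-- one-hot: the row assigned to the current column -/
  | piv : Fin m → Wire m κ
  /-- no row with a usable pivot entry among the first `i` rows -/
  | seek : Fin (m + 1) → Wire m κ
  /-- one-hot: the first row with a usable pivot entry -/
  | src : Fin m → Wire m κ
  /-- no usable pivot entry for this column of `H'`: the selected columns are dependent -/
  | bad : Fin κ → Wire m κ
  /-- one-hot counter for the weight of the solution -/
  | wt : Fin (m + 1) → Wire m κ
  deriving DecidableEq, Fintype

open Wire

variable {m κ : ℕ}

/-- Multi-controlled NOT. -/
def mcx {Q : Type} (ctrl : List (Q × Bool)) (t : Q) : Gate Q := ⟨Base.X, ctrl, t⟩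

/-- The uniform superposition over all size-`m` subsets of the `m + κ` columns, bit by bit: if `j`
more columns have to be selected among the remaining `N - i`, then column `i` is selected with
probability `C(N - i - 1, j - 1) / C(N - i, j)`. The one-hot counter holds `j`. -/
noncomputable def superpose (m κ : ℕ) : Circuit (Wire m κ) :=
  mcx [] (cnt (Fin.last m)) ::
  (List.finRange (m + κ)).flatMap fun i =>
    let b : Wire m κ := sel (finSumFinEquiv.symm i)
    ((List.finRange m).map fun j : Fin m =>
      (⟨Base.Ry (2 * Real.arcsin (Real.sqrt
          ((Nat.choose (m + κ - i - 1) j : ℝ) / (Nat.choose (m + κ - i) (j + 1) : ℝ)))),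
        [(cnt j.succ, true)], b⟩ : Gate (Wire m κ))) ++
    ((List.finRange m).flatMap fun j : Fin m =>
      [mcx [(b, true), (cnt j.succ, true)] (cnt j.castSucc),
       mcx [(b, true), (cnt j.castSucc, true)] (cnt j.succ)])

/-- Load `(H' | s)` into the matrix and syndrome qubits. -/
def load (H' : Matrix (Fin m) (Fin κ) (ZMod 2)) (s : Fin m → ZMod 2) : Circuit (Wire m κ) :=
  ((List.finRange m).flatMap fun r => (List.finRange κ).flatMap fun c =>
    if H' r c = 1 then [mcx [] (mat r c)] else []) ++
  ((List.finRange m).flatMap fun r => if s r = 1 then [mcx [] (syn r)] else [])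

/-- If column `c` of `H'` is selected, assign the first row that is not yet taken to it. -/
def assignRow (m : ℕ) {κ : ℕ} (c : Fin κ) : Circuit (Wire m κ) :=
  (List.finRange m).map fun r =>
    mcx ((sel (Sum.inr c), true) :: (taken r, false) ::
      ((List.finRange m).filter (· < r)).map fun r' => (taken r', true)) (piv r)

/-- Pivot search: find the first row that is not taken and has a one in column `c`. -/
def pivotSearch (m : ℕ) {κ : ℕ} (c : Fin κ) : Circuit (Wire m κ) :=
  mcx [] (seek 0) ::
  (List.finRange m).flatMap fun i =>
    [mcx [(seek i.castSucc, true), (taken i, false), (mat i c, true)] (src i),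
     mcx [(seek i.castSucc, true)] (seek i.succ),
     mcx [(src i, true)] (seek i.succ)]

/-- Under the controls `ctrl`, add row `i` to row `r`, only on the columns after `c` and on the
syndrome. -/
def addRow (ctrl : List (Wire m κ × Bool)) (c : Fin κ) (i r : Fin m) : Circuit (Wire m κ) :=
  (((List.finRange κ).filter (c < ·)).map fun c' =>
    mcx (ctrl ++ [(mat i c', true)]) (mat r c')) ++
  [mcx (ctrl ++ [(syn i, true)]) (syn r)]

/-- Add the row found by the pivot search to the assigned row (unless they coincide), and then the
assigned row to all other rows with a one in column `c`. -/
def eliminate (m : ℕ) {κ : ℕ} (c : Fin κ) : Circuit (Wire m κ) :=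
  ((List.finRange m).flatMap fun r => ((List.finRange m).filter (· ≠ r)).flatMap fun i =>
    addRow [(piv r, true), (src i, true)] c i r) ++
  ((List.finRange m).flatMap fun r => ((List.finRange m).filter (· ≠ r)).flatMap fun i =>
    addRow [(piv r, true), (mat i c, true)] c r i)

/-- Mark the assigned row as taken, and clear the register that held it. -/
def releaseRow (m : ℕ) {κ : ℕ} (c : Fin κ) : Circuit (Wire m κ) :=
  ((List.finRange m).flatMap fun r =>
    [mcx [(piv r, true)] (taken r), mcx [(piv r, true)] (used r)]) ++
  (List.finRange m).map fun r =>
    mcx ((sel (Sum.inr c), true) :: (used r, true) ::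
      ((List.finRange m).filter (r < ·)).map fun r' => (used r', false)) (piv r)

/-- In-place Gaussian elimination on the selected columns: afterwards, if these are independent,
the syndrome register holds the entries of the solution of the corresponding linear system. -/
noncomputable def solve (m κ : ℕ) : Circuit (Wire m κ) :=
  ((List.finRange m).map fun r => mcx [(sel (Sum.inl r), true)] (taken r)) ++
  (List.finRange κ).flatMap fun c =>
    assignRow m c ++ pivotSearch m c ++
    [mcx [(sel (Sum.inr c), true), (seek (Fin.last m), true)] (bad c)] ++
    eliminate m c ++ Circuit.inv (pivotSearch m c) ++ releaseRow m c

/-- Accumulate the weight of the syndrome register in a one-hot counter. -/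
def accumulate (m κ : ℕ) : Circuit (Wire m κ) :=
  mcx [] (wt 0) ::
  (List.finRange m).flatMap fun r => (List.finRange m).reverse.flatMap fun j =>
    [mcx [(syn r, true), (wt j.castSucc, true)] (wt j.succ),
     mcx [(syn r, true), (wt j.succ, true)] (wt j.castSucc)]

/-- `S_t`: flip the sign of the subsets that yield a solution of weight `ω`. -/
noncomputable def flipTarget (m κ ω : ℕ) : Circuit (Wire m κ) :=
  solve m κ ++ accumulate m κ ++
  [⟨Base.Z, (List.finRange κ).map fun c => (bad c, false), wt (Fin.ofNat (m + 1) ω)⟩] ++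
  Circuit.inv (accumulate m κ) ++ Circuit.inv (solve m κ)

/-- `S_0`: flip the sign of the initial state of the registers on which `superpose` acts. -/
def flipZero (m κ : ℕ) : Circuit (Wire m κ) :=
  [mcx [] (cnt 0),
   ⟨Base.Z, ((List.finRange (m + κ)).map fun i => (sel (finSumFinEquiv.symm i), false)) ++
      ((List.finRange m).map fun j : Fin m => (cnt j.succ, false)), cnt 0⟩,
   mcx [] (cnt 0)]

/-- One step of amplitude amplification, `A S_0 A† S_t` (up to the global phase `-1`). -/
noncomputable def amplify (m κ ω : ℕ) : Circuit (Wire m κ) :=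
  flipTarget m κ ω ++ Circuit.inv (superpose m κ) ++ flipZero m κ ++ superpose m κ

/-- Quantum Prange: load the instance, create the superposition over all subsets, and perform
`j` steps of amplitude amplification. -/
noncomputable def quantumPrange (H' : Matrix (Fin m) (Fin κ) (ZMod 2)) (s : Fin m → ZMod 2)
    (ω j : ℕ) : Circuit (Wire m κ) :=
  load H' s ++ superpose m κ ++ (List.replicate j (amplify m κ ω)).flatten

/-- `⌈π / (4a)⌉`, where `a` is the square root of the proportion `C(m, ω) / C(m + κ, ω)` of
size-`m` subsets that contain the support of a given error of weight `ω`. -/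
noncomputable def maxSteps (m κ ω : ℕ) : ℕ :=
  ⌈Real.pi / (4 * Real.sqrt ((Nat.choose m ω : ℝ) / (Nat.choose (m + κ) ω : ℝ)))⌉₊

/-! ## Classical Gaussian elimination -/

/-- A linear system together with the pivot columns found so far. -/
structure Tableau (m N : ℕ) where
  A : Matrix (Fin m) (Fin N) (ZMod 2)
  s : Fin m → ZMod 2
  pivot : Fin m → Option (Fin N)

namespace Tableau

variable {m N : ℕ}

/-- Search a row without pivot that has a one in column `c`; if there is one, make `c` its pivot
column and clear the column in all other rows. -/
def step (T : Tableau m N) (c : Fin N) : Tableau m N :=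
  match (List.finRange m).find? (fun r => decide (T.pivot r = none ∧ T.A r c = 1)) with
  | none => T
  | some r =>
    { A := fun i j => if i ≠ r ∧ T.A i c = 1 then T.A i j + T.A r j else T.A i j
      s := fun i => if i ≠ r ∧ T.A i c = 1 then T.s i + T.s r else T.s i
      pivot := Function.update T.pivot r (some c) }

/-- Bit operations of `step`: a search through `m` rows, and at most `m` row additions. -/
def stepCost (m N : ℕ) : ℕ := m + m * (N + 1)

/-- Gauss-Jordan elimination, trying the columns in the given order. -/
def gauss (A : Matrix (Fin m) (Fin N) (ZMod 2)) (s : Fin m → ZMod 2) (cols : List (Fin N)) :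
    Tableau m N :=
  cols.foldl step ⟨A, s, fun _ => none⟩

/-- Every row has a pivot column. -/
def Full (T : Tableau m N) : Prop := ∀ r, T.pivot r ≠ none

instance (T : Tableau m N) : Decidable T.Full := by unfold Full; infer_instance

/-- The columns that are not pivot columns, in increasing order. -/
def rest (T : Tableau m N) : List (Fin N) :=
  (List.finRange N).filter fun j => decide (∀ r, T.pivot r ≠ some j)

/-- The `H'` of the systematic form `(I_m | H')`, the columns being reordered such that the pivot
columns come first. -/
def systematic (T : Tableau m N) : Matrix (Fin m) (Fin (N - m)) (ZMod 2) :=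
  fun r c => ((T.rest[(c : ℕ)]?).map (T.A r)).getD 0

/-- The columns of the original matrix that belong to a subset of the columns of `(I_m | H')`. -/
def columns (T : Tableau m N) (b : Fin m ⊕ Fin (N - m) → Bool) : List (Fin N) :=
  ((List.finRange m).filter fun r => b (Sum.inl r)).filterMap T.pivot ++
  ((List.finRange (N - m)).filter fun c => b (Sum.inr c)).filterMap fun c => T.rest[(c : ℕ)]?

/-- The solution of the system that vanishes outside the pivot columns. -/
def solution (T : Tableau m N) : Fin N → ZMod 2 :=
  fun j => ∑ r, if T.pivot r = some j then T.s r else 0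

end Tableau

/-! ## Hybrid-Prange -/

variable {n k : ℕ}

/-- The number `αn` of guessed zero coordinates, where `α = (1 - δ) k / n`, rounded up. -/
noncomputable def guessed (n k : ℕ) (δ : ℝ) : ℕ := ⌈(1 - δ) * ((k : ℝ) / n) * n⌉₊

/-- The length `(1 - α) n` of the shortened code. -/
noncomputable def shortLength (n k : ℕ) (δ : ℝ) : ℕ := n - guessed n k δ

theorem shortLength_le (n k : ℕ) (δ : ℝ) : shortLength n k δ ≤ n := Nat.sub_le _ _

/-- The qubits used by Hybrid-Prange: those of the quantum circuit for the shortened code. -/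
abbrev HybridWire (n k : ℕ) (δ : ℝ) : Type := Wire (n - k) (shortLength n k δ - (n - k))

/-- The number of qubits that represent the matrix. -/
noncomputable def matrixQubits (n k : ℕ) (δ : ℝ) : ℕ :=
  Set.ncard {w : HybridWire n k δ | ∃ r c, w = Wire.mat r c}

/-- `e` is a solution of the syndrome decoding instance `(H, s, ω)`. -/
def IsSolution (H : Matrix (Fin (n - k)) (Fin n) (ZMod 2)) (s : Fin (n - k) → ZMod 2) (ω : ℕ)
    (e : Fin n → ZMod 2) : Prop :=
  H.mulVec e = s ∧ hammingNorm e = ω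

instance (H : Matrix (Fin (n - k)) (Fin n) (ZMod 2)) (s : Fin (n - k) → ZMod 2) (ω : ℕ)
    (e : Fin n → ZMod 2) : Decidable (IsSolution H s ω e) := by
  unfold IsSolution; infer_instance

/-- Time for drawing the permutation, permuting the columns of `H`, and the classical Gaussian
elimination that brings the shortened matrix into systematic form. -/
def prepareCost (m n N : ℕ) : ℕ := n * n + m * n + N * Tableau.stepCost m N

/-- Time for the classical Gaussian elimination on the `l` measured columns, and for checking the
resulting vector. -/
def finishCost (m n N l : ℕ) : ℕ := l * Tableau.stepCost m N + n + (m * n + n)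

/-- One pass through the loop of Hybrid-Prange; the value is the joint distribution of the result
(`none` if the pass was not successful) and of the time taken.

A random permutation moves the guessed zero coordinates to the end; the columns there are removed,
the remaining instance is brought into systematic form (if its matrix does not have full rank, the
guess is discarded), and it is solved by the quantum circuit. As the number of subsets that yield a
solution is not known, the number of steps of amplitude amplification is drawn uniformly from
`{0, …, maxSteps}`. The measured subset determines a linear system, whose solution is extended by
zeros, and returned if it solves the given instance. -/
noncomputable def hybridPass (H : Matrix (Fin (n - k)) (Fin n) (ZMod 2))
    (s : Fin (n - k) → ZMod 2) (ω : ℕ) (δ : ℝ) : PMF (Option (Fin n → ZMod 2) × ℕ) := do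
  let N := shortLength n k δ
  let P ← PMF.uniformOfFintype (Equiv.Perm (Fin n))
  let Hs : Matrix (Fin (n - k)) (Fin N) (ZMod 2) :=
    fun r i => H r (P (Fin.castLE (shortLength_le n k δ) i))
  let T := Tableau.gauss Hs s (List.finRange N)
  let t₁ := prepareCost (n - k) n N
  if T.Full then
    let M := maxSteps (n - k) (N - (n - k)) ω
    let j ← PMF.uniformOfFintype (Fin (M + 1))
    let circuit := quantumPrange T.systematic T.s ω j
    let x ← circuit.measure
    let cols := T.columns fun i => x (Wire.sel i)
    let e₁ := (Tableau.gauss Hs s cols).solution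
    let e : Fin n → ZMod 2 := fun l =>
      if h : ((P.symm l : Fin n) : ℕ) < N then e₁ ⟨(P.symm l : Fin n), h⟩ else 0
    let t₂ := Nat.clog 2 (M + 1) + circuit.cost
    let t₃ := finishCost (n - k) n N cols.length
    pure (if IsSolution H s ω e then some e else none, t₁ + t₂ + t₃)
  else
    pure (none, t₁)

/-- Repeat a pass until it is successful, but at most `r` times; the total time is accumulated. -/
noncomputable def repeatPass {α : Type} (pass : PMF (Option α × ℕ)) : ℕ → PMF (Option α × ℕ)
  | 0 => pure (none, 0)
  | r + 1 => do
    let y ← pass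
    match y with
    | (some e, t) => pure (some e, t)
    | (none, t) => do
      let z ← repeatPass pass r
      pure (z.1, t + z.2)

/-- The expected time of the first `r` passes of Hybrid-Prange. -/
noncomputable def expectedTimeUpTo (H : Matrix (Fin (n - k)) (Fin n) (ZMod 2))
    (s : Fin (n - k) → ZMod 2) (ω : ℕ) (δ : ℝ) (r : ℕ) : ℝ≥0∞ :=
  ∑' z, repeatPass (hybridPass H s ω δ) r z * (z.2 : ℝ≥0∞)

/-- The expected time of Hybrid-Prange (repeated without limit). -/
noncomputable def expectedTime (H : Matrix (Fin (n - k)) (Fin n) (ZMod 2))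
    (s : Fin (n - k) → ZMod 2) (ω : ℕ) (δ : ℝ) : ℝ≥0∞ :=
  ⨆ r, expectedTimeUpTo H s ω δ r

/-- The probability that Hybrid-Prange has returned a vector after at most `r` passes. -/
noncomputable def haltingProb (H : Matrix (Fin (n - k)) (Fin n) (ZMod 2))
    (s : Fin (n - k) → ZMod 2) (ω : ℕ) (δ : ℝ) (r : ℕ) : ℝ≥0∞ :=
  (repeatPass (hybridPass H s ω δ) r).toOuterMeasure {z | z.1 ≠ none}

/-- Hybrid-Prange solves the instance `(H, s, ω)` in expected time at most `B`: it halts almost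
surely, every vector it may return is a solution, and its expected time is at most `B`. -/
structure HybridSolves (H : Matrix (Fin (n - k)) (Fin n) (ZMod 2)) (s : Fin (n - k) → ZMod 2)
    (ω : ℕ) (δ : ℝ) (B : ℝ) : Prop where
  halts : Filter.Tendsto (haltingProb H s ω δ) Filter.atTop (nhds 1)
  correct : ∀ r e t, (some e, t) ∈ (repeatPass (hybridPass H s ω δ) r).support →
    IsSolution H s ω e
  time : expectedTime H s ω δ ≤ ENNReal.ofReal B

/-! ## The exponent -/

/-- The binary entropy function. -/
noncomputable def H₂ (x : ℝ) : ℝ := -x * Real.logb 2 x - (1 - x) * Real.logb 2 (1 - x)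

/-- The classical running time, up to polynomial factors. -/
noncomputable def classicalTime (n k ω : ℕ) : ℝ :=
  (Nat.choose n ω : ℝ) / (Nat.choose (n - k) ω : ℝ)

/-- The time exponent `t(δ)` for rate `R` and error rate `τ`. -/
noncomputable def tExp (R τ δ : ℝ) : ℝ :=
  let α := (1 - δ) * R
  1 - (1 / 2 * ((1 - α) * H₂ (τ / (1 - α)) - (1 - R) * H₂ (τ / (1 - R)))) /
    (H₂ τ - (1 - R) * H₂ (τ / (1 - R)))

end ISD

set_option linter.unusedSectionVars false

namespace ISD

/-! ### Folds over `List.finRange` -/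

/-! Write m = n - k, let N be the shortened length, and fix the error e. The argument has a circuit
half and a probabilistic half. They meet in a lower bound for the success probability of one pass
that is linear in the number of usable column sets.

Circuit. Apart from the rotations in `superpose` and the two Z gates, every gate is a controlled
NOT, so the circuit can be followed on basis states through the contents of its registers. The
in-place elimination maintains an invertible map U, the composite of its row operations, which sends
the processed selected columns to distinct unit vectors. It ends either with U s in the syndrome
register or with a flag that proves the selected columns dependent (`act_solve`). In the first case
the weight of U s is the weight of the unique solution, so `flipTarget` negates exactly the good
sets (`run_flipTarget_selected`). By Pascal's rule `superpose` yields the uniform state. One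
amplification step is therefore a rotation by 2θ, where sin²θ is the proportion of good sets
(`run_amplify_iterate`). This proportion is unknown: it can be below a², because a set around the
support may be dependent, or above it, because there may be other solutions. Averaging over the
random number of steps still gives at least (1/4) min(1, sin²θ / a²) (`le_sum_sin_sq`).

One pass. For a permutation P let c be the number of sets of m independent columns of H that contain
the support of e and are moved to the front by P. Each of them is a good set for the shortened
instance, so P succeeds with probability at least (1/4) c / C(N-ω, m-ω). If the shortened matrix
lacks full rank then c = 0, so discarded guesses need no separate estimate. As the bound is linear
in c, double counting averages it over P. The result is (1/4) · (number of information sets around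
e) / C(n-ω, m-ω) · C(N, ω) / C(n, ω) (`le_success`).

Random matrix. A fixed set of m columns is independent with probability at least 1/4. For two sets W
and W' the joint probability exceeds the product by at most a term of order 2^(-|W' \ W|). Only
polynomially many W' are close to W, while exponentially many sets contain the support. Chebyshev's
inequality thus shows that for most matrices at least 1/8 of these sets are information sets
(`exists_forall_most_matrices`). Passing to matrices of rank m costs a factor 4, since they make up
at least a quarter of all matrices.

Time. A pass never takes longer than 170 n⁴ (M+1) with M+1 ≤ 3/a, and the expected number of passes
is at most the inverse of the success probability (`expected_repeatPass_le`). Up to a polynomial the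
product is C(n, ω) / √(C(N, ω) C(m, ω)). With Ln, L', Lm the entropy exponents of C(n, ω), C((1-α)n,
ω), C(m, ω), its logarithm is Ln - (L' + Lm)/2 = t(δ)(Ln - Lm) up to O(log n); rounding (1-α)n to an
integer also costs only O(log n) (`choose_div_sqrt_le`). The qubit bounds are a count of the
registers. -/

theorem foldl_finRange_induction {α : Type*} {m : ℕ} (f : α → Fin m → α) (P : ℕ → α → Prop)
    {a : α} (h0 : P 0 a) (hs : ∀ (i : Fin m) a, P i a → P (i + 1) (f a i)) :
    P m ((List.finRange m).foldl f a) := by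
  induction m with
  | zero => simpa using h0
  | succ m ih =>
    rw [List.finRange_succ_last, List.foldl_append, List.foldl_map]
    exact hs (Fin.last m) _ (ih (fun a i => f a i.castSucc) fun i a h => hs i.castSucc a h)

/-- The invariant is indexed by the number of entries not yet visited and so counts down. It serves
the weight counter, which is updated from its top end. -/
theorem foldl_finRange_reverse_induction {α : Type*} {m : ℕ} (f : α → Fin m → α)
    (P : ℕ → α → Prop) {a : α} (h0 : P m a) (hs : ∀ (i : Fin m) a, P (i + 1) a → P i (f a i)) :
    P 0 ((List.finRange m).reverse.foldl f a) := by
  induction m generalizing a with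
  | zero => simpa using h0
  | succ m ih =>
    rw [List.finRange_succ_last, List.reverse_append, List.foldl_append, ← List.map_reverse,
      List.foldl_map]
    exact ih (fun a i => f a i.castSucc) (hs (Fin.last m) a h0) fun i a h => hs i.castSucc a h

/-! ### Circuits as linear maps -/

variable {Q : Type} [DecidableEq Q]

namespace Circuit

theorem run_append (c d : Circuit Q) (ψ : QState Q) : run (c ++ d) ψ = run d (run c ψ) :=
  List.foldl_append

theorem run_cons (g : Gate Q) (c : Circuit Q) (ψ : QState Q) :
    run (g :: c) ψ = run c (g.apply ψ) := rfl

theorem run_flatMap {ι : Type*} (l : List ι) (f : ι → Circuit Q) (ψ : QState Q) :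
    run (l.flatMap f) ψ = l.foldl (fun φ i => run (f i) φ) ψ := by
  induction l generalizing ψ with
  | nil => rfl
  | cons i l ih => rw [List.flatMap_cons, run_append, ih]; rfl

theorem inv_append (c d : Circuit Q) : inv (c ++ d) = inv d ++ inv c := by simp [inv]

end Circuit

theorem Gate.apply_add (g : Gate Q) (φ ψ : QState Q) : g.apply (φ + ψ) = g.apply φ + g.apply ψ := by
  funext x
  simp only [Gate.apply, Pi.add_apply]
  split_ifs
  · simp only [mul_add, Finset.sum_add_distrib]
  · rfl

theorem Gate.apply_smul (g : Gate Q) (a : ℂ) (ψ : QState Q) : g.apply (a • ψ) = a • g.apply ψ := by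
  funext x
  simp only [Gate.apply, Pi.smul_apply, smul_eq_mul]
  split_ifs
  · rw [Finset.mul_sum]
    exact Finset.sum_congr rfl fun b _ => by ring
  · rfl

theorem Base.mat_inv_mul (u : Base) (i j : Bool) :
    u.inv.mat i false * u.mat false j + u.inv.mat i true * u.mat true j = if i = j then 1 else 0 := by
  cases u with
  | X => cases i <;> cases j <;> simp [Base.mat, Base.inv]
  | Z => cases i <;> cases j <;> simp [Base.mat, Base.inv]
  | Ry θ =>
    have h : (Real.sin (θ / 2) : ℂ) ^ 2 + (Real.cos (θ / 2) : ℂ) ^ 2 = 1 := by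
      exact_mod_cast Real.sin_sq_add_cos_sq (θ / 2)
    cases i <;> cases j <;>
      simp only [Base.mat, Base.inv, neg_div, Real.cos_neg, Real.sin_neg, Complex.ofReal_neg,
        if_true, Bool.false_eq_true, Bool.true_eq_false, if_false]
    · linear_combination h
    · ring
    · ring
    · linear_combination h

theorem Base.inv_inv (u : Base) : u.inv.inv = u := by cases u <;> simp [Base.inv]

theorem Gate.inv_inv (g : Gate Q) : g.inv.inv = g := by
  simp [Gate.inv, Base.inv_inv]

theorem Gate.inv_apply_apply (g : Gate Q) (ψ : QState Q) : g.inv.apply (g.apply ψ) = ψ := by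
  funext x
  have hA : ∀ y, g.inv.Active y ↔ g.Active y := fun y => Iff.rfl
  by_cases h : g.Active x
  · have h' : ∀ b, g.Active (Function.update x g.target b) := fun b => (g.active_update x b).2 h
    have e : ∀ b, Function.update x g.inv.target b = Function.update x g.target b := fun b => rfl
    have hf := g.base.mat_inv_mul (x g.target) false
    have ht := g.base.mat_inv_mul (x g.target) true
    simp only [Gate.apply, hA, h, h', e, if_true, Fintype.sum_bool, Function.update_self,
      Function.update_idem]
    simp only [Gate.inv]
    have hx : ∀ b, x g.target = b → Function.update x g.target b = x := by
      rintro b rfl; simp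
    cases hb : x g.target <;> simp only [hb, if_true, reduceCtorEq, if_false] at hf ht ⊢
    · rw [hx _ hb]; linear_combination (ψ x) * hf + ψ (Function.update x g.target true) * ht
    · rw [hx _ hb]; linear_combination (ψ x) * ht + ψ (Function.update x g.target false) * hf
  · simp only [Gate.apply, hA, h, if_false]

namespace Circuit

theorem run_add (c : Circuit Q) (φ ψ : QState Q) : run c (φ + ψ) = run c φ + run c ψ := by
  induction c generalizing φ ψ with
  | nil => rfl
  | cons g c ih => simp only [run_cons, Gate.apply_add, ih]

theorem run_smul (c : Circuit Q) (a : ℂ) (ψ : QState Q) : run c (a • ψ) = a • run c ψ := by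
  induction c generalizing ψ with
  | nil => rfl
  | cons g c ih => simp only [run_cons, Gate.apply_smul, ih]

/-- The linear map computed by a circuit. -/
noncomputable def lin (c : Circuit Q) : QState Q →ₗ[ℂ] QState Q where
  toFun := run c
  map_add' := run_add c
  map_smul' := run_smul c

theorem run_sum (c : Circuit Q) {ι : Type*} (s : Finset ι) (f : ι → QState Q) :
    run c (∑ i ∈ s, f i) = ∑ i ∈ s, run c (f i) := map_sum (lin c) f s

theorem run_sub (c : Circuit Q) (φ ψ : QState Q) : run c (φ - ψ) = run c φ - run c ψ :=
  map_sub (lin c) φ ψ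

theorem run_inv_run (c : Circuit Q) (ψ : QState Q) : run (inv c) (run c ψ) = ψ := by
  induction c generalizing ψ with
  | nil => rfl
  | cons g c ih =>
    have : inv (g :: c) = inv c ++ [g.inv] := by simp [inv]
    rw [this, run_append, run_cons, run_cons, ih]
    exact g.inv_apply_apply ψ

theorem inv_inv (c : Circuit Q) : inv (inv c) = c := by
  simp only [inv, List.map_reverse, List.reverse_reverse, List.map_map]
  exact (List.map_congr_left fun g _ => g.inv_inv).trans (List.map_id c)

theorem run_run_inv (c : Circuit Q) (ψ : QState Q) : run c (run (inv c) ψ) = ψ := by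
  conv_lhs => rw [← inv_inv c]
  rw [inv_inv (inv c)]
  exact run_inv_run (inv c) ψ

end Circuit

/-! ### Basis states -/

/-- The computational basis state `|x⟩`. -/
noncomputable def ket [Fintype Q] (x : Q → Bool) : QState Q := Pi.single x 1

section Ket

variable [Fintype Q]

theorem ket_apply (x y : Q → Bool) : ket x y = if y = x then 1 else 0 := by
  rw [ket, Pi.single_apply]

theorem zeroState_eq : zeroState Q = ket fun _ => false := by
  funext x; simp [zeroState, ket_apply]

/-- The inner product of two states. -/
noncomputable def braket (φ ψ : QState Q) : ℂ := ∑ x, star (φ x) * ψ x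

theorem braket_ket (x : Q → Bool) (ψ : QState Q) : braket (ket x) ψ = ψ x := by
  simp [braket, ket_apply]

/-- A circuit is linear and preserves norms; over `EuclideanSpace` this makes it a linear isometry,
and polarization gives the inner products. -/
theorem Circuit.braket_run (c : Circuit Q) (φ ψ : QState Q) :
    braket (run c φ) (run c ψ) = braket φ ψ := by
  let U : EuclideanSpace ℂ (Q → Bool) →ₗᵢ[ℂ] EuclideanSpace ℂ (Q → Bool) :=
    { toLinearMap := (WithLp.linearEquiv 2 ℂ _).symm.toLinearMap ∘ₗ lin c ∘ₗ
        (WithLp.linearEquiv 2 ℂ _).toLinearMap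
      norm_map' := fun v => by
        simp only [EuclideanSpace.norm_eq]
        congr 1
        exact run_norm c (WithLp.ofLp v) }
  have h := U.inner_map_map (WithLp.toLp 2 φ) (WithLp.toLp 2 ψ)
  simp only [PiLp.inner_apply] at h
  unfold braket
  simp only [RCLike.inner_apply, RCLike.star_def] at h ⊢
  simp only [mul_comm (starRingEnd ℂ _)]
  exact h

/-- The adjoint of a circuit is its inverse. This turns an amplitude of the state pulled back
through `superpose` into an overlap with the uniform state. -/
theorem braket_run_left (c : Circuit Q) (φ ψ : QState Q) :
    braket φ (Circuit.run (Circuit.inv c) ψ) = braket (Circuit.run c φ) ψ := by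
  rw [← Circuit.braket_run c, Circuit.run_run_inv]

end Ket

/-! ### Circuits of controlled NOTs -/

/-- The action of a controlled NOT on basis states. -/
def Gate.flip (g : Gate Q) (x : Q → Bool) : Q → Bool :=
  if g.Active x then Function.update x g.target (!x g.target) else x

/-- The action of a circuit of controlled NOTs on basis states. -/
def Circuit.act (c : Circuit Q) (x : Q → Bool) : Q → Bool := c.foldl (fun y g => g.flip y) x

/-- All gates of the circuit are controlled NOTs. -/
def Circuit.Classical (c : Circuit Q) : Prop := ∀ g ∈ c, g.base = Base.X

theorem Gate.apply_ket_of_not_active [Fintype Q] (g : Gate Q) {x : Q → Bool} (h : ¬ g.Active x) :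
    g.apply (ket x) = ket x := by
  funext y
  unfold Gate.apply
  split_ifs with hy
  · have hne : ∀ b, Function.update y g.target b ≠ x := by
      rintro b rfl; exact h ((g.active_update y b).2 hy)
    have hne' : y ≠ x := by rintro rfl; exact h hy
    simp [ket_apply, hne, hne']
  · rfl

theorem Gate.apply_ket_of_active [Fintype Q] (g : Gate Q) {x : Q → Bool} (h : g.Active x) :
    g.apply (ket x) = g.base.mat false (x g.target) • ket (Function.update x g.target false)
      + g.base.mat true (x g.target) • ket (Function.update x g.target true) := by
  funext y
  simp only [Gate.apply, Pi.add_apply, Pi.smul_apply, ket_apply, smul_eq_mul, Fintype.sum_bool]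
  -- The condition says that `y` agrees with `x` away from the target; only such `y` receive
  -- amplitude from `ket x`.
  by_cases hy : y = Function.update x g.target (y g.target)
  · have hact : g.Active y := by rw [hy]; exact (g.active_update x _).2 h
    have hU : ∀ b, Function.update y g.target b = x ↔ b = x g.target := fun b =>
      ⟨fun e => by rw [← e]; simp, fun e => by rw [e, hy]; simp⟩
    have hV : ∀ b, y = Function.update x g.target b ↔ y g.target = b := fun b =>
      ⟨fun e => by rw [e]; simp, fun e => by rw [← e]; exact hy⟩
    rw [if_pos hact]
    simp only [hU, hV]
    cases y g.target <;> cases x g.target <;> simp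
  · have hyx : y ≠ x := by rintro rfl; simp at hy
    have hU : ∀ b, Function.update y g.target b ≠ x := fun b e => hy (by rw [← e]; simp)
    have hV : ∀ b, y ≠ Function.update x g.target b := fun b e =>
      hy (by rw [e]; simp)
    simp [hU, hV, hyx]

theorem Gate.apply_ket [Fintype Q] (g : Gate Q) (hg : g.base = Base.X) (x : Q → Bool) :
    g.apply (ket x) = ket (g.flip x) := by
  unfold Gate.flip
  split_ifs with h
  · rw [g.apply_ket_of_active h, hg]
    cases hx : x g.target <;> simp [Base.mat]
  · exact g.apply_ket_of_not_active h

theorem Gate.flip_flip (g : Gate Q) (x : Q → Bool) : g.flip (g.flip x) = x := by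
  unfold Gate.flip
  by_cases h : g.Active x
  · have := (g.active_update x (!x g.target)).2 h
    simp [h, this]
  · simp [h]

namespace Circuit

theorem run_ket [Fintype Q] {c : Circuit Q} (hc : c.Classical) (x : Q → Bool) :
    run c (ket x) = ket (act c x) := by
  induction c generalizing x with
  | nil => rfl
  | cons g c ih =>
    rw [run_cons, g.apply_ket (hc g (by simp)), ih fun g' h => hc g' (by simp [h])]
    rfl

theorem act_append (c d : Circuit Q) (x : Q → Bool) : act (c ++ d) x = act d (act c x) :=
  List.foldl_append

theorem act_cons (g : Gate Q) (c : Circuit Q) (x : Q → Bool) :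
    act (g :: c) x = act c (g.flip x) := rfl

theorem act_nil (x : Q → Bool) : act ([] : Circuit Q) x = x := rfl

theorem act_flatMap {ι : Type*} (l : List ι) (f : ι → Circuit Q) (x : Q → Bool) :
    act (l.flatMap f) x = l.foldl (fun y i => act (f i) y) x := by
  induction l generalizing x with
  | nil => rfl
  | cons i l ih => rw [List.flatMap_cons, act_append, ih]; rfl

theorem act_map {ι : Type*} (l : List ι) (f : ι → Gate Q) (x : Q → Bool) :
    act (l.map f) x = l.foldl (fun y i => (f i).flip y) x := List.foldl_map

theorem Classical.append {c d : Circuit Q} (hc : c.Classical) (hd : d.Classical) :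
    Classical (c ++ d) := by
  intro g hg
  rcases List.mem_append.1 hg with h | h
  exacts [hc g h, hd g h]

theorem Classical.cons {g : Gate Q} {c : Circuit Q} (hg : g.base = Base.X) (hc : c.Classical) :
    Classical (g :: c) := by
  intro g' hg'
  rcases List.mem_cons.1 hg' with rfl | h
  exacts [hg, hc g' h]

theorem classical_nil : Classical ([] : Circuit Q) := fun _ h => absurd h (by simp)

theorem classical_flatMap {ι : Type*} {l : List ι} {f : ι → Circuit Q}
    (h : ∀ i, (f i).Classical) : Classical (l.flatMap f) := by
  intro g hg
  obtain ⟨i, -, hi⟩ := List.mem_flatMap.1 hg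
  exact h i g hi

theorem classical_map {ι : Type*} {l : List ι} {f : ι → Gate Q}
    (h : ∀ i, (f i).base = Base.X) : Classical (l.map f) := by
  intro g hg
  obtain ⟨i, -, rfl⟩ := List.mem_map.1 hg
  exact h i

theorem Classical.inv {c : Circuit Q} (hc : c.Classical) : Classical (inv c) := by
  intro g hg
  simp only [Circuit.inv, List.mem_reverse, List.mem_map] at hg
  obtain ⟨g', hg', rfl⟩ := hg
  simp [Gate.inv, hc g' hg', Base.inv]

theorem act_inv_act {c : Circuit Q} (hc : c.Classical) (x : Q → Bool) :
    act (inv c) (act c x) = x := by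
  induction c generalizing x with
  | nil => rfl
  | cons g c ih =>
    have : inv (g :: c) = inv c ++ [g.inv] := by simp [inv]
    rw [this, act_append, act_cons, act_cons, ih fun g' h => hc g' (by simp [h])]
    have : ∀ y, g.inv.flip y = g.flip y := fun y => rfl
    rw [act_nil, this, g.flip_flip]

/-- A qubit that is not the target of any gate keeps its value. -/
theorem act_of_forall_target_ne {c : Circuit Q} {q : Q} (h : ∀ g ∈ c, g.target ≠ q)
    (x : Q → Bool) : act c x q = x q := by
  induction c generalizing x with
  | nil => rfl
  | cons g c ih =>
    rw [act_cons, ih fun g' h' => h g' (by simp [h'])]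
    unfold Gate.flip
    split_ifs
    · exact Function.update_of_ne (h g (by simp)).symm _ _
    · rfl

end Circuit

end ISD

namespace ISD

/-! ### The registers of the circuit -/

/-- The contents of the registers of the circuit in a basis state. -/
structure Reg (m κ : ℕ) where
  sel : Fin m ⊕ Fin κ → Bool
  mat : Fin m → Fin κ → Bool
  syn : Fin m → Bool
  cnt : Fin (m + 1) → Bool
  taken : Fin m → Bool
  used : Fin m → Bool
  piv : Fin m → Bool
  seek : Fin (m + 1) → Bool
  src : Fin m → Bool
  bad : Fin κ → Bool
  wt : Fin (m + 1) → Bool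

variable {m κ : ℕ}

namespace Reg

/-- The basis state with the given register contents. -/
def state (R : Reg m κ) : Wire m κ → Bool
  | .sel i => R.sel i
  | .mat r c => R.mat r c
  | .syn r => R.syn r
  | .cnt i => R.cnt i
  | .taken r => R.taken r
  | .used r => R.used r
  | .piv r => R.piv r
  | .seek i => R.seek i
  | .src r => R.src r
  | .bad c => R.bad c
  | .wt i => R.wt i

section
variable (R : Reg m κ)
@[simp] theorem state_sel (i) : R.state (.sel i) = R.sel i := rfl
@[simp] theorem state_mat (i j) : R.state (.mat i j) = R.mat i j := rfl
@[simp] theorem state_syn (i) : R.state (.syn i) = R.syn i := rfl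
@[simp] theorem state_cnt (i) : R.state (.cnt i) = R.cnt i := rfl
@[simp] theorem state_taken (i) : R.state (.taken i) = R.taken i := rfl
@[simp] theorem state_used (i) : R.state (.used i) = R.used i := rfl
@[simp] theorem state_piv (i) : R.state (.piv i) = R.piv i := rfl
@[simp] theorem state_seek (i) : R.state (.seek i) = R.seek i := rfl
@[simp] theorem state_src (i) : R.state (.src i) = R.src i := rfl
@[simp] theorem state_bad (i) : R.state (.bad i) = R.bad i := rfl
@[simp] theorem state_wt (i) : R.state (.wt i) = R.wt i := rfl

theorem update_sel (i b) : Function.update R.state (.sel i) b =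
    { R with sel := Function.update R.sel i b }.state := by
  funext q; cases q <;> simp [Function.update_apply]
theorem update_mat (i j b) : Function.update R.state (.mat i j) b =
    { R with mat := Function.update R.mat i (Function.update (R.mat i) j b) }.state := by
  funext q
  cases q with
  | mat r c => by_cases h : r = i <;> by_cases h' : c = j <;> simp [h, h']
  | _ => simp
theorem update_syn (i b) : Function.update R.state (.syn i) b =
    { R with syn := Function.update R.syn i b }.state := by
  funext q; cases q <;> simp [Function.update_apply]
theorem update_cnt (i b) : Function.update R.state (.cnt i) b =
    { R with cnt := Function.update R.cnt i b }.state := by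
  funext q; cases q <;> simp [Function.update_apply]
theorem update_taken (i b) : Function.update R.state (.taken i) b =
    { R with taken := Function.update R.taken i b }.state := by
  funext q; cases q <;> simp [Function.update_apply]
theorem update_used (i b) : Function.update R.state (.used i) b =
    { R with used := Function.update R.used i b }.state := by
  funext q; cases q <;> simp [Function.update_apply]
theorem update_piv (i b) : Function.update R.state (.piv i) b =
    { R with piv := Function.update R.piv i b }.state := by
  funext q; cases q <;> simp [Function.update_apply]
theorem update_seek (i b) : Function.update R.state (.seek i) b =
    { R with seek := Function.update R.seek i b }.state := by
  funext q; cases q <;> simp [Function.update_apply]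
theorem update_src (i b) : Function.update R.state (.src i) b =
    { R with src := Function.update R.src i b }.state := by
  funext q; cases q <;> simp [Function.update_apply]
theorem update_wt (i b) : Function.update R.state (.wt i) b =
    { R with wt := Function.update R.wt i b }.state := by
  funext q; cases q <;> simp [Function.update_apply]
end

theorem state_injective : Function.Injective (state (m := m) (κ := κ)) := by
  intro R R' h
  have H := fun q => congrFun h q
  cases R; cases R'
  simp only [Reg.mk.injEq]
  exact ⟨funext fun i => H (.sel i), funext fun i => funext fun j => H (.mat i j),
    funext fun i => H (.syn i), funext fun i => H (.cnt i), funext fun i => H (.taken i),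
    funext fun i => H (.used i), funext fun i => H (.piv i), funext fun i => H (.seek i),
    funext fun i => H (.src i), funext fun i => H (.bad i), funext fun i => H (.wt i)⟩

end Reg

theorem mcx_flip {Q : Type} [DecidableEq Q] (ctrl : List (Q × Bool)) (t : Q) (x : Q → Bool) :
    (mcx ctrl t).flip x =
      if ∀ p ∈ ctrl, p.1 ≠ t → x p.1 = p.2 then Function.update x t (!x t) else x := by
  unfold Gate.flip
  exact if_congr Iff.rfl rfl rfl

/-- A fold that assigns the entries of a function one after the other. -/
theorem foldl_finRange_update_of_or {α β : Type*} {m : ℕ} (S : (Fin m → β) → α)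
    (f : α → Fin m → α) (g v : Fin m → β)
    (h : ∀ i g', g' i = g i → (∀ j, g' j = g j ∨ g' j = v j) →
      f (S g') i = S (Function.update g' i (v i))) :
    (List.finRange m).foldl f (S g) = S v := by
  have := foldl_finRange_induction f
    (fun j a => a = S fun r => if (r : ℕ) < j then v r else g r) (a := S g) (by simp) (by
      rintro i a rfl
      rw [h i _ (by simp) (fun j => by split_ifs <;> simp)]
      congr 1
      funext r
      by_cases hr : r = i
      · subst hr; simp
      · have : (r : ℕ) ≠ i := fun h => hr (Fin.ext h)
        rw [Function.update_of_ne hr]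
        by_cases h1 : (r : ℕ) < i
        · rw [if_pos h1, if_pos (by omega)]
        · rw [if_neg h1, if_neg (by omega)])
  simpa using this

theorem foldl_finRange_update {α β : Type*} {m : ℕ} (S : (Fin m → β) → α) (f : α → Fin m → α)
    (g v : Fin m → β)
    (h : ∀ i g', g' i = g i → f (S g') i = S (Function.update g' i (v i))) :
    (List.finRange m).foldl f (S g) = S v :=
  foldl_finRange_update_of_or S f g v fun i g' hi _ => h i g' hi

open Circuit Wire

/-! ### Loading the instance -/

/-- The registers after loading `(H' | s)`. -/
def Reg.loaded (H' : Matrix (Fin m) (Fin κ) (ZMod 2)) (s : Fin m → ZMod 2) : Reg m κ where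
  sel _ := false
  mat r c := decide (H' r c = 1)
  syn r := decide (s r = 1)
  cnt _ := false
  taken _ := false
  used _ := false
  piv _ := false
  seek _ := false
  src _ := false
  bad _ := false
  wt _ := false

theorem classical_load (H' : Matrix (Fin m) (Fin κ) (ZMod 2)) (s : Fin m → ZMod 2) :
    (load H' s).Classical := by
  refine Classical.append (classical_flatMap fun r => classical_flatMap fun c => ?_)
    (classical_flatMap fun r => ?_) <;> split_ifs
  · exact Classical.cons rfl classical_nil
  · exact classical_nil
  · exact Classical.cons rfl classical_nil
  · exact classical_nil

theorem act_load (H' : Matrix (Fin m) (Fin κ) (ZMod 2)) (s : Fin m → ZMod 2) :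
    act (load H' s) (fun _ => false) = (Reg.loaded H' s).state := by
  let Z : Reg m κ := { Reg.loaded H' s with mat := fun _ _ => false, syn := fun _ => false }
  have h0 : (fun _ => false) = Z.state := by funext q; cases q <;> rfl
  rw [h0, load, act_append, act_flatMap, act_flatMap]
  have h1 : (List.finRange m).foldl (fun y r => act ((List.finRange κ).flatMap fun c =>
      if H' r c = 1 then [mcx [] (mat r c)] else []) y) Z.state =
      { Z with mat := fun r c => decide (H' r c = 1) }.state := by
    refine foldl_finRange_update (fun g => { Z with mat := g }.state) _ Z.mat _ fun r g hg => ?_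
    rw [act_flatMap]
    have := foldl_finRange_update
      (fun u => { Z with mat := Function.update g r u }.state)
      (fun y c => act (if H' r c = 1 then [mcx [] (mat r c)] else []) y) (g r)
      (fun c => decide (H' r c = 1)) fun c u hu => ?_
    · simpa using this
    · have hz : u c = false := by rw [hu, hg]
      split_ifs with h
      · simp [act_cons, act_nil, mcx_flip, Reg.update_mat, h, hz]
      · simp only [act_nil, h, decide_false]
        rw [← hz, Function.update_eq_self]
  rw [h1]
  refine foldl_finRange_update
    (fun g => { Z with mat := fun r c => decide (H' r c = 1), syn := g }.state) _ Z.syn _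
    fun r g hg => ?_
  have hz : g r = false := hg
  split_ifs with h
  · simp [act_cons, act_nil, mcx_flip, Reg.update_syn, h, hz]
  · simp only [act_nil, h, decide_false]
    rw [← hz, Function.update_eq_self]

/-! ### The steps of the Gaussian elimination -/

theorem act_markIdentity (R : Reg m κ) :
    act ((List.finRange m).map fun r => mcx [(sel (Sum.inl r), true)] (taken r)) R.state =
      { R with taken := fun r => R.taken r ^^ R.sel (Sum.inl r) }.state := by
  rw [act_map]
  refine foldl_finRange_update (fun g => { R with taken := g }.state) _ R.taken _ fun r g hg => ?_
  rw [mcx_flip]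
  cases h : R.sel (Sum.inl r)
  · simp [h, ← hg]
  · simp [h, Reg.update_taken, hg]

/-- Gate `r` fires only if `r` is free and every earlier row is taken, so at most one gate fires,
and no gate reads `piv`. The xor appears because `piv` is not assumed to be clear. -/
theorem act_assignRow (R : Reg m κ) (c : Fin κ) :
    act (assignRow m c) R.state =
      { R with piv := fun r => R.piv r ^^ (decide (R.sel (Sum.inr c) = true ∧ R.taken r = false ∧
          ∀ r' < r, R.taken r' = true)) }.state := by
  rw [assignRow, act_map]
  refine foldl_finRange_update (fun g => { R with piv := g }.state) _ R.piv _ fun r g hg => ?_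
  rw [mcx_flip]
  by_cases h : R.sel (Sum.inr c) = true ∧ R.taken r = false ∧ ∀ r' < r, R.taken r' = true
  · rw [if_pos (by simpa using h), Reg.update_piv]
    have hd := decide_eq_true h
    simp only [hd, hg, Bool.xor_true, Reg.state_piv]
  · rw [if_neg]
    · simp [h, ← hg]
    · simpa using h

/-- Row `r` has a usable pivot entry in column `c`. -/
def Reg.Usable (R : Reg m κ) (c : Fin κ) (r : Fin m) : Prop :=
  R.taken r = false ∧ R.mat r c = true

instance (R : Reg m κ) (c : Fin κ) (r : Fin m) : Decidable (R.Usable c r) := by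
  unfold Reg.Usable; infer_instance

/-- The registers after the pivot search. -/
def Reg.searched (R : Reg m κ) (c : Fin κ) : Reg m κ :=
  { R with
    seek := fun i => decide (∀ r : Fin m, (r : ℕ) < i → ¬ R.Usable c r)
    src := fun i => decide (R.Usable c i ∧ ∀ r < i, ¬ R.Usable c r) }

theorem classical_pivotSearch (c : Fin κ) : (pivotSearch m c).Classical :=
  Classical.cons rfl (classical_flatMap fun _ =>
    Classical.cons rfl (Classical.cons rfl (Classical.cons rfl classical_nil)))

theorem act_pivotSearch (R : Reg m κ) (c : Fin κ) (hseek : R.seek = fun _ => false)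
    (hsrc : R.src = fun _ => false) :
    act (pivotSearch m c) R.state = (R.searched c).state := by
  rw [pivotSearch, act_cons, act_flatMap]
  -- Invariant: after `j` rounds `seek` has its final value up to index `j` and `src` below index
  -- `j`; beyond that both are still false.
  have := foldl_finRange_induction (fun y i => act [mcx [(seek i.castSucc, true),
      (taken i, false), (mat i c, true)] (src i), mcx [(seek i.castSucc, true)] (seek i.succ),
     mcx [(src i, true)] (seek i.succ)] y)
    (fun j a => a = { R with
      seek := fun i => decide ((i : ℕ) ≤ j ∧ ∀ r : Fin m, (r : ℕ) < i → ¬ R.Usable c r)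
      src := fun i => decide ((i : ℕ) < j ∧ R.Usable c i ∧ ∀ r < i, ¬ R.Usable c r) }.state)
    (a := (mcx [] (seek 0)).flip R.state) ?_ ?_
  · rw [this]
    congr 1
    simp only [Reg.searched, Reg.mk.injEq, true_and, and_true]
    constructor
    · funext i
      simp [Nat.le_of_lt_succ i.2]
    · funext i
      simp
  · rw [mcx_flip, if_pos (by simp), Reg.update_seek]
    congr 1
    simp only [Reg.mk.injEq, true_and, and_true]
    constructor
    · funext i
      by_cases hi : i = 0
      · subst hi; simp [hseek]
      · have : (i : ℕ) ≠ 0 := fun h => hi (Fin.ext h)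
        simp [hi, hseek]
    · simp [hsrc]
  · rintro i a rfl
    have hne : (i.castSucc : Fin (m + 1)) ≠ i.succ := (Fin.castSucc_lt_succ).ne
    -- Three situations. If row `i` is the first usable one, all three gates fire and the third
    -- undoes the second. If the search goes on past `i`, only the second fires. If it is already
    -- over, none does.
    by_cases hs : ∀ r : Fin m, (r : ℕ) < i → ¬ R.Usable c r
    · have hs' : ∀ r : Fin m, r < i → ¬ R.Usable c r := hs
      by_cases hu : R.Usable c i
      · rw [act_cons, mcx_flip, if_pos (by simpa using ⟨hs', hu.1, hu.2⟩), Reg.update_src, act_cons,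
          mcx_flip, if_pos (by simpa using fun _ => hs'), Reg.update_seek, act_cons, mcx_flip,
          if_pos (by simp [hu]), Reg.update_seek, act_nil]
        congr 1
        simp only [Reg.mk.injEq, true_and, and_true]
        constructor
        · funext l
          by_cases hl : l = i.succ
          · subst hl
            have : ¬ ∀ r : Fin m, (r : ℕ) < i + 1 → ¬ R.Usable c r := fun h => h i (by simp) hu
            simpa using this
          · have : (l : ℕ) ≠ i + 1 := fun h => hl (Fin.ext h)
            have e : (l : ℕ) ≤ i + 1 ↔ (l : ℕ) ≤ i := by omega
            simp [hl, e]
        · funext l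
          by_cases hl : l = i
          · subst hl; simpa [hu] using hs'
          · have : (l : ℕ) ≠ i := fun h => hl (Fin.ext h)
            have e : (l : ℕ) < i + 1 ↔ (l : ℕ) < i := by omega
            simp only [Function.update_of_ne hl, e]
      · have hu' : R.taken i = false → R.mat i c = false := by simpa [Reg.Usable] using hu
        rw [act_cons, mcx_flip, if_neg (by simpa using fun _ => hu'), act_cons, mcx_flip,
          if_pos (by simpa using fun _ => hs'), Reg.update_seek, act_cons, mcx_flip, if_neg (by simp), act_nil]
        congr 1
        simp only [Reg.mk.injEq, true_and, and_true]
        constructor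
        · funext l
          by_cases hl : l = i.succ
          · subst hl
            have : ∀ r : Fin m, (r : ℕ) < i + 1 → ¬ R.Usable c r := fun r h => by
              rcases Nat.lt_succ_iff_lt_or_eq.1 h with h | h
              · exact hs r h
              · rwa [show r = i from Fin.ext h]
            simpa using this
          · have : (l : ℕ) ≠ i + 1 := fun h => hl (Fin.ext h)
            have e : (l : ℕ) ≤ i + 1 ↔ (l : ℕ) ≤ i := by omega
            simp [hl, e]
        · funext l
          by_cases hl : l = i
          · subst hl; simp [hu]
          · have : (l : ℕ) ≠ i := fun h => hl (Fin.ext h)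
            have e : (l : ℕ) < i + 1 ↔ (l : ℕ) < i := by omega
            simp only [e]
    · have hs' : ¬ ∀ r : Fin m, r < i → ¬ R.Usable c r := hs
      rw [act_cons, mcx_flip, if_neg, act_cons, mcx_flip, if_neg, act_cons, mcx_flip,
        if_neg (by simp), act_nil]
      · congr 1
        simp only [Reg.mk.injEq, true_and, and_true]
        constructor
        · funext l
          by_cases hl : l = i.succ
          · subst hl
            have : ¬ ∀ r : Fin m, (r : ℕ) < i + 1 → ¬ R.Usable c r := fun h =>
              hs fun r hr => h r (by omega)
            simp only [Fin.val_succ, this, and_false]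
          · have : (l : ℕ) ≠ i + 1 := fun h => hl (Fin.ext h)
            have e : (l : ℕ) ≤ i + 1 ↔ (l : ℕ) ≤ i := by omega
            simp only [e]
        · funext l
          by_cases hl : l = i
          · subst hl; simp only [hs', and_false]
          · have : (l : ℕ) ≠ i := fun h => hl (Fin.ext h)
            have e : (l : ℕ) < i + 1 ↔ (l : ℕ) < i := by omega
            simp only [e]
      · intro h
        have := h (seek i.castSucc, true) (by simp) (by simp [hne])
        exact hs (of_decide_eq_true this).2
      · intro h
        have := h (seek i.castSucc, true) (by simp) (by simp)
        exact hs (of_decide_eq_true this).2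

/-- This uncomputation still applies after the elimination, because that changes neither column `c`
nor `taken`: the registers keep the form `searched`. -/
theorem act_inv_pivotSearch (R : Reg m κ) (c : Fin κ) (hseek : R.seek = fun _ => false)
    (hsrc : R.src = fun _ => false) :
    act (Circuit.inv (pivotSearch m c)) (R.searched c).state = R.state := by
  rw [← act_pivotSearch R c hseek hsrc, act_inv_act (classical_pivotSearch c)]

end ISD

/-! ### Row additions, clearing of a column, and release of the assigned row -/

namespace ISD
variable {m κ : ℕ}
open Circuit Wire

/-- Row `i` is added to row `r`, on the columns after `c` and on the syndrome. -/
def Reg.rowAdd (R : Reg m κ) (c : Fin κ) (i r : Fin m) : Reg m κ :=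
  { R with
    mat := fun a b => if a = r ∧ c < b then R.mat a b ^^ R.mat i b else R.mat a b
    syn := fun a => if a = r then R.syn a ^^ R.syn i else R.syn a }

/-- The controls may read matrix entries only in columns up to `c`, and no syndrome bits. The block
changes none of what they read, so it acts as a whole or not at all. -/
theorem act_addRow (R : Reg m κ) (ctrl : List (Wire m κ × Bool)) (c : Fin κ) {i r : Fin m}
    (hir : i ≠ r) (hm : ∀ p ∈ ctrl, ∀ a b, p.1 = mat a b → b ≤ c)
    (hs : ∀ p ∈ ctrl, ∀ a, p.1 ≠ syn a) :
    act (addRow ctrl c i r) R.state =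
      if ∀ p ∈ ctrl, R.state p.1 = p.2 then (R.rowAdd c i r).state else R.state := by
  have hval : ∀ p ∈ ctrl, ∀ g, (∀ a, ∀ b ≤ c, g a b = R.mat a b) →
      ({ R with mat := g } : Reg m κ).state p.1 = R.state p.1 := by
    rintro ⟨q, b⟩ hp g hg
    cases q with
    | mat x y => exact hg _ _ (hm _ hp _ _ rfl)
    | syn x => exact absurd rfl (hs _ hp x)
    | _ => rfl
  have hctrl : ∀ g t, (∀ a, ∀ b ≤ c, g a b = R.mat a b) → (∀ p ∈ ctrl, p.1 ≠ t) →
      ((∀ p ∈ ctrl, p.1 ≠ t → ({ R with mat := g } : Reg m κ).state p.1 = p.2) ↔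
        ∀ p ∈ ctrl, R.state p.1 = p.2) := by
    intro g t hg ht
    refine forall₂_congr fun p hp => ?_
    rw [hval p hp g hg]
    simp [ht p hp]
  rw [addRow, act_append, act_map, List.foldl_filter]
  let row : Fin κ → Bool := fun b =>
    if c < b ∧ ∀ p ∈ ctrl, R.state p.1 = p.2 then R.mat r b ^^ R.mat i b else R.mat r b
  have hrow : ∀ b ≤ c, row b = R.mat r b := fun b hb => if_neg fun h => absurd h.1 (not_lt.2 hb)
  have h1 : (List.finRange κ).foldl (fun y c' => if decide (c < c') = true then
      (mcx (ctrl ++ [(mat i c', true)]) (mat r c')).flip y else y) R.state =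
      { R with mat := Function.update R.mat r row }.state := by
    have := foldl_finRange_update_of_or
      (fun u => { R with mat := Function.update R.mat r u }.state)
      (fun y c' => if decide (c < c') = true then
        (mcx (ctrl ++ [(mat i c', true)]) (mat r c')).flip y else y)
      (R.mat r) row fun b u hu huv => ?_
    · simpa using this
    · have hu' : ∀ a, ∀ b ≤ c, Function.update R.mat r u a b = R.mat a b := by
        intro a b' hb'
        by_cases ha : a = r
        · subst ha
          rw [Function.update_self]
          rcases huv b' with h | h
          · exact h
          · rw [h, hrow b' hb']
        · rw [Function.update_of_ne ha]
      by_cases hb : c < b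
      · have ht : ∀ p ∈ ctrl, p.1 ≠ mat r b := fun p hp h => absurd (hm p hp _ _ h) (not_le.2 hb)
        simp only [hb, decide_true, if_true]
        rw [mcx_flip]
        simp only [List.forall_mem_append, hctrl _ _ hu' ht, List.forall_mem_singleton,
          Reg.state_mat, Function.update_of_ne hir, ne_eq, Wire.mat.injEq, hir, false_and,
          not_false_eq_true, true_implies, Function.update_self]
        by_cases hc : ∀ p ∈ ctrl, R.state p.1 = p.2
        · have hrb : row b = (R.mat r b ^^ R.mat i b) := if_pos ⟨hb, hc⟩
          rw [hrb]
          cases hib : R.mat i b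
          · rw [if_neg (by simp)]
            simp [← hu]
          · rw [if_pos ⟨hc, rfl⟩, Reg.update_mat]
            simp [hu]
        · have hrb : row b = R.mat r b := if_neg fun h => hc h.2
          rw [if_neg fun h => hc h.1, hrb, ← hu, Function.update_eq_self]
      · simp only [hb, decide_false, Bool.false_eq_true, if_false, hrow b (not_lt.1 hb), ← hu,
          Function.update_eq_self]
  rw [h1, act_cons, act_nil, mcx_flip]
  have hu : ∀ a, ∀ b ≤ c, Function.update R.mat r row a b = R.mat a b := by
    intro a b hb
    by_cases ha : a = r
    · subst ha; rw [Function.update_self, hrow b hb]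
    · rw [Function.update_of_ne ha]
  simp only [List.forall_mem_append, hctrl _ _ hu fun p hp => hs p hp r,
    List.forall_mem_singleton, Reg.state_syn, ne_eq, Wire.syn.injEq, hir, not_false_eq_true,
    true_implies]
  by_cases hc : ∀ p ∈ ctrl, R.state p.1 = p.2
  · rw [if_pos hc]
    have hmat : Function.update R.mat r row = (R.rowAdd c i r).mat := by
      funext a b
      by_cases ha : a = r
      · subst ha
        simp only [Function.update_self, Reg.rowAdd, true_and]
        exact if_congr (and_iff_left hc) rfl rfl
      · simp [Reg.rowAdd, ha]
    rw [hmat, Reg.update_syn]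
    have hsyn : (if (∀ p ∈ ctrl, R.state p.1 = p.2) ∧ R.syn i = true
        then Function.update R.syn r (!R.syn r) else R.syn) = (R.rowAdd c i r).syn := by
      funext a
      by_cases ha : a = r
      · subst ha
        cases h : R.syn i
        · rw [if_neg (by simp)]; simp [Reg.rowAdd, h]
        · rw [if_pos ⟨hc, rfl⟩]; simp [Reg.rowAdd, h]
      · simp only [Reg.rowAdd, ha, if_false]
        split_ifs
        · rw [Function.update_of_ne ha]
        · rfl
    change _ = ({ R with mat := (R.rowAdd c i r).mat, syn := (R.rowAdd c i r).syn } :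
      Reg m κ).state
    rw [← hsyn]
    split_ifs <;> rfl
  · rw [if_neg hc, if_neg fun h => hc h.1]
    congr 1
    have : row = R.mat r := by funext b; exact if_neg fun h => hc h.2
    rw [this, Function.update_eq_self]

/-- The rows with a one in column `c` are cleared by adding row `r`. -/
def Reg.clear (R : Reg m κ) (c : Fin κ) (r : Fin m) : Reg m κ :=
  { R with
    mat := fun a b => if a ≠ r ∧ R.mat a c = true ∧ c < b then R.mat a b ^^ R.mat r b
      else R.mat a b
    syn := fun a => if a ≠ r ∧ R.mat a c = true then R.syn a ^^ R.syn r else R.syn a }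

/-- For families of blocks controlled by a one-hot register: only the block at `i₀` acts, the others
fix the state both before and after it. -/
theorem foldl_finRange_single {α : Type*} (f : α → Fin m → α) (i₀ : Fin m) (a b : α)
    (h0 : f a i₀ = b) (ha : ∀ i ≠ i₀, f a i = a) (hb : ∀ i ≠ i₀, f b i = b) :
    (List.finRange m).foldl f a = b := by
  have := foldl_finRange_induction f (fun j y => y = if (i₀ : ℕ) < j then b else a) (a := a)
    (by simp) (by
      rintro i y rfl
      by_cases h : i = i₀
      · subst h; simp [h0]
      · have h' : (i₀ : ℕ) ≠ i := fun e => h (Fin.ext e.symm)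
        by_cases h1 : (i₀ : ℕ) < i
        · rw [if_pos h1, if_pos (by omega), hb i h]
        · rw [if_neg h1, if_neg (by omega), ha i h])
  simpa using this

theorem foldl_finRange_fixed {α : Type*} (f : α → Fin m → α) (a : α) (h : ∀ i, f a i = a) :
    (List.finRange m).foldl f a = a :=
  foldl_finRange_induction f (fun _ y => y = a) rfl fun i y hy => by rw [hy, h]

theorem act_eliminate_of_piv_eq_false (R : Reg m κ) (c : Fin κ) (h : ∀ r, R.piv r = false) :
    act (eliminate m c) R.state = R.state := by
  rw [eliminate, act_append]
  refine (congrArg (act _) (a₂ := R.state) ?_).trans ?_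
  all_goals
    rw [act_flatMap]
    refine foldl_finRange_fixed _ _ fun r => ?_
    rw [act_flatMap, List.foldl_filter, foldl_finRange_fixed]
    intro i
    split_ifs with hi
    · have hi : i ≠ r := of_decide_eq_true hi
      rw [act_addRow _ _ _ (by first | exact hi | exact hi.symm) (by simp) (by simp),
        if_neg (by simp [h])]
    · rfl

/-- Since `piv` and `src` are one-hot, the first half reduces to the single addition of `i₀` to
`r₀`, and to nothing if they coincide. In the second half only the additions of `r₀` to rows with a
one in column `c` survive. These controls read the original column, which no addition changes. -/
theorem act_eliminate (R : Reg m κ) (c : Fin κ) (r₀ i₀ : Fin m)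
    (hp : ∀ r, R.piv r = decide (r = r₀)) (hi : ∀ i, R.src i = decide (i = i₀)) :
    act (eliminate m c) R.state =
      ((if i₀ = r₀ then R else R.rowAdd c i₀ r₀).clear c r₀).state := by
  have key1 : ∀ R' : Reg m κ, (∀ r, R'.piv r = decide (r = r₀)) →
      (∀ i, R'.src i = decide (i = i₀)) → ∀ r i,
      (if decide (i ≠ r) = true then
        act (addRow [(piv r, true), (src i, true)] c i r) R'.state else R'.state) =
        if r = r₀ ∧ i = i₀ ∧ i ≠ r then (R'.rowAdd c i r).state else R'.state := by
    intro R' hp hi r i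
    by_cases h : i = r
    · simp [h]
    · rw [if_pos (decide_eq_true h), act_addRow _ _ _ h (by simp) (by simp)]
      simp [hp, hi, h]
  rw [eliminate, act_append]
  refine (congrArg (act _) (a₂ := (if i₀ = r₀ then R else R.rowAdd c i₀ r₀).state) ?_).trans ?_
  · rw [act_flatMap]
    refine foldl_finRange_single _ r₀ _ _ ?_ ?_ ?_
    · rw [act_flatMap, List.foldl_filter]
      refine foldl_finRange_single _ i₀ _ _ ?_ ?_ ?_
      · rw [key1 R hp hi]
        by_cases h : i₀ = r₀ <;> simp [h]
      · intro i h; rw [key1 R hp hi, if_neg fun h' => h h'.2.1]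
      · intro i h
        rw [key1 _ (by split_ifs <;> exact hp) (by split_ifs <;> exact hi),
          if_neg fun h' => h h'.2.1]
    · intro r h
      rw [act_flatMap, List.foldl_filter]
      exact foldl_finRange_fixed _ _ fun i => by rw [key1 R hp hi, if_neg fun h' => h h'.1]
    · intro r h
      rw [act_flatMap, List.foldl_filter]
      exact foldl_finRange_fixed _ _ fun i => by
        rw [key1 _ (by split_ifs <;> exact hp) (by split_ifs <;> exact hi),
          if_neg fun h' => h h'.1]
  have hp' : ∀ r, (if i₀ = r₀ then R else R.rowAdd c i₀ r₀).piv r = decide (r = r₀) := by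
    split_ifs <;> exact hp
  -- The second half depends on the outcome of the first only through `piv`.
  generalize (if i₀ = r₀ then R else R.rowAdd c i₀ r₀) = R at hp' ⊢
  have key2 : ∀ R' : Reg m κ, (∀ r, R'.piv r = decide (r = r₀)) → ∀ r i,
      (if decide (i ≠ r) = true then
        act (addRow [(piv r, true), (mat i c, true)] c r i) R'.state else R'.state) =
        if r = r₀ ∧ R'.mat i c = true ∧ i ≠ r then (R'.rowAdd c r i).state else R'.state := by
    intro R' hp r i
    by_cases h : i = r
    · simp [h]
    · rw [if_pos (decide_eq_true h), act_addRow _ _ _ (Ne.symm h) (by simp) (by simp)]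
      simp [hp, h]
  rw [act_flatMap]
  refine foldl_finRange_single _ r₀ _ _ ?_ ?_ ?_
  · rw [act_flatMap, List.foldl_filter]
    have := foldl_finRange_induction (fun y i => if decide (i ≠ r₀) = true then
        act (addRow [(piv r₀, true), (mat i c, true)] c r₀ i) y else y)
      (fun j y => y = { R with
        mat := fun a b => if (a : ℕ) < j ∧ a ≠ r₀ ∧ R.mat a c = true ∧ c < b then
          R.mat a b ^^ R.mat r₀ b else R.mat a b
        syn := fun a => if (a : ℕ) < j ∧ a ≠ r₀ ∧ R.mat a c = true then
          R.syn a ^^ R.syn r₀ else R.syn a }.state) (a := R.state) (by simp) ?_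
    · rw [this]
      simp only [Fin.is_lt, true_and]
      rfl
    · rintro i y rfl
      rw [key2 _ (by exact hp')]
      have e : ∀ a : Fin m, (a : ℕ) < i + 1 ↔ a = i ∨ (a : ℕ) < i := by
        intro a; rw [Fin.ext_iff]; omega
      split_ifs with h
      · obtain ⟨-, h1, h2⟩ := h
        have h1 : R.mat i c = true := by simpa using h1
        congr 1
        simp only [Reg.rowAdd, Reg.mk.injEq, true_and, and_true]
        constructor
        · funext a b
          by_cases ha : a = i
          · subst ha; by_cases hb : c < b <;> simp [hb, h1, h2]
          · simp [ha, e]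
        · funext a
          by_cases ha : a = i
          · subst ha; simp [h1, h2]
          · simp [ha, e]
      · have h1 : ¬ (R.mat i c = true ∧ i ≠ r₀) := by simpa using h
        congr 1
        simp only [Reg.mk.injEq, true_and, and_true]
        constructor
        · funext a b
          by_cases ha : a = i
          · subst ha
            rw [if_neg (by simp), if_neg fun h => h1 ⟨h.2.2.1, h.2.1⟩]
          · simp [ha, e]
        · funext a
          by_cases ha : a = i
          · subst ha
            rw [if_neg (by simp), if_neg fun h => h1 ⟨h.2.2, h.2.1⟩]
          · simp [ha, e]
  · intro r h
    rw [act_flatMap, List.foldl_filter]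
    exact foldl_finRange_fixed _ _ fun i => by rw [key2 _ hp', if_neg fun h' => h h'.1]
  · intro r h
    rw [act_flatMap, List.foldl_filter]
    exact foldl_finRange_fixed _ _ fun i => by
      rw [key2 _ (by exact hp'), if_neg fun h' => h h'.1]

/-- The last layer toggles `piv` at the largest `used` row, after the update of `used`. Rows are
assigned in increasing order, so in the algorithm this is the row just assigned and the toggle
clears it. Nothing of this is assumed here, hence the xor. -/
theorem act_releaseRow (R : Reg m κ) (c : Fin κ) :
    act (releaseRow m c) R.state =
      { R with
        taken := fun r => R.taken r ^^ R.piv r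
        used := fun r => R.used r ^^ R.piv r
        piv := fun r => R.piv r ^^ decide (R.sel (Sum.inr c) = true ∧
          (R.used r ^^ R.piv r) = true ∧ ∀ r', r < r' → (R.used r' ^^ R.piv r') = false) }.state := by
  rw [releaseRow, act_append, act_flatMap, act_map]
  -- The two registers are updated alternately, so the fold is taken over the pair of their
  -- contents.
  have h1 := foldl_finRange_update
    (fun g : Fin m → Bool × Bool => { R with
      taken := fun r => (g r).1, used := fun r => (g r).2 }.state)
    (fun y i => act [mcx [(piv i, true)] (taken i), mcx [(piv i, true)] (used i)] y)
    (fun r => (R.taken r, R.used r)) (fun r => (R.taken r ^^ R.piv r, R.used r ^^ R.piv r))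
    fun r g hg => ?_
  · dsimp only at h1
    rw [h1]
    refine foldl_finRange_update (fun g => { R with
      taken := fun r => R.taken r ^^ R.piv r
      used := fun r => R.used r ^^ R.piv r
      piv := g }.state) _ R.piv _ fun r g hg => ?_
    rw [mcx_flip]
    by_cases h : R.sel (Sum.inr c) = true ∧
          (R.used r ^^ R.piv r) = true ∧ ∀ r', r < r' → (R.used r' ^^ R.piv r') = false
    · rw [if_pos (by simpa using h), Reg.update_piv]
      have hd := decide_eq_true h
      simp only [hd, hg, Bool.xor_true, Reg.state_piv]
    · rw [if_neg (by simpa using h)]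
      have hd := decide_eq_false h
      rw [hd, Bool.xor_false, ← hg, Function.update_eq_self]
  · have e1 : (fun a => (Function.update g r (R.taken r ^^ R.piv r, R.used r ^^ R.piv r) a).1) =
        Function.update (fun a => (g a).1) r (R.taken r ^^ R.piv r) := by
      funext a; by_cases h : a = r <;> simp [h]
    have e2 : (fun a => (Function.update g r (R.taken r ^^ R.piv r, R.used r ^^ R.piv r) a).2) =
        Function.update (fun a => (g a).2) r (R.used r ^^ R.piv r) := by
      funext a; by_cases h : a = r <;> simp [h]
    rw [e1, e2, act_cons, mcx_flip]
    cases h : R.piv r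
    · rw [if_neg (by simp [h]), act_cons, mcx_flip, if_neg (by simp [h]), act_nil]
      have g1 : R.taken r = (g r).1 := by rw [hg]
      have g2 : R.used r = (g r).2 := by rw [hg]
      simp only [Bool.xor_false, g1, g2]
      rw [Function.update_eq_self r (fun a => (g a).1), Function.update_eq_self r (fun a => (g a).2)]
    · rw [if_pos (by simp [h]), Reg.update_taken, act_cons, mcx_flip, if_pos (by simp [h]),
        Reg.update_used, act_nil]
      simp [hg]

end ISD

namespace ISD
variable {m κ : ℕ}
open Circuit Wire

/-! ### Elimination of one column -/

/-- A bit as an element of the field with two elements. -/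
def bit (b : Bool) : ZMod 2 := if b then 1 else 0

@[simp] theorem bit_true : bit true = 1 := rfl
@[simp] theorem bit_false : bit false = 0 := rfl

theorem bit_xor (a b : Bool) : bit (a ^^ b) = bit a + bit b := by
  cases a <;> cases b <;> decide

theorem bit_eq_one_iff (b : Bool) : bit b = 1 ↔ b = true := by cases b <;> decide

theorem zmod_two_add_self (a : ZMod 2) : a + a = 0 := CharTwo.add_self_eq_zero a

theorem zmod_two_eq (a : ZMod 2) : a = 0 ∨ a = 1 := by revert a; decide

theorem bit_decide_eq_one (a : ZMod 2) : bit (decide (a = 1)) = a := by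
  revert a; decide

def Reg.col (R : Reg m κ) (c : Fin κ) : Fin m → ZMod 2 := fun r => bit (R.mat r c)

def Reg.synVec (R : Reg m κ) : Fin m → ZMod 2 := fun r => bit (R.syn r)

/-- Adding the entry `i` to the entry `r`. -/
def rowAddEquiv (i r : Fin m) (h : i ≠ r) : (Fin m → ZMod 2) ≃ₗ[ZMod 2] (Fin m → ZMod 2) :=
  LinearEquiv.ofInvolutive
    { toFun := fun v a => if a = r then v a + v i else v a
      map_add' := fun v w => by funext a; dsimp only [Pi.add_apply]; split_ifs <;> ring
      map_smul' := fun t v => by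
        funext a
        simp only [Pi.smul_apply, smul_eq_mul, RingHom.id_apply]; split_ifs <;> ring }
    fun v => by
      funext a
      by_cases ha : a = r
      · subst ha; simp [h, add_assoc, zmod_two_add_self]
      · simp [ha]

theorem rowAddEquiv_apply (i r : Fin m) (h : i ≠ r) (v : Fin m → ZMod 2) (a : Fin m) :
    rowAddEquiv i r h v a = if a = r then v a + v i else v a := rfl

/-- Adding the entry `r` to all other entries at which `w` is one. -/
def clearEquiv (w : Fin m → ZMod 2) (r : Fin m) :
    (Fin m → ZMod 2) ≃ₗ[ZMod 2] (Fin m → ZMod 2) :=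
  LinearEquiv.ofInvolutive
    { toFun := fun v a => if a ≠ r ∧ w a = 1 then v a + v r else v a
      map_add' := fun v w => by funext a; dsimp only [Pi.add_apply]; split_ifs <;> ring
      map_smul' := fun t v => by
        funext a
        simp only [Pi.smul_apply, smul_eq_mul, RingHom.id_apply]; split_ifs <;> ring }
    fun v => by
      funext a
      by_cases ha : a ≠ r ∧ w a = 1
      · simp [ha, add_assoc, zmod_two_add_self]
      · simp [ha]

theorem clearEquiv_apply (w : Fin m → ZMod 2) (r : Fin m) (v : Fin m → ZMod 2) (a : Fin m) :
    clearEquiv w r v a = if a ≠ r ∧ w a = 1 then v a + v r else v a := rfl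

theorem Reg.rowAdd_col (R : Reg m κ) {c c' : Fin κ} {i r : Fin m} (h : i ≠ r) (hc : c < c') :
    (R.rowAdd c i r).col c' = rowAddEquiv i r h (R.col c') := by
  funext a
  simp only [Reg.col, Reg.rowAdd, rowAddEquiv_apply, hc, and_true]
  split_ifs <;> simp [bit_xor]

theorem Reg.rowAdd_synVec (R : Reg m κ) {c : Fin κ} {i r : Fin m} (h : i ≠ r) :
    (R.rowAdd c i r).synVec = rowAddEquiv i r h R.synVec := by
  funext a
  simp only [Reg.synVec, Reg.rowAdd, rowAddEquiv_apply]
  split_ifs <;> simp [bit_xor]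

theorem Reg.clear_col (R : Reg m κ) {c c' : Fin κ} {r : Fin m} (hc : c < c') :
    (R.clear c r).col c' = clearEquiv (R.col c) r (R.col c') := by
  funext a
  simp only [Reg.col, Reg.clear, clearEquiv_apply, hc, and_true, bit_eq_one_iff]
  split_ifs <;> simp [bit_xor]

theorem Reg.clear_synVec (R : Reg m κ) {c : Fin κ} {r : Fin m} :
    (R.clear c r).synVec = clearEquiv (R.col c) r R.synVec := by
  funext a
  simp only [Reg.synVec, Reg.col, Reg.clear, clearEquiv_apply, bit_eq_one_iff]
  split_ifs <;> simp [bit_xor]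

/-- Additions skip column `c` itself. Keeping it intact allows the pivot search to be undone and
lets the clearing step read the original entries. -/
theorem Reg.rowAdd_col_self (R : Reg m κ) (c : Fin κ) (i r : Fin m) :
    (R.rowAdd c i r).col c = R.col c := by
  funext a; simp [Reg.col, Reg.rowAdd]

/-- One column of the Gaussian elimination. -/
noncomputable def columnStep (m : ℕ) {κ : ℕ} (c : Fin κ) : Circuit (Wire m κ) :=
  assignRow m c ++ pivotSearch m c ++
    [mcx [(sel (Sum.inr c), true), (seek (Fin.last m), true)] (bad c)] ++
    eliminate m c ++ Circuit.inv (pivotSearch m c) ++ releaseRow m c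

theorem mem_addRow_target {ctrl : List (Wire m κ × Bool)} {c : Fin κ} {i r : Fin m}
    {g : Gate (Wire m κ)} (h : g ∈ addRow ctrl c i r) :
    (∃ b, g.target = mat r b) ∨ g.target = syn r := by
  simp only [addRow, List.mem_append, List.mem_map, List.mem_singleton] at h
  rcases h with ⟨b, -, rfl⟩ | rfl
  · exact Or.inl ⟨b, rfl⟩
  · exact Or.inr rfl

theorem eliminate_target {c c' : Fin κ} {g : Gate (Wire m κ)} (h : g ∈ eliminate m c) :
    g.target ≠ bad c' := by
  simp only [eliminate, List.mem_append, List.mem_flatMap] at h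
  rcases h with ⟨r, -, i, -, h⟩ | ⟨r, -, i, -, h⟩ <;>
    rcases mem_addRow_target h with ⟨b, h⟩ | h <;> simp [h]

theorem pivotSearch_target {c c' : Fin κ} {g : Gate (Wire m κ)} (h : g ∈ pivotSearch m c) :
    g.target ≠ bad c' := by
  simp only [pivotSearch, List.mem_cons, List.mem_flatMap, List.not_mem_nil, or_false] at h
  rcases h with rfl | ⟨r, -, rfl | rfl | rfl⟩ <;> simp [mcx]

theorem inv_pivotSearch_target {c c' : Fin κ} {g : Gate (Wire m κ)}
    (h : g ∈ Circuit.inv (pivotSearch m c)) : g.target ≠ bad c' := by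
  simp only [Circuit.inv, List.mem_reverse, List.mem_map] at h
  obtain ⟨g', h', rfl⟩ := h
  exact pivotSearch_target (g := g') h'

theorem assignRow_target {c c' : Fin κ} {g : Gate (Wire m κ)} (h : g ∈ assignRow m c) :
    g.target ≠ bad c' := by
  simp only [assignRow, List.mem_map] at h
  obtain ⟨r, -, rfl⟩ := h
  simp [mcx]

theorem releaseRow_target {c c' : Fin κ} {g : Gate (Wire m κ)} (h : g ∈ releaseRow m c) :
    g.target ≠ bad c' := by
  simp only [releaseRow, List.mem_append, List.mem_flatMap, List.mem_map, List.mem_cons,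
    List.not_mem_nil, or_false] at h
  rcases h with ⟨r, -, rfl | rfl⟩ | ⟨r, -, rfl⟩ <;> simp [mcx]

theorem act_columnStep_bad_of_ne {c c' : Fin κ} (h : c' ≠ c) (x : Wire m κ → Bool) :
    act (columnStep m c) x (bad c') = x (bad c') := by
  refine act_of_forall_target_ne (fun g hg => ?_) x
  simp only [columnStep, List.mem_append, List.mem_singleton] at hg
  rcases hg with ((((hg | hg) | rfl) | hg) | hg) | hg
  · exact assignRow_target hg
  · exact pivotSearch_target hg
  · simpa [mcx] using h.symm
  · exact eliminate_target hg
  · exact inv_pivotSearch_target hg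
  · exact releaseRow_target hg

/-- The auxiliary registers of the elimination are clean. -/
structure Reg.Clean (R : Reg m κ) : Prop where
  piv : R.piv = fun _ => false
  seek : R.seek = fun _ => false
  src : R.src = fun _ => false

/-- The pivot search runs in any case, but with no assigned row everything controlled by `piv` is
idle, and the search is then undone. -/
theorem act_columnStep_of_not_sel (R : Reg m κ) (hR : R.Clean) (c : Fin κ)
    (hsel : R.sel (Sum.inr c) = false) : act (columnStep m c) R.state = R.state := by
  have hpiv : ∀ r, R.piv r = false := fun r => congrFun hR.piv r
  simp only [columnStep, act_append]
  rw [act_assignRow]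
  have h1 : ({ R with piv := fun r => R.piv r ^^ (decide (R.sel (Sum.inr c) = true ∧
      R.taken r = false ∧ ∀ r' < r, R.taken r' = true)) } : Reg m κ) = R := by
    have : (fun r => R.piv r ^^ (decide (R.sel (Sum.inr c) = true ∧
      R.taken r = false ∧ ∀ r' < r, R.taken r' = true))) = R.piv := by
      funext r; simp [hsel]
    rw [this]
  rw [h1, act_pivotSearch R c hR.seek hR.src, act_cons, mcx_flip, if_neg, act_nil,
    act_eliminate_of_piv_eq_false _ _ (by exact hpiv), act_inv_pivotSearch R c hR.seek hR.src,
    act_releaseRow]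
  · congr 1
    cases R; simp_all
  · intro h
    have := h (sel (Sum.inr c), true) (by simp) (by simp)
    rw [Reg.state_sel] at this
    change R.sel (Sum.inr c) = true at this
    rw [hsel] at this
    exact absurd this (by simp)

/-- The flag is raised right after the search and no later block targets it. The other registers are
not tracked: whatever they hold is removed when `flipTarget` runs the whole computation backwards.
-/
theorem act_columnStep_bad (R : Reg m κ) (hR : R.Clean) (c : Fin κ)
    (hsel : R.sel (Sum.inr c) = true) (hbad : R.bad c = false) (hu : ∀ r, ¬ R.Usable c r) :
    act (columnStep m c) R.state (bad c) = true := by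
  simp only [columnStep, act_append]
  rw [act_of_forall_target_ne fun g hg => releaseRow_target hg,
    act_of_forall_target_ne fun g hg => inv_pivotSearch_target hg,
    act_of_forall_target_ne fun g hg => eliminate_target hg,
    act_assignRow, act_pivotSearch _ _ (by exact hR.seek) (by exact hR.src), act_cons, act_nil,
    mcx_flip, if_pos]
  · simp [Reg.searched, hbad]
  · simp only [List.forall_mem_cons, ne_eq, reduceCtorEq, not_false_eq_true, Reg.state_sel,
      Reg.state_seek, true_implies, List.not_mem_nil, false_implies, implies_true, and_true]
    exact ⟨hsel, decide_eq_true fun r _ => hu r⟩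

theorem Reg.searched_congr (R R' : Reg m κ) (c : Fin κ)
    (h : ∀ r, R'.Usable c r ↔ R.Usable c r) :
    R'.searched c = { R' with seek := (R.searched c).seek, src := (R.searched c).src } := by
  simp only [Reg.searched, h]

/-- Here `r₀` is the first free row and `i₀` the first usable one. The condition that all used rows
lie below `r₀` is what makes the release step erase `piv`. -/
theorem act_columnStep_of_usable (R : Reg m κ) (hR : R.Clean) (c : Fin κ) {r₀ i₀ : Fin m}
    (hsel : R.sel (Sum.inr c) = true) (hr : R.taken r₀ = false)
    (hr' : ∀ r < r₀, R.taken r = true) (hi : R.Usable c i₀) (hi' : ∀ i < i₀, ¬ R.Usable c i)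
    (hused : ∀ r, R.used r = true → r < r₀) :
    act (columnStep m c) R.state =
      { (if i₀ = r₀ then R else R.rowAdd c i₀ r₀).clear c r₀ with
        taken := fun r => R.taken r || decide (r = r₀)
        used := fun r => R.used r || decide (r = r₀) }.state := by
  simp only [columnStep, act_append]
  rw [act_assignRow]
  have h1 : (fun r => R.piv r ^^ (decide (R.sel (Sum.inr c) = true ∧
      R.taken r = false ∧ ∀ r' < r, R.taken r' = true))) = fun r => decide (r = r₀) := by
    funext r
    rw [hR.piv, Bool.false_xor]
    refine decide_eq_decide.2 ⟨fun h => ?_, ?_⟩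
    · rcases lt_trichotomy r r₀ with h' | h' | h'
      · exact absurd (hr' r h') (by simp [h.2.1])
      · exact h'
      · exact absurd (h.2.2 r₀ h') (by simp [hr])
    · rintro rfl; exact ⟨hsel, hr, hr'⟩
  rw [h1]
  set R₁ : Reg m κ := { R with piv := fun r => decide (r = r₀) } with hR₁
  have hU : ∀ i, R₁.Usable c i ↔ R.Usable c i := fun i => Iff.rfl
  rw [act_pivotSearch R₁ c (by exact hR.seek) (by exact hR.src), act_cons, mcx_flip, if_neg,
    act_nil, act_eliminate _ c r₀ i₀ (fun r => rfl)]
  · have h2 : (if i₀ = r₀ then R₁.searched c else (R₁.searched c).rowAdd c i₀ r₀).clear c r₀ =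
        Reg.searched ((if i₀ = r₀ then R₁ else R₁.rowAdd c i₀ r₀).clear c r₀) c := by
      have e : ∀ R' : Reg m κ, (∀ r, R'.taken r = R.taken r) → (∀ r, R'.mat r c = R.mat r c) →
          ∀ r, R'.Usable c r ↔ R.Usable c r := by
        intro R' h h' r; simp only [Reg.Usable, h, h']
      split_ifs with h
      · rw [Reg.searched_congr R₁ _ c fun r => (e (R₁.clear c r₀) (fun r => rfl)
          (fun r => by simp [Reg.clear, hR₁]) r).trans (hU r).symm]
        rfl
      · rw [Reg.searched_congr R₁ _ c fun r => (e ((R₁.rowAdd c i₀ r₀).clear c r₀) (fun r => rfl)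
          (fun r => by simp [Reg.clear, Reg.rowAdd, hR₁]) r).trans (hU r).symm]
        simp only [Reg.searched, Reg.clear, Reg.rowAdd]
    rw [h2, act_inv_pivotSearch, act_releaseRow]
    · congr 1
      have hx : ∀ (f : Fin m → Bool), f r₀ = false →
          (fun r => f r ^^ decide (r = r₀)) = fun r => f r || decide (r = r₀) := by
        intro f hf
        funext r
        by_cases h : r = r₀
        · subst h; simp [hf]
        · simp [h]
      have hu0 : R.used r₀ = false := by
        by_contra h
        exact lt_irrefl _ (hused r₀ (by simpa using h))
      -- The largest used row is now `r₀`, so the toggle hits exactly the one bit set in `piv`.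
      have hcl : (fun r => decide (r = r₀) ^^ decide (R.sel (Sum.inr c) = true ∧
          (R.used r ^^ decide (r = r₀)) = true ∧
          ∀ r', r < r' → (R.used r' ^^ decide (r' = r₀)) = false)) = R.piv := by
        funext r
        rw [hR.piv]
        have h2 := fun r => congrFun (hx R.used hu0) r
        simp only [h2]
        by_cases h : r = r₀
        · subst h
          have h3 : ∀ r', r < r' → (R.used r' || decide (r' = r)) = false := by
            intro r' h'
            have : R.used r' = false := by
              by_contra h4; exact absurd (hused r' (by simpa using h4)) (not_lt.2 h'.le)
            simp [this, h'.ne']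
          simp [hsel, hu0]
          simpa using h3
        · simp only [h, decide_false, Bool.false_xor, Bool.or_false, decide_eq_false_iff_not]
          rintro ⟨-, h3, h4⟩
          have := h4 r₀ (hused r h3)
          simp at this
      split_ifs <;>
        simp only [Reg.clear, Reg.rowAdd, hR₁, hx _ hr, hx _ hu0, hcl]
    · split_ifs <;> exact hR.seek
    · split_ifs <;> exact hR.src
  · intro i
    refine decide_eq_decide.2 ⟨fun h => ?_, ?_⟩
    · rcases lt_trichotomy i i₀ with h' | h' | h'
      · exact absurd h.1 (hi' i h')
      · exact h'
      · exact absurd hi (h.2 i₀ h')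
    · rintro rfl; exact ⟨hi, hi'⟩
  · intro h
    have := h (seek (Fin.last m), true) (by simp) (by simp)
    exact (of_decide_eq_true this) i₀ (by simp) hi

end ISD

namespace ISD
variable {m κ : ℕ}
open Circuit Wire

/-! ### The Gaussian elimination of the circuit -/

/-- `S` consists of `m` independent columns, and the solution of the corresponding linear system
has weight `ω`. -/
def GoodSet {ι : Type*} [Fintype ι] (v : ι → Fin m → ZMod 2) (s : Fin m → ZMod 2) (ω : ℕ)
    (S : Finset ι) : Prop :=
  S.card = m ∧ LinearIndepOn (ZMod 2) v (S : Set ι) ∧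
    ∃ x : ι → ZMod 2, (∀ i ∉ S, x i = 0) ∧ ∑ i, x i • v i = s ∧ hammingNorm x = ω

/-- The linear system is equivalent, by row operations `U`, to one in which the columns in `S` are
unit vectors. -/
theorem unit_columns_solution {ι : Type*} [Fintype ι] {v : ι → Fin m → ZMod 2}
    {s : Fin m → ZMod 2} {S : Finset ι} (U : (Fin m → ZMod 2) ≃ₗ[ZMod 2] (Fin m → ZMod 2))
    {ρ : ι → Fin m} (hρ : Set.InjOn ρ S) (hU : ∀ i ∈ S, U (v i) = Pi.single (ρ i) 1)
    {x : ι → ZMod 2} (hx : ∀ i ∉ S, x i = 0) (hs : ∑ i, x i • v i = s) {i : ι} (hi : i ∈ S) :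
    x i = U s (ρ i) := by
  classical
  have h1 : U s = ∑ j ∈ S, x j • Pi.single (ρ j) (1 : ZMod 2) := by
    rw [← hs, map_sum, ← Finset.sum_subset (Finset.subset_univ S)]
    · exact Finset.sum_congr rfl fun j hj => by rw [map_smul, hU j hj]
    · intro j _ hj; rw [hx j hj, zero_smul, map_zero]
  rw [h1, Finset.sum_apply, Finset.sum_eq_single i]
  · simp
  · intro j hj hji
    have : ρ i ≠ ρ j := fun h => hji (hρ hj hi h.symm)
    simp [Pi.single_eq_of_ne this]
  · exact fun h => absurd hi h

theorem unit_columns_linearIndepOn {ι : Type*} {v : ι → Fin m → ZMod 2}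
    {S : Finset ι} (U : (Fin m → ZMod 2) ≃ₗ[ZMod 2] (Fin m → ZMod 2))
    {ρ : ι → Fin m} (hρ : Set.InjOn ρ S) (hU : ∀ i ∈ S, U (v i) = Pi.single (ρ i) 1) :
    LinearIndepOn (ZMod 2) v (S : Set ι) := by
  have h : LinearIndependent (ZMod 2) fun i : (S : Set ι) => U (v i) := by
    have e : (fun i : (S : Set ι) => U (v i)) =
        (Pi.basisFun (ZMod 2) (Fin m)) ∘ fun i : (S : Set ι) => ρ i := by
      funext i; simp [hU i i.2]
    rw [e]
    exact (Pi.basisFun (ZMod 2) (Fin m)).linearIndependent.comp _ fun i j h =>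
      Subtype.ext (hρ i.2 j.2 h)
  exact LinearIndependent.of_comp U.toLinearMap h

/-- As `S` has `m` elements, `ρ` is a bijection from `S` onto the rows. The system therefore has
exactly one solution supported on `S`, and its entries are those of `U s` in another order. -/
theorem unit_columns_goodSet_iff {ι : Type*} [Fintype ι] [DecidableEq ι]
    {v : ι → Fin m → ZMod 2} {s : Fin m → ZMod 2} {S : Finset ι}
    (U : (Fin m → ZMod 2) ≃ₗ[ZMod 2] (Fin m → ZMod 2))
    {ρ : ι → Fin m} (hρ : Set.InjOn ρ S) (hU : ∀ i ∈ S, U (v i) = Pi.single (ρ i) 1)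
    (hS : S.card = m) (ω : ℕ) : GoodSet v s ω S ↔ hammingNorm (U s) = ω := by
  classical
  have hsurj : ∀ r, ∃ i ∈ S, ρ i = r := by
    intro r
    have : S.image ρ = Finset.univ := by
      apply Finset.eq_univ_of_card
      rw [Finset.card_image_of_injOn hρ, hS, Fintype.card_fin]
    have hr := this ▸ Finset.mem_univ r
    simpa using hr
  have hw : ∀ x : ι → ZMod 2, (∀ i ∉ S, x i = 0) → ∑ i, x i • v i = s →
      hammingNorm x = hammingNorm (U s) := by
    intro x hx hs
    have key := fun i (hi : i ∈ S) => unit_columns_solution U hρ hU hx hs hi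
    refine Finset.card_bij (fun i _ => ρ i) ?_ ?_ ?_
    · intro i hi
      have hne : x i ≠ 0 := by simpa using hi
      have hS : i ∈ S := by by_contra h; exact hne (hx i h)
      simpa [← key i hS] using hne
    · intro i hi j hj h
      have hi : x i ≠ 0 := by simpa using hi
      have hj : x j ≠ 0 := by simpa using hj
      exact hρ (by by_contra h; exact hi (hx i h)) (by by_contra h; exact hj (hx j h)) h
    · intro r hr
      obtain ⟨i, hi, rfl⟩ := hsurj r
      exact ⟨i, by simpa [key i hi] using hr, rfl⟩
  constructor
  · rintro ⟨-, -, x, hx, hs, rfl⟩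
    exact (hw x hx hs).symm
  · intro h
    have hsol : ∑ i, (if i ∈ S then U s (ρ i) else 0) • v i = s := by
      apply U.injective
      rw [map_sum, ← Finset.sum_subset (Finset.subset_univ S)
        (fun j _ hj => by rw [if_neg hj, zero_smul, map_zero])]
      funext r
      obtain ⟨i, hi, rfl⟩ := hsurj r
      rw [Finset.sum_apply, Finset.sum_eq_single i]
      · simp [hi, hU i hi]
      · intro j hj hji
        have : ρ i ≠ ρ j := fun h => hji (hρ hj hi h.symm)
        simp [hj, hU j hj, Pi.single_eq_of_ne this]
      · exact fun h => absurd hi h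
    exact ⟨hS, unit_columns_linearIndepOn U hρ hU, _, fun i hi => if_neg hi, hsol,
      (hw _ (fun i hi => if_neg hi) hsol).trans h⟩

/-- The columns of `(I_m | H')`. -/
def sysCol (H' : Matrix (Fin m) (Fin κ) (ZMod 2)) : Fin m ⊕ Fin κ → Fin m → ZMod 2 :=
  Sum.elim (fun r => Pi.single r 1) fun c r => H' r c

/-- The columns that have been processed when the first `j` columns of `H'` have been. -/
def Processed (j : ℕ) : Fin m ⊕ Fin κ → Prop :=
  Sum.elim (fun _ => True) fun c => (c : ℕ) < j

theorem Processed.succ {j : ℕ} {σ : Fin m ⊕ Fin κ} (h : Processed j σ) : Processed (j + 1) σ := by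
  cases σ with
  | inl r => trivial
  | inr c => exact Nat.lt_succ_of_lt h

theorem processed_succ_iff {c : Fin κ} {σ : Fin m ⊕ Fin κ} :
    Processed (c + 1) σ ↔ Processed c σ ∨ σ = Sum.inr c := by
  cases σ with
  | inl r => simp [Processed]
  | inr c' => simp [Processed, Fin.ext_iff]; omega

/-- The registers after the elimination of the first `j` columns of `H'`, as far as these are
selected, if no dependency has been found. -/
structure Eliminated (H' : Matrix (Fin m) (Fin κ) (ZMod 2)) (s : Fin m → ZMod 2)
    (S : Finset (Fin m ⊕ Fin κ)) (j : ℕ) (R : Reg m κ)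
    (U : (Fin m → ZMod 2) ≃ₗ[ZMod 2] (Fin m → ZMod 2)) (ρ : Fin m ⊕ Fin κ → Fin m) : Prop where
  clean : R.Clean
  sel : ∀ σ, R.sel σ = true ↔ σ ∈ S
  bad : ∀ c, R.bad c = false
  wt : ∀ i, R.wt i = false
  col : ∀ c : Fin κ, j ≤ c → R.col c = U (sysCol H' (Sum.inr c))
  syn : R.synVec = U s
  unit : ∀ σ ∈ S, Processed j σ → U (sysCol H' σ) = Pi.single (ρ σ) 1
  inj : ∀ σ ∈ S, ∀ τ ∈ S, Processed j σ → Processed j τ → ρ σ = ρ τ → σ = τ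
  taken : ∀ r, R.taken r = true ↔ ∃ σ ∈ S, Processed j σ ∧ ρ σ = r
  used : ∀ r r', R.used r = true → r' ≤ r → R.taken r' = true

variable {H' : Matrix (Fin m) (Fin κ) (ZMod 2)} {s : Fin m → ZMod 2}
  {S : Finset (Fin m ⊕ Fin κ)}

/-- The taken rows are images of selected columns already processed. Column `c` is selected but not
among these, so at most `m - 1` rows are taken. -/
theorem Eliminated.exists_first_untaken {c : Fin κ} {R : Reg m κ} {U ρ}
    (h : Eliminated H' s S c R U ρ) (hS : S.card = m) (hc : Sum.inr c ∈ S) :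
    ∃ r₀, R.taken r₀ = false ∧ ∀ r < r₀, R.taken r = true := by
  classical
  have hex : ∃ r, R.taken r = false := by
    by_contra hne
    push Not at hne
    have hsub : (Finset.univ : Finset (Fin m)) ⊆ (S.erase (Sum.inr c)).image ρ := by
      intro r _
      obtain ⟨σ, hσ, hp, rfl⟩ := (h.taken r).1 (by simpa using hne r)
      refine Finset.mem_image_of_mem ρ (Finset.mem_erase.2 ⟨?_, hσ⟩)
      rintro rfl
      exact lt_irrefl _ hp
    have h1 := (Finset.card_le_card hsub).trans Finset.card_image_le
    rw [Finset.card_erase_of_mem hc, hS, Finset.card_univ, Fintype.card_fin] at h1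
    have : 0 < S.card := Finset.card_pos.2 ⟨_, hc⟩
    omega
  obtain ⟨r₀, h1, h2⟩ := wellFounded_lt.has_min {r : Fin m | R.taken r = false} hex
  exact ⟨r₀, h1, fun r hr => by
    by_contra h3
    exact h2 r (by simpa using h3) hr⟩

/-- Without a usable row, the transformed column `c` is supported on taken rows. It is then a
combination of unit vectors that are the transforms of other selected columns. -/
theorem Eliminated.not_linearIndepOn {c : Fin κ} {R : Reg m κ} {U ρ}
    (h : Eliminated H' s S c R U ρ) (hc : Sum.inr c ∈ S) (hu : ∀ r, ¬ R.Usable c r) :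
    ¬ LinearIndepOn (ZMod 2) (sysCol H') (S : Set (Fin m ⊕ Fin κ)) := by
  intro hli
  refine hli.notMem_span hc ?_
  have hcol : sysCol H' (Sum.inr c) = ∑ r, R.col c r • U.symm (Pi.single r 1) := by
    apply U.injective
    rw [← h.col c le_rfl, map_sum]
    simp only [map_smul, LinearEquiv.apply_symm_apply]
    exact pi_eq_sum_univ' (R.col c)
  rw [hcol]
  refine Submodule.sum_mem _ fun r _ => ?_
  by_cases ht : R.taken r = true
  · obtain ⟨σ, hσ, hp, rfl⟩ := (h.taken r).1 ht
    refine Submodule.smul_mem _ _ (Submodule.subset_span ⟨σ, ⟨hσ, ?_⟩, ?_⟩)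
    · rintro rfl; exact lt_irrefl _ hp
    · rw [← h.unit σ hσ hp, LinearEquiv.symm_apply_apply]
  · have : R.mat r c = false := by
      by_contra hm
      exact hu r ⟨by simpa using ht, by simpa using hm⟩
    simp [Reg.col, this]

/-- Clearing is steered by the old column `w`. It differs from the updated column only at `r₀`,
which the clearing step ignores. -/
theorem clearEquiv_rowAdd_column (w : Fin m → ZMod 2) {r₀ i₀ : Fin m} (hi : w i₀ = 1)
    (h : i₀ ≠ r₀) (hr : w r₀ = 0) :
    clearEquiv w r₀ (rowAddEquiv i₀ r₀ h w) = Pi.single r₀ 1 := by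
  funext a
  simp only [clearEquiv_apply, rowAddEquiv_apply]
  by_cases ha : a = r₀
  · subst ha; simp [hi, hr]
  · rcases zmod_two_eq (w a) with h0 | h0
    · simp [ha, h0]
    · simp [ha, h0, hi, hr, zmod_two_add_self]

theorem clearEquiv_column (w : Fin m → ZMod 2) {r₀ : Fin m} (hi : w r₀ = 1) :
    clearEquiv w r₀ w = Pi.single r₀ 1 := by
  funext a
  simp only [clearEquiv_apply]
  by_cases ha : a = r₀
  · subst ha; simp [hi]
  · rcases zmod_two_eq (w a) with h0 | h0
    · simp [ha, h0]
    · simp [ha, h0, hi, zmod_two_add_self]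

theorem clearEquiv_single (w : Fin m → ZMod 2) {r₀ r : Fin m} (h : r ≠ r₀) :
    clearEquiv w r₀ (Pi.single r 1) = Pi.single r 1 := by
  funext a
  simp [clearEquiv_apply, Pi.single_eq_of_ne h.symm]

theorem rowAddEquiv_single {r₀ i₀ r : Fin m} (h : i₀ ≠ r₀) (hi : r ≠ i₀) :
    rowAddEquiv i₀ r₀ h (Pi.single r 1) = Pi.single r 1 := by
  funext a
  simp [rowAddEquiv_apply, Pi.single_eq_of_ne hi.symm]

/-- The row operations performed for one column. -/
theorem exists_rowOperations (R : Reg m κ) (c : Fin κ) {r₀ i₀ : Fin m}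
    (hr : R.taken r₀ = false) (hr' : ∀ r < r₀, R.taken r = true) (hi : R.Usable c i₀)
    (hi' : ∀ i < i₀, ¬ R.Usable c i) :
    ∃ E : (Fin m → ZMod 2) ≃ₗ[ZMod 2] (Fin m → ZMod 2),
      (∀ c', c < c' →
        ((if i₀ = r₀ then R else R.rowAdd c i₀ r₀).clear c r₀).col c' = E (R.col c')) ∧
      ((if i₀ = r₀ then R else R.rowAdd c i₀ r₀).clear c r₀).synVec = E R.synVec ∧
      E (R.col c) = Pi.single r₀ 1 ∧
      ∀ r, R.taken r = true → E (Pi.single r 1) = Pi.single r 1 := by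
  have hw : R.col c i₀ = 1 := by simp [Reg.col, hi.2]
  have hne : ∀ r, R.taken r = true → r ≠ r₀ := by rintro r h rfl; simp [hr] at h
  by_cases h : i₀ = r₀
  · subst h
    simp only [if_true]
    exact ⟨clearEquiv (R.col c) i₀, fun c' hc => R.clear_col hc, R.clear_synVec,
      clearEquiv_column _ hw, fun r ht => clearEquiv_single _ (hne r ht)⟩
  · simp only [h, if_false]
    have hlt : r₀ < i₀ := by
      rcases lt_trichotomy r₀ i₀ with h1 | h1 | h1
      · exact h1
      · exact absurd h1.symm h
      · exact absurd (hr' i₀ h1) (by simp [hi.1])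
    -- Row `r₀` is free and comes before the first usable row `i₀`, so it has no one in column `c`.
    have hw0 : R.col c r₀ = 0 := by
      have : ¬ (R.mat r₀ c = true) := fun hm => hi' r₀ hlt ⟨hr, hm⟩
      simp [Reg.col, this]
    refine ⟨(rowAddEquiv i₀ r₀ h).trans (clearEquiv (R.col c) r₀), fun c' hc => ?_, ?_, ?_,
      fun r ht => ?_⟩
    · rw [Reg.clear_col _ hc, Reg.rowAdd_col R h hc, Reg.rowAdd_col_self]; rfl
    · rw [Reg.clear_synVec, Reg.rowAdd_synVec R h, Reg.rowAdd_col_self]; rfl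
    · exact clearEquiv_rowAdd_column _ hw h hw0
    · have : r ≠ i₀ := by rintro rfl; simp [hi.1] at ht
      rw [LinearEquiv.trans_apply, rowAddEquiv_single h this, clearEquiv_single _ (hne r ht)]

/-- An unselected column changes nothing, and a selected one without a usable row proves dependence.
Otherwise the new row operation `E` sends column `c` to the unit vector at `r₀` and fixes the unit
vectors of the taken rows, so earlier columns stay in reduced form. -/
theorem Eliminated.step {c : Fin κ} {R : Reg m κ} {U ρ} (h : Eliminated H' s S c R U ρ)
    (hS : S.card = m) :
    (∃ R' U' ρ', act (columnStep m c) R.state = R'.state ∧ Eliminated H' s S (c + 1) R' U' ρ') ∨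
    (act (columnStep m c) R.state (Wire.bad c) = true ∧
      ¬ LinearIndepOn (ZMod 2) (sysCol H') (S : Set (Fin m ⊕ Fin κ))) := by
  classical
  by_cases hc : Sum.inr c ∈ S
  · have hsel := (h.sel _).2 hc
    by_cases hu : ∀ r, ¬ R.Usable c r
    · exact Or.inr ⟨act_columnStep_bad R h.clean c hsel (h.bad c) hu, h.not_linearIndepOn hc hu⟩
    · left
      push Not at hu
      obtain ⟨r₀, hr, hr'⟩ := h.exists_first_untaken hS hc
      obtain ⟨i₀, hi, hi'⟩ := wellFounded_lt.has_min {r | R.Usable c r} hu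
      replace hi' : ∀ i < i₀, ¬ R.Usable c i := fun i h1 h2 => hi' i h2 h1
      have hused : ∀ r, R.used r = true → r < r₀ := fun r h1 => by
        by_contra h2
        have := h.used r r₀ h1 (not_lt.1 h2)
        simp [hr] at this
      obtain ⟨E, hE1, hE2, hE3, hE4⟩ := exists_rowOperations R c hr hr' hi hi'
      refine ⟨_, U.trans E, Function.update ρ (Sum.inr c) r₀,
        act_columnStep_of_usable R h.clean c hsel hr hr' hi hi' hused, ?_⟩
      have hρc : ∀ σ, Processed c σ → Function.update ρ (Sum.inr c) r₀ σ = ρ σ := by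
        intro σ hσ
        refine Function.update_of_ne ?_ _ _
        rintro rfl
        exact lt_irrefl _ hσ
      have hρt : ∀ σ ∈ S, Processed c σ → R.taken (ρ σ) = true := fun σ hσ hp =>
        (h.taken _).2 ⟨σ, hσ, hp, rfl⟩
      have hρr : ∀ σ ∈ S, Processed c σ → ρ σ ≠ r₀ := by
        rintro σ hσ hp rfl
        have := hρt σ hσ hp
        simp [hr] at this
      constructor
      · split_ifs <;> exact ⟨h.clean.piv, h.clean.seek, h.clean.src⟩
      · split_ifs <;> exact h.sel
      · split_ifs <;> exact h.bad
      · split_ifs <;> exact h.wt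
      · intro c' hc'
        rw [LinearEquiv.trans_apply, ← h.col c' (by omega)]
        exact hE1 c' hc'
      · rw [LinearEquiv.trans_apply, ← h.syn]
        exact hE2
      · intro σ hσ hp
        rw [LinearEquiv.trans_apply]
        rcases processed_succ_iff.1 hp with hp | rfl
        · rw [h.unit σ hσ hp, hρc σ hp, hE4 _ (hρt σ hσ hp)]
        · rw [← h.col c le_rfl, hE3, Function.update_self]
      · intro σ hσ τ hτ hpσ hpτ he
        rcases processed_succ_iff.1 hpσ with hpσ | rfl <;>
          rcases processed_succ_iff.1 hpτ with hpτ | rfl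
        · rw [hρc σ hpσ, hρc τ hpτ] at he
          exact h.inj σ hσ τ hτ hpσ hpτ he
        · rw [hρc σ hpσ, Function.update_self] at he
          exact absurd he (hρr σ hσ hpσ)
        · rw [hρc τ hpτ, Function.update_self] at he
          exact absurd he.symm (hρr τ hτ hpτ)
        · rfl
      · intro r
        simp only [Bool.or_eq_true, decide_eq_true_eq]
        rw [h.taken r]
        constructor
        · rintro (⟨σ, hσ, hp, rfl⟩ | rfl)
          · exact ⟨σ, hσ, hp.succ, hρc σ hp⟩
          · exact ⟨Sum.inr c, hc, processed_succ_iff.2 (Or.inr rfl), Function.update_self _ _ _⟩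
        · rintro ⟨σ, hσ, hp, rfl⟩
          rcases processed_succ_iff.1 hp with hp | rfl
          · exact Or.inl ⟨σ, hσ, hp, (hρc σ hp).symm⟩
          · exact Or.inr (Function.update_self _ _ _)
      -- `r₀` was the first free row, so once it is taken every row up to it is; this keeps the
      -- release step valid for later columns.
      · intro r r' h1 h2
        simp only [Bool.or_eq_true, decide_eq_true_eq] at h1 ⊢
        rcases h1 with h1 | rfl
        · exact Or.inl (h.used r r' h1 h2)
        · rcases h2.lt_or_eq with h3 | h3
          · exact Or.inl (hr' r' h3)
          · exact Or.inr h3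
  · left
    have hsel : R.sel (Sum.inr c) = false := by
      by_contra h1; exact hc ((h.sel _).1 (by simpa using h1))
    refine ⟨R, U, ρ, act_columnStep_of_not_sel R h.clean c hsel, ?_⟩
    have hp : ∀ σ ∈ S, (Processed (c + 1) σ ↔ Processed c σ) := by
      intro σ hσ
      rw [processed_succ_iff, or_iff_left]
      rintro rfl
      exact hc hσ
    exact
      { clean := h.clean
        sel := h.sel
        bad := h.bad
        wt := h.wt
        col := fun c' hc' => h.col c' (by omega)
        syn := h.syn
        unit := fun σ hσ h1 => h.unit σ hσ ((hp σ hσ).1 h1)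
        inj := fun σ hσ τ hτ h1 h2 => h.inj σ hσ τ hτ ((hp σ hσ).1 h1) ((hp τ hτ).1 h2)
        taken := fun r => (h.taken r).trans (exists_congr fun σ =>
          and_congr_right fun hσ => by rw [hp σ hσ])
        used := h.used }

/-- The registers with the loaded instance and the selection `S`. -/
def Reg.selected (H' : Matrix (Fin m) (Fin κ) (ZMod 2)) (s : Fin m → ZMod 2)
    (S : Finset (Fin m ⊕ Fin κ)) (cnt : Fin (m + 1) → Bool) : Reg m κ :=
  { Reg.loaded H' s with sel := fun σ => decide (σ ∈ S), cnt := cnt }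

theorem eliminated_zero (H' : Matrix (Fin m) (Fin κ) (ZMod 2)) (s : Fin m → ZMod 2)
    (S : Finset (Fin m ⊕ Fin κ)) (cnt : Fin (m + 1) → Bool) (hm : 0 < m) :
    ∃ ρ, Eliminated H' s S 0 { Reg.selected H' s S cnt with
      taken := fun r => decide (Sum.inl r ∈ S) } (LinearEquiv.refl _ _) ρ := by
  -- The value on columns of `H'` is arbitrary, as none of them has been processed. The identity
  -- columns are unit vectors from the start.
  refine ⟨Sum.elim id fun _ => ⟨0, hm⟩, ?_⟩
  have hp : ∀ σ : Fin m ⊕ Fin κ, Processed 0 σ → ∃ r, σ = Sum.inl r := by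
    rintro (r | c) h
    · exact ⟨r, rfl⟩
    · exact absurd h (by simp [Processed])
  constructor
  · exact ⟨rfl, rfl, rfl⟩
  · exact fun σ => by simp [Reg.selected]
  · exact fun _ => rfl
  · exact fun _ => rfl
  · intro c _
    funext r
    simp [Reg.col, Reg.selected, Reg.loaded, bit_decide_eq_one, sysCol]
  · funext r
    simp [Reg.synVec, Reg.selected, Reg.loaded, bit_decide_eq_one]
  · intro σ _ h
    obtain ⟨r, rfl⟩ := hp σ h
    rfl
  · intro σ _ τ _ h1 h2 h3
    obtain ⟨r, rfl⟩ := hp σ h1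
    obtain ⟨r', rfl⟩ := hp τ h2
    exact congrArg Sum.inl h3
  · intro r
    rw [decide_eq_true_iff]
    constructor
    · exact fun h => ⟨_, h, trivial, rfl⟩
    · rintro ⟨σ, hσ, h1, h2⟩
      obtain ⟨r', rfl⟩ := hp σ h1
      exact h2 ▸ hσ
  · intro r r' h
    exact absurd h (by simp [Reg.selected, Reg.loaded])

/-- Either the invariant survives all columns, or a flag is raised once and never cleared. Only
failure is tied to dependence here; in the other case independence follows from the invariant by
`unit_columns_linearIndepOn`. -/
theorem act_solve (H' : Matrix (Fin m) (Fin κ) (ZMod 2)) (s : Fin m → ZMod 2)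
    (S : Finset (Fin m ⊕ Fin κ)) (cnt : Fin (m + 1) → Bool) (hm : 0 < m) (hS : S.card = m) :
    (∃ R U ρ, act (solve m κ) (Reg.selected H' s S cnt).state = R.state ∧
      Eliminated H' s S κ R U ρ) ∨
    ((∃ c, act (solve m κ) (Reg.selected H' s S cnt).state (bad c) = true) ∧
      ¬ LinearIndepOn (ZMod 2) (sysCol H') (S : Set (Fin m ⊕ Fin κ))) := by
  rw [solve, act_append, act_markIdentity, act_flatMap]
  have h0 : ({ Reg.selected H' s S cnt with
      taken := fun r => (Reg.selected H' s S cnt).taken r ^^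
        (Reg.selected H' s S cnt).sel (Sum.inl r) } : Reg m κ) =
      { Reg.selected H' s S cnt with taken := fun r => decide (Sum.inl r ∈ S) } := by
    simp [Reg.selected, Reg.loaded]
  rw [h0]
  obtain ⟨ρ, hρ⟩ := eliminated_zero H' s S cnt hm
  refine foldl_finRange_induction (fun y c => act (columnStep m c) y)
    (fun j y => (∃ R U ρ, y = R.state ∧ Eliminated H' s S j R U ρ) ∨
      ((∃ c : Fin κ, (c : ℕ) < j ∧ y (bad c) = true) ∧
        ¬ LinearIndepOn (ZMod 2) (sysCol H') (S : Set (Fin m ⊕ Fin κ))))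
    (Or.inl ⟨_, _, ρ, rfl, hρ⟩) ?_ |>.imp_right ?_
  · rintro c y (⟨R, U, ρ, rfl, h⟩ | ⟨⟨c', hc', hb⟩, hli⟩)
    · rcases h.step hS with h1 | ⟨h1, h2⟩
      · exact Or.inl h1
      · exact Or.inr ⟨⟨c, Nat.lt_succ_self _, h1⟩, h2⟩
    · refine Or.inr ⟨⟨c', by omega, ?_⟩, hli⟩
      rwa [act_columnStep_bad_of_ne (fun h => by subst h; exact lt_irrefl _ hc')]
  · rintro ⟨⟨c, -, h1⟩, h2⟩
    exact ⟨⟨c, h1⟩, h2⟩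

end ISD

namespace ISD
variable {m κ : ℕ}
open Circuit Wire

/-! ### The weight of the solution -/

theorem classical_accumulate (m κ : ℕ) : (accumulate m κ).Classical :=
  Classical.cons rfl (classical_flatMap fun _ => classical_flatMap fun _ =>
    Classical.cons rfl (Classical.cons rfl classical_nil))

/-- The pair of gates at `j` moves the token from `j` to `j + 1`. Going down from the top, the token
is met once, at `j = p`, and not again after it has moved; an upward sweep would carry it along. -/
theorem act_increment (R : Reg m κ) (r : Fin m) (hr : R.syn r = true) {p : ℕ} (hp : p < m)
    (hw : ∀ j, R.wt j = decide ((j : ℕ) = p)) :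
    act ((List.finRange m).reverse.flatMap fun j =>
      [mcx [(syn r, true), (wt j.castSucc, true)] (wt j.succ),
        mcx [(syn r, true), (wt j.succ, true)] (wt j.castSucc)]) R.state =
      { R with wt := fun j => decide ((j : ℕ) = p + 1) }.state := by
  rw [act_flatMap]
  have hw' : R = { R with wt := fun j => decide ((j : ℕ) = p) } := by
    cases R; simp only [Reg.mk.injEq, true_and]; exact funext hw
  have := foldl_finRange_reverse_induction (fun y j => act
      [mcx [(syn r, true), (wt j.castSucc, true)] (wt j.succ),
        mcx [(syn r, true), (wt j.succ, true)] (wt j.castSucc)] y)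
    (fun i y => y = { R with wt := fun j => decide ((j : ℕ) = if i ≤ p then p + 1 else p) }.state)
    (a := R.state) (by conv_lhs => rw [hw']
                       simp [not_le.2 hp]) ?_
  · simpa using this
  · rintro j y rfl
    have hne : j.castSucc ≠ j.succ := (Fin.castSucc_lt_succ).ne
    rcases lt_trichotomy (j : ℕ) p with h | h | h
    · rw [act_cons, mcx_flip, if_neg, act_cons, mcx_flip, if_neg, act_nil]
      · simp [show (j : ℕ) + 1 ≤ p by omega, show (j : ℕ) ≤ p by omega]
      · intro h1
        have := h1 (wt j.succ, true) (by simp) (by simp [hne.symm])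
        have := of_decide_eq_true this
        rw [if_pos (by omega)] at this
        simp at this; omega
      · intro h1
        have := h1 (wt j.castSucc, true) (by simp) (by simp [hne])
        have := of_decide_eq_true this
        rw [if_pos (by omega)] at this
        simp at this; omega
    · rw [act_cons, mcx_flip, if_pos (by simp [hr, h]), Reg.update_wt, act_cons, mcx_flip,
        if_pos (by simp [hr, h]), Reg.update_wt, act_nil]
      congr 1
      simp only [Reg.mk.injEq, true_and]
      funext l
      by_cases h1 : l = j.castSucc
      · subst h1; simp [h, hne]
      · rw [Function.update_of_ne h1]
        by_cases h2 : l = j.succ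
        · subst h2; simp [h]
        · have h1' : (l : ℕ) ≠ j := fun e => h1 (Fin.ext e)
          have h2' : (l : ℕ) ≠ j + 1 := fun e => h2 (Fin.ext e)
          rw [Function.update_of_ne h2]
          simp [← h, h1', h2']
    · rw [act_cons, mcx_flip, if_neg, act_cons, mcx_flip, if_neg, act_nil]
      · simp [show ¬ (j : ℕ) + 1 ≤ p by omega, show ¬ (j : ℕ) ≤ p by omega]
      · intro h1
        have := h1 (wt j.succ, true) (by simp) (by simp [hne.symm])
        have := of_decide_eq_true this
        rw [if_neg (by omega)] at this
        simp at this; omega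
      · intro h1
        have := h1 (wt j.castSucc, true) (by simp) (by simp [hne])
        have := of_decide_eq_true this
        rw [if_neg (by omega)] at this
        simp at this; omega

theorem act_accumulate (R : Reg m κ) (hw : ∀ i, R.wt i = false) :
    act (accumulate m κ) R.state =
      { R with wt := fun j => decide ((j : ℕ) = hammingNorm R.synVec) }.state := by
  classical
  rw [accumulate, act_cons, mcx_flip, if_pos (by simp), Reg.update_wt, act_flatMap]
  -- The number of ones among the first `i` syndrome bits, which is the position of the token after
  -- `i` rounds.
  let cn : ℕ → ℕ := fun i => (Finset.univ.filter fun r : Fin m => (r : ℕ) < i ∧ R.syn r = true).card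
  have := foldl_finRange_induction (fun y r => act ((List.finRange m).reverse.flatMap fun j =>
      [mcx [(syn r, true), (wt j.castSucc, true)] (wt j.succ),
        mcx [(syn r, true), (wt j.succ, true)] (wt j.castSucc)]) y)
    (fun i y => y = { R with wt := fun j => decide ((j : ℕ) = cn i) }.state)
    (a := { R with wt := Function.update R.wt 0 (!R.state (wt 0)) }.state) ?_ ?_
  · rw [this]
    have : cn m = hammingNorm R.synVec := by
      simp only [cn, hammingNorm, Reg.synVec]
      refine congrArg Finset.card (Finset.filter_congr fun r _ => ?_)
      cases R.syn r <;> simp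
    rw [this]
  · congr 1
    simp only [Reg.mk.injEq, true_and]
    funext j
    have h0 : cn 0 = 0 := by simp [cn]
    by_cases hj : j = 0
    · subst hj; simp [h0, hw]
    · have : (j : ℕ) ≠ 0 := fun e => hj (Fin.ext e)
      simp [hj, h0, hw, this]
  · rintro r y rfl
    have hsplit : (Finset.univ.filter fun a : Fin m => (a : ℕ) < r + 1 ∧ R.syn a = true) =
        if R.syn r = true then insert r (Finset.univ.filter fun a : Fin m =>
          (a : ℕ) < r ∧ R.syn a = true) else Finset.univ.filter fun a : Fin m =>
          (a : ℕ) < r ∧ R.syn a = true := by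
      have e : ∀ a : Fin m, (a : ℕ) < r + 1 ↔ a = r ∨ (a : ℕ) < r := by
        intro a; rw [Fin.ext_iff]; omega
      ext a
      by_cases ha : a = r
      · subst ha; split_ifs with h <;> simp [h]
      · split_ifs with h <;> simp [ha, e]
    by_cases hr : R.syn r = true
    · have hcn : cn (r + 1) = cn r + 1 := by
        simp only [cn]
        rw [hsplit, if_pos hr, Finset.card_insert_of_notMem (by simp)]
      -- At most `r` ones have been counted before round `r`, so the counter has room for one more.
      have hlt : cn r < m := by
        have : cn r ≤ (r : ℕ) := by
          have h1 : (Finset.univ.filter fun a : Fin m => (a : ℕ) < r ∧ R.syn a = true) ⊆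
            Finset.Iio r := by intro a ha; exact Finset.mem_Iio.2 (Finset.mem_filter.1 ha).2.1
          have := Finset.card_le_card h1
          rwa [Fin.card_Iio] at this
        omega
      rw [hcn]
      exact act_increment { R with wt := fun j => decide ((j : ℕ) = cn r) } r hr hlt fun j => rfl
    · have hcn : cn (r + 1) = cn r := by
        simp only [cn]
        rw [hsplit, if_neg hr]
      rw [hcn, act_flatMap]
      have hfix : ∀ y : Wire m κ → Bool, y (syn r) = false → ∀ j : Fin m, act
          [mcx [(syn r, true), (wt j.castSucc, true)] (wt j.succ),
            mcx [(syn r, true), (wt j.succ, true)] (wt j.castSucc)] y = y := by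
        intro y hy j
        rw [act_cons, mcx_flip, if_neg (by simp [hy]), act_cons, mcx_flip, if_neg (by simp [hy]),
          act_nil]
      exact foldl_finRange_reverse_induction _ (fun _ y => y = _) rfl fun j y hy => by
        rw [hy]; exact hfix _ (by simpa using hr) j

theorem accumulate_target {c : Fin κ} {g : Gate (Wire m κ)} (h : g ∈ accumulate m κ) :
    g.target ≠ bad c := by
  simp only [accumulate, List.mem_cons, List.mem_flatMap, List.not_mem_nil, or_false] at h
  rcases h with rfl | ⟨r, -, i, -, rfl | rfl⟩ <;> simp [mcx]

/-! ### Flipping the sign of the target states -/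

theorem classical_addRow (ctrl : List (Wire m κ × Bool)) (c : Fin κ) (i r : Fin m) :
    (addRow ctrl c i r).Classical :=
  Classical.append (classical_map fun _ => rfl) (Classical.cons rfl classical_nil)

theorem classical_columnStep (c : Fin κ) : (columnStep m c).Classical := by
  refine Classical.append (Classical.append (Classical.append (Classical.append
    (Classical.append ?_ ?_) ?_) ?_) ?_) ?_
  · exact classical_map fun _ => rfl
  · exact classical_pivotSearch c
  · exact Classical.cons rfl classical_nil
  · exact Classical.append
      (classical_flatMap fun _ => classical_flatMap fun _ => classical_addRow _ _ _ _)
      (classical_flatMap fun _ => classical_flatMap fun _ => classical_addRow _ _ _ _)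
  · exact (classical_pivotSearch c).inv
  · exact Classical.append (classical_flatMap fun _ => Classical.cons rfl (Classical.cons rfl
      classical_nil)) (classical_map fun _ => rfl)

theorem classical_solve (m κ : ℕ) : (solve m κ).Classical :=
  Classical.append (classical_map fun _ => rfl) (classical_flatMap classical_columnStep)

/-- A diagonal gate conjugated by a permutation of the basis states is again diagonal: the sign at
`x` is the sign of the Z gate at the image of `x`. -/
theorem run_flipTarget_ket (ω : ℕ) (x : Wire m κ → Bool) :
    run (flipTarget m κ ω) (ket x) =
      (if (∀ c, act (solve m κ ++ accumulate m κ) x (bad c) = false) ∧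
        act (solve m κ ++ accumulate m κ) x (wt (Fin.ofNat (m + 1) ω)) = true
        then (-1 : ℂ) else 1) • ket x := by
  set V := solve m κ ++ accumulate m κ with hV
  have hcl : V.Classical := (classical_solve m κ).append (classical_accumulate m κ)
  have e : flipTarget m κ ω = V ++ [⟨Base.Z, (List.finRange κ).map fun c => (bad c, false),
      wt (Fin.ofNat (m + 1) ω)⟩] ++ Circuit.inv V := by
    rw [flipTarget, hV, inv_append]; simp
  set y := act V x with hy
  set g : Gate (Wire m κ) := ⟨Base.Z, (List.finRange κ).map fun c => (bad c, false),
    wt (Fin.ofNat (m + 1) ω)⟩ with hg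
  have hact : g.Active y ↔ ∀ c, y (bad c) = false := by simp [Gate.Active, hg]
  have hgy : g.apply (ket y) = (if (∀ c, y (bad c) = false) ∧
      y (wt (Fin.ofNat (m + 1) ω)) = true then (-1 : ℂ) else 1) • ket y := by
    by_cases h : g.Active y
    · rw [g.apply_ket_of_active h]
      have h' := hact.1 h
      have hup : ∀ b, y g.target = b → Function.update y g.target b = y := by
        rintro b rfl; simp
      cases hb : y g.target
      · have hb' : y (wt (Fin.ofNat (m + 1) ω)) = false := hb
        rw [hup _ hb]; simp [hg, Base.mat]
      · have hb' : y (wt (Fin.ofNat (m + 1) ω)) = true := hb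
        rw [hup _ hb]; simp [hg, Base.mat, h']
    · rw [g.apply_ket_of_not_active h, if_neg fun h1 => h (hact.2 h1.1), one_smul]
  rw [e, run_append, run_append, run_ket hcl, run_cons, ← hy, hgy]
  change run (Circuit.inv V) (_ • ket y) = _
  rw [run_smul, run_ket hcl.inv, hy, act_inv_act hcl]

/-- `S_t` flips the sign of exactly the sets that yield a solution of weight `ω`. -/
theorem run_flipTarget_selected (H' : Matrix (Fin m) (Fin κ) (ZMod 2)) (s : Fin m → ZMod 2)
    (S : Finset (Fin m ⊕ Fin κ)) (cnt : Fin (m + 1) → Bool) (hm : 0 < m) (hS : S.card = m)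
    {ω : ℕ} (hω : ω ≤ m) [Decidable (GoodSet (sysCol H') s ω S)] :
    run (flipTarget m κ ω) (ket (Reg.selected H' s S cnt).state) =
      (if GoodSet (sysCol H') s ω S then (-1 : ℂ) else 1) •
        ket (Reg.selected H' s S cnt).state := by
  rw [run_flipTarget_ket]
  congr 1
  refine if_congr ?_ rfl rfl
  rw [act_append]
  rcases act_solve H' s S cnt hm hS with ⟨R, U, ρ, hR, h⟩ | ⟨⟨c, hc⟩, hli⟩
  · rw [hR, act_accumulate R h.wt]
    have hp : ∀ σ : Fin m ⊕ Fin κ, Processed κ σ := by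
      rintro (r | c)
      · trivial
      · exact c.2
    rw [unit_columns_goodSet_iff U (fun σ hσ τ hτ => h.inj σ hσ τ hτ (hp σ) (hp τ))
      (fun σ hσ => h.unit σ hσ (hp σ)) hS, ← h.syn]
    simp only [Reg.state_bad, h.bad, implies_true, true_and, Reg.state_wt, decide_eq_true_eq,
      Fin.val_ofNat, Nat.mod_eq_of_lt (Nat.lt_succ_of_le hω)]
    exact eq_comm
  · constructor
    · rintro ⟨h1, -⟩
      have := h1 c
      rw [act_of_forall_target_ne fun g hg => accumulate_target hg, hc] at this
      exact absurd this (by simp)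
    · exact fun h => absurd h.2.1 hli

end ISD

namespace ISD
variable {m κ : ℕ}
open Circuit Wire

/-! ### The uniform superposition -/

/-- Mirror image of `act_increment`: the token moves down, so the sweep has to go up for it to move
only once. -/
theorem act_decrement (R : Reg m κ) (b : Fin m ⊕ Fin κ) (hb : R.sel b = true) {p : ℕ} (hp : p < m)
    (hc : ∀ j, R.cnt j = decide ((j : ℕ) = p + 1)) :
    act ((List.finRange m).flatMap fun j =>
      [mcx [(sel b, true), (cnt j.succ, true)] (cnt j.castSucc),
        mcx [(sel b, true), (cnt j.castSucc, true)] (cnt j.succ)]) R.state =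
      { R with cnt := fun j => decide ((j : ℕ) = p) }.state := by
  rw [act_flatMap]
  have hc' : R = { R with cnt := fun j => decide ((j : ℕ) = p + 1) } := by
    cases R; simp only [Reg.mk.injEq, true_and, and_true]; exact funext hc
  have := foldl_finRange_induction (fun y j => act
      [mcx [(sel b, true), (cnt j.succ, true)] (cnt j.castSucc),
        mcx [(sel b, true), (cnt j.castSucc, true)] (cnt j.succ)] y)
    (fun i y => y = { R with cnt := fun j => decide ((j : ℕ) = if i ≤ p then p + 1 else p) }.state)
    (a := R.state) (by conv_lhs => rw [hc']
                       simp) ?_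
  · simpa [not_le.2 hp] using this
  · rintro j y rfl
    have hne : j.castSucc ≠ j.succ := (Fin.castSucc_lt_succ).ne
    rcases lt_trichotomy (j : ℕ) p with h | h | h
    · rw [act_cons, mcx_flip, if_neg, act_cons, mcx_flip, if_neg, act_nil]
      · simp [show (j : ℕ) + 1 ≤ p by omega, show (j : ℕ) ≤ p by omega]
      · intro h1
        have := h1 (cnt j.castSucc, true) (by simp) (by simp [hne])
        have := of_decide_eq_true this
        rw [if_pos (by omega)] at this
        simp at this; omega
      · intro h1
        have := h1 (cnt j.succ, true) (by simp) (by simp [hne.symm])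
        have := of_decide_eq_true this
        rw [if_pos (by omega)] at this
        simp at this; omega
    · rw [act_cons, mcx_flip, if_pos (by simp [hb, h]), Reg.update_cnt, act_cons, mcx_flip,
        if_pos (by simp [hb, h]), Reg.update_cnt, act_nil]
      congr 1
      simp only [Reg.mk.injEq, true_and, and_true]
      funext l
      by_cases h1 : l = j.succ
      · subst h1; simp [h, hne.symm]
      · rw [Function.update_of_ne h1]
        by_cases h2 : l = j.castSucc
        · subst h2; simp [h]
        · have h1' : (l : ℕ) ≠ j := fun e => h2 (Fin.ext e)
          have h2' : (l : ℕ) ≠ j + 1 := fun e => h1 (Fin.ext e)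
          rw [Function.update_of_ne h2]
          simp [← h, h1', h2']
    · rw [act_cons, mcx_flip, if_neg, act_cons, mcx_flip, if_neg, act_nil]
      · simp [show ¬ (j : ℕ) + 1 ≤ p by omega, show ¬ (j : ℕ) ≤ p by omega]
      · intro h1
        have := h1 (cnt j.castSucc, true) (by simp) (by simp [hne])
        have := of_decide_eq_true this
        rw [if_neg (by omega)] at this
        simp at this; omega
      · intro h1
        have := h1 (cnt j.succ, true) (by simp) (by simp [hne.symm])
        have := of_decide_eq_true this
        rw [if_neg (by omega)] at this
        simp at this; omega

theorem act_decrement_of_not_sel (R : Reg m κ) (b : Fin m ⊕ Fin κ) (hb : R.sel b = false) :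
    act ((List.finRange m).flatMap fun j =>
      [mcx [(sel b, true), (cnt j.succ, true)] (cnt j.castSucc),
        mcx [(sel b, true), (cnt j.castSucc, true)] (cnt j.succ)]) R.state = R.state := by
  rw [act_flatMap]
  exact foldl_finRange_fixed _ _ fun j => by
    rw [act_cons, mcx_flip, if_neg (by simp [hb]), act_cons, mcx_flip, if_neg (by simp [hb]),
      act_nil]

/-- The registers with the loaded instance, the selection `T`, and the number of columns that
still have to be selected. -/
def Reg.partial (H' : Matrix (Fin m) (Fin κ) (ZMod 2)) (s : Fin m → ZMod 2)
    (T : Finset (Fin m ⊕ Fin κ)) : Reg m κ :=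
  Reg.selected H' s T fun j => decide ((j : ℕ) + T.card = m)

/-- One column of the creation of the superposition. -/
noncomputable def superposeStep (m κ : ℕ) (i : Fin (m + κ)) : Circuit (Wire m κ) :=
  ((List.finRange m).map fun j : Fin m =>
      (⟨Base.Ry (2 * Real.arcsin (Real.sqrt
          ((Nat.choose (m + κ - i - 1) j : ℝ) / (Nat.choose (m + κ - i) (j + 1) : ℝ)))),
        [(cnt j.succ, true)], sel (finSumFinEquiv.symm i)⟩ : Gate (Wire m κ))) ++
    ((List.finRange m).flatMap fun j : Fin m =>
      [mcx [(sel (finSumFinEquiv.symm i), true), (cnt j.succ, true)] (cnt j.castSucc),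
       mcx [(sel (finSumFinEquiv.symm i), true), (cnt j.castSucc, true)] (cnt j.succ)])

/-- The amplitude of the selection `T` among the first columns, if `l` columns remain. -/
noncomputable def selAmp (m κ l t : ℕ) : ℝ :=
  if t ≤ m then Real.sqrt ((l.choose (m - t) : ℝ) / ((m + κ).choose m : ℝ)) else 0

/-- By Pascal's rule, of the C(l+1, m-t) completions of a selection with `t` columns, C(l, m-t)
leave the next column out; this fraction is the squared cosine of the rotation angle. -/
theorem selAmp_succ_zero {t : ℕ} (l : ℕ) (ht : t < m) :
    selAmp m κ l t = selAmp m κ (l + 1) t * Real.cos (Real.arcsin (Real.sqrt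
      ((l.choose (m - t - 1) : ℝ) / ((l + 1).choose (m - t - 1 + 1) : ℝ)))) := by
  have e : m - t - 1 + 1 = m - t := by omega
  have hpas : (l + 1).choose (m - t) = l.choose (m - t - 1) + l.choose (m - t) := by
    rw [← e]; exact Nat.choose_succ_succ _ _
  rw [selAmp, if_pos ht.le, selAmp, if_pos ht.le, Real.cos_arcsin, Real.sq_sqrt (by positivity),
    ← Real.sqrt_mul (by positivity), e]
  congr 1
  -- If too few columns remain, the angle involves 0/0 = 0; the amplitudes vanish on both sides.
  by_cases h0 : (l + 1).choose (m - t) = 0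
  · have : l.choose (m - t) = 0 := by omega
    simp [h0, this]
  · have h0' : ((l + 1).choose (m - t) : ℝ) ≠ 0 := by exact_mod_cast h0
    have hp' : ((l + 1).choose (m - t) : ℝ) = l.choose (m - t - 1) + l.choose (m - t) := by
      exact_mod_cast hpas
    have : (1 : ℝ) - (l.choose (m - t - 1) : ℝ) / ((l + 1).choose (m - t) : ℝ) =
        (l.choose (m - t) : ℝ) / ((l + 1).choose (m - t) : ℝ) := by
      rw [eq_div_iff h0', sub_mul, div_mul_cancel₀ _ h0', hp']; ring
    rw [this, div_mul_div_comm, mul_comm ((l + 1).choose (m - t) : ℝ), mul_div_mul_right _ _ h0']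

theorem selAmp_succ_one {t : ℕ} (l : ℕ) (ht : t < m) :
    selAmp m κ l (t + 1) = selAmp m κ (l + 1) t * Real.sin (Real.arcsin (Real.sqrt
      ((l.choose (m - t - 1) : ℝ) / ((l + 1).choose (m - t - 1 + 1) : ℝ)))) := by
  have e : m - t - 1 + 1 = m - t := by omega
  have e' : m - (t + 1) = m - t - 1 := by omega
  have hpas : (l + 1).choose (m - t) = l.choose (m - t - 1) + l.choose (m - t) := by
    rw [← e]; exact Nat.choose_succ_succ _ _
  have hle : (l.choose (m - t - 1) : ℝ) ≤ ((l + 1).choose (m - t) : ℝ) := by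
    exact_mod_cast (by omega : l.choose (m - t - 1) ≤ (l + 1).choose (m - t))
  have hle1 : (l.choose (m - t - 1) : ℝ) / ((l + 1).choose (m - t) : ℝ) ≤ 1 :=
    div_le_one_of_le₀ hle (by positivity)
  rw [selAmp, if_pos (by omega), selAmp, if_pos ht.le, e, e',
    Real.sin_arcsin ((by norm_num : (-1 : ℝ) ≤ 0).trans (Real.sqrt_nonneg _))
      (Real.sqrt_le_one.2 hle1), ← Real.sqrt_mul (by positivity)]
  congr 1
  by_cases h0 : (l + 1).choose (m - t) = 0
  · have : l.choose (m - t - 1) = 0 := by omega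
    simp [h0, this]
  · have h0' : ((l + 1).choose (m - t) : ℝ) ≠ 0 := by exact_mod_cast h0
    rw [div_mul_div_comm, mul_comm ((l + 1).choose (m - t) : ℝ), mul_div_mul_right _ _ h0']

theorem selAmp_full (l : ℕ) : selAmp m κ l m = selAmp m κ (l + 1) m := by
  simp [selAmp]

/-- Below `m` selected columns one rotation fires, splitting the state, and the counter drops on the
selected branch. At `m` columns the counter is at zero and no rotation fires. Above `m` the
amplitude is zero by definition, so `T` needs no size restriction. -/
theorem run_superposeStep (H' : Matrix (Fin m) (Fin κ) (ZMod 2)) (s : Fin m → ZMod 2)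
    (i : Fin (m + κ)) (T : Finset (Fin m ⊕ Fin κ)) (hi : finSumFinEquiv.symm i ∉ T) :
    run (superposeStep m κ i) ((selAmp m κ (m + κ - i) T.card : ℂ) •
        ket (Reg.partial H' s T).state) =
      (selAmp m κ (m + κ - (i + 1)) T.card : ℂ) • ket (Reg.partial H' s T).state +
      (selAmp m κ (m + κ - (i + 1)) (insert (finSumFinEquiv.symm i) T).card : ℂ) •
        ket (Reg.partial H' s (insert (finSumFinEquiv.symm i) T)).state := by
  set b := finSumFinEquiv.symm i with hb
  obtain ⟨l, hl, hl'⟩ : ∃ l, m + κ - i = l + 1 ∧ m + κ - (i + 1) = l :=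
    ⟨m + κ - (i + 1), by have := i.2; omega, rfl⟩
  have hl1 : m + κ - i - 1 = l := by omega
  rw [hl, hl', run_smul, Finset.card_insert_of_notMem hi]
  have hsel : (Reg.partial H' s T).sel b = false := by simp [Reg.partial, Reg.selected, hi]
  rw [superposeStep, run_append]
  have hcl : Classical ((List.finRange m).flatMap fun j : Fin m =>
      [mcx [(sel b, true), (cnt j.succ, true)] (cnt j.castSucc),
       (mcx [(sel b, true), (cnt j.castSucc, true)] (cnt j.succ) : Gate (Wire m κ))]) :=
    classical_flatMap fun _ => Classical.cons rfl (Classical.cons rfl classical_nil)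
  rcases lt_trichotomy T.card m with hT | hT | hT
  · set θ := Real.arcsin (Real.sqrt
      ((l.choose (m - T.card - 1) : ℝ) / ((l + 1).choose (m - T.card - 1 + 1) : ℝ))) with hθ
    let R₁ : Reg m κ := { Reg.partial H' s T with
      sel := Function.update (Reg.partial H' s T).sel b true }
    -- The counter stands at `m - T.card`, which is `j₀.succ`: the index of the one rotation that is
    -- active.
    let j₀ : Fin m := ⟨m - T.card - 1, by omega⟩
    have hrot : run ((List.finRange m).map fun j : Fin m =>
        (⟨Base.Ry (2 * Real.arcsin (Real.sqrt
            ((Nat.choose (m + κ - i - 1) j : ℝ) / (Nat.choose (m + κ - i) (j + 1) : ℝ)))),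
          [(cnt j.succ, true)], sel b⟩ : Gate (Wire m κ))) (ket (Reg.partial H' s T).state) =
        (Real.cos θ : ℂ) • ket (Reg.partial H' s T).state + (Real.sin θ : ℂ) • ket R₁.state := by
      rw [run, List.foldl_map]
      have hcnt : ∀ j : Fin m, j ≠ j₀ → (Reg.partial H' s T).cnt j.succ ≠ true := by
        intro j hj h
        have := of_decide_eq_true h
        exact hj (Fin.ext (by simp [j₀] at this ⊢; omega))
      refine foldl_finRange_single _ j₀ _ _ ?_ ?_ ?_
      · rw [Gate.apply_ket_of_active]
        · have hx : (Reg.partial H' s T).state (sel b) = false := hsel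
          have hup : Function.update (Reg.partial H' s T).state (sel b) false =
              (Reg.partial H' s T).state := by
            rw [← hx, Function.update_eq_self]
          simp only [hx, hup, Reg.update_sel, hl, Nat.add_sub_cancel, Base.mat, j₀]
          rw [mul_div_cancel_left₀ _ (two_ne_zero), ← hθ]
        · intro p hp _
          simp only [List.mem_singleton] at hp
          subst hp
          exact decide_eq_true (by simp [j₀]; omega)
      · intro j hj
        refine Gate.apply_ket_of_not_active _ fun h => ?_
        exact hcnt j hj (h (cnt j.succ, true) (by simp) (by simp))
      · intro j hj
        rw [Gate.apply_add, Gate.apply_smul, Gate.apply_smul, Gate.apply_ket_of_not_active,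
          Gate.apply_ket_of_not_active]
        · intro h
          exact hcnt j hj (h (cnt j.succ, true) (by simp) (by simp))
        · intro h
          exact hcnt j hj (h (cnt j.succ, true) (by simp) (by simp))
    rw [hrot, run_add, run_smul, run_smul, run_ket hcl, run_ket hcl,
      act_decrement_of_not_sel _ _ hsel, act_decrement R₁ b (by simp [R₁])
        (p := m - (T.card + 1)) (by omega)]
    · have hR : ({ R₁ with cnt := fun j => decide ((j : ℕ) = m - (T.card + 1)) } : Reg m κ) =
          Reg.partial H' s (insert b T) := by
        simp only [R₁, Reg.partial, Reg.selected, Reg.mk.injEq, true_and, and_true]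
        constructor
        · funext σ
          by_cases h : σ = b
          · subst h; simp
          · simp [h]
        · funext j
          rw [Finset.card_insert_of_notMem hi]
          exact decide_eq_decide.2 (by omega)
      rw [hR, smul_add, smul_smul, smul_smul, selAmp_succ_zero l hT, selAmp_succ_one l hT]
      push_cast
      rfl
    · intro j
      exact decide_eq_decide.2 (by omega)
  · have hrot : run ((List.finRange m).map fun j : Fin m =>
        (⟨Base.Ry (2 * Real.arcsin (Real.sqrt
            ((Nat.choose (m + κ - i - 1) j : ℝ) / (Nat.choose (m + κ - i) (j + 1) : ℝ)))),
          [(cnt j.succ, true)], sel b⟩ : Gate (Wire m κ))) (ket (Reg.partial H' s T).state) =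
        ket (Reg.partial H' s T).state := by
      rw [run, List.foldl_map]
      refine foldl_finRange_fixed _ _ fun j => ?_
      refine Gate.apply_ket_of_not_active _ fun h => ?_
      have := of_decide_eq_true (h (cnt j.succ, true) (by simp) (by simp))
      simp at this; omega
    rw [hrot, run_ket hcl, act_decrement_of_not_sel _ _ hsel, hT, ← selAmp_full]
    simp [selAmp]
  · have h1 : ∀ l, selAmp m κ l T.card = 0 := fun l => if_neg (by omega)
    have h2 : ∀ l, selAmp m κ l (T.card + 1) = 0 := fun l => if_neg (by omega)
    simp [h1, h2]

theorem superpose_eq (m κ : ℕ) : superpose m κ =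
    mcx [] (cnt (Fin.last m)) :: (List.finRange (m + κ)).flatMap (superposeStep m κ) := rfl

/-- The state prepared by `superpose`. -/
noncomputable def uniformState (H' : Matrix (Fin m) (Fin κ) (ZMod 2)) (s : Fin m → ZMod 2) :
    QState (Wire m κ) :=
  ((Real.sqrt ((m + κ).choose m : ℝ))⁻¹ : ℂ) •
    ∑ S ∈ Finset.powersetCard m Finset.univ, ket (Reg.partial H' s S).state

theorem run_superpose (H' : Matrix (Fin m) (Fin κ) (ZMod 2)) (s : Fin m → ZMod 2) :
    run (superpose m κ) (ket (Reg.loaded H' s).state) = uniformState H' s := by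
  classical
  let F : ℕ → Finset (Fin m ⊕ Fin κ) := fun j =>
    Finset.univ.filter fun σ => (finSumFinEquiv σ : ℕ) < j
  have key := foldl_finRange_induction (fun φ i => run (superposeStep m κ i) φ)
    (fun j φ => φ = ∑ T ∈ (F j).powerset,
      (selAmp m κ (m + κ - j) T.card : ℂ) • ket (Reg.partial H' s T).state)
    (a := ket (Reg.partial H' s ∅).state) ?_ ?_
  · rw [superpose_eq, run_cons, run_flatMap, Gate.apply_ket _ rfl, mcx_flip, if_pos (by simp),
      Reg.update_cnt]
    have h0 : ({ Reg.loaded H' s with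
        cnt := Function.update (Reg.loaded H' s).cnt (Fin.last m)
          (!(Reg.loaded H' s).state (cnt (Fin.last m))) } : Reg m κ) = Reg.partial H' s ∅ := by
      simp only [Reg.partial, Reg.selected, Reg.loaded, Reg.mk.injEq, true_and, and_true]
      constructor
      · simp
      · funext j
        by_cases hj : j = Fin.last m
        · subst hj; simp
        · have : (j : ℕ) ≠ m := fun h => hj (Fin.ext h)
          simp [hj, this]
    rw [h0, key, uniformState, Finset.smul_sum]
    have hF : F (m + κ) = Finset.univ := by
      ext σ; simp [F]
    rw [hF, Finset.powerset_univ]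
    -- With no column left, C(0, m-t) kills every selection whose size is not `m`.
    rw [← Finset.sum_subset (Finset.subset_univ (Finset.powersetCard m Finset.univ))]
    · refine Finset.sum_congr rfl fun T hT => ?_
      rw [(Finset.mem_powersetCard.1 hT).2]
      simp [selAmp]
    · intro T _ hT
      have hne : T.card ≠ m := fun h => hT (Finset.mem_powersetCard.2 ⟨Finset.subset_univ _, h⟩)
      have : selAmp m κ (m + κ - (m + κ)) T.card = 0 := by
        unfold selAmp
        split_ifs with h
        · rw [Nat.sub_self, Nat.choose_eq_zero_of_lt (by omega)]; simp
        · rfl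
      rw [this]; simp
  · have : F 0 = ∅ := by ext σ; simp [F]
    rw [this, Finset.powerset_empty, Finset.sum_singleton]
    have hpos : ((m + κ).choose m : ℝ) ≠ 0 := by
      exact_mod_cast (Nat.choose_pos (Nat.le_add_right m κ)).ne'
    simp [selAmp, hpos]
  · rintro i φ rfl
    have hF : F (i + 1) = insert (finSumFinEquiv.symm i) (F i) := by
      ext σ
      simp only [F, Finset.mem_filter, Finset.mem_univ, true_and, Finset.mem_insert,
        Equiv.eq_symm_apply, Fin.ext_iff]
      omega
    have hni : finSumFinEquiv.symm i ∉ F i := by simp [F]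
    rw [hF, Finset.sum_powerset_insert hni, run_sum, ← Finset.sum_add_distrib]
    refine Finset.sum_congr rfl fun T hT => ?_
    exact run_superposeStep H' s i T fun h => hni (Finset.mem_powerset.1 hT h)

end ISD

namespace ISD
variable {m κ : ℕ}
open Circuit Wire

/-! ### Amplitude amplification -/

/-- `superpose` does not act on this qubit. -/
def Wire.IsIdle : Wire m κ → Prop
  | .sel _ => False
  | .cnt _ => False
  | _ => True

/-- All basis states with a nonzero amplitude agree with `z` on the idle qubits. -/
def IdleEq (z : Wire m κ → Bool) (ψ : QState (Wire m κ)) : Prop :=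
  ∀ x, ψ x ≠ 0 → ∀ q : Wire m κ, q.IsIdle → x q = z q

/-- `flipZero` tests only the qubits on which `superpose` acts. It singles out one basis state only
if the remaining qubits are known, hence this invariant. -/
theorem IdleEq.run {z : Wire m κ → Bool} {ψ : QState (Wire m κ)} (h : IdleEq z ψ)
    {c : Circuit (Wire m κ)} (hc : ∀ g ∈ c, ¬ g.target.IsIdle) : IdleEq z (c.run ψ) := by
  induction c generalizing ψ with
  | nil => exact h
  | cons g c ih =>
    refine ih (ψ := g.apply ψ) ?_ fun g' h' => hc g' (by simp [h'])
    intro x hx q hq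
    have hne : q ≠ g.target := by
      rintro rfl; exact hc g (by simp) hq
    by_contra hxq
    have h0 : ∀ b, ψ (Function.update x g.target b) = 0 := fun b => by
      by_contra h1
      have := h _ h1 q hq
      rw [Function.update_of_ne hne] at this
      exact hxq this
    have h1 : ψ x = 0 := by
      by_contra h1
      exact hxq (h _ h1 q hq)
    apply hx
    unfold Gate.apply
    split_ifs
    · simp [h0]
    · exact h1

theorem superposeStep_target {i : Fin (m + κ)} {g : Gate (Wire m κ)}
    (h : g ∈ superposeStep m κ i) : ¬ g.target.IsIdle := by
  simp only [superposeStep, List.mem_append, List.mem_map, List.mem_flatMap, List.mem_cons,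
    List.not_mem_nil, or_false] at h
  rcases h with ⟨j, -, rfl⟩ | ⟨j, -, rfl | rfl⟩ <;> exact id

theorem superpose_target {g : Gate (Wire m κ)} (h : g ∈ superpose m κ) : ¬ g.target.IsIdle := by
  rw [superpose_eq, List.mem_cons, List.mem_flatMap] at h
  rcases h with rfl | ⟨i, -, h⟩
  · exact id
  · exact superposeStep_target h

theorem inv_superpose_target {g : Gate (Wire m κ)} (h : g ∈ Circuit.inv (superpose m κ)) :
    ¬ g.target.IsIdle := by
  simp only [Circuit.inv, List.mem_reverse, List.mem_map] at h
  obtain ⟨g', h', rfl⟩ := h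
  exact superpose_target (g := g') h'

theorem sum_smul_ket {Q : Type} [DecidableEq Q] [Fintype Q] (ψ : QState Q) :
    ψ = ∑ x, ψ x • ket x := by
  funext y
  simp [ket_apply]

/-- A Z gate marks the value one. The surrounding X gates on `cnt 0` make it mark the value zero;
all other zeros are tested by the controls. -/
theorem run_flipZero_ket (R : Reg m κ) :
    run (flipZero m κ) (ket R.state) =
      (if (∀ i, R.sel i = false) ∧ ∀ j, R.cnt j = false then (-1 : ℂ) else 1) • ket R.state := by
  set g : Gate (Wire m κ) := ⟨Base.Z, ((List.finRange (m + κ)).map fun i =>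
    (sel (finSumFinEquiv.symm i), false)) ++
      ((List.finRange m).map fun j : Fin m => (cnt j.succ, false)), cnt 0⟩ with hg
  have e : flipZero m κ = [mcx [] (cnt 0)] ++ [g] ++ [mcx [] (cnt 0)] := rfl
  have hX : ∀ x : Wire m κ → Bool, run [mcx [] (cnt 0)] (ket x) =
      ket (Function.update x (cnt 0) (!x (cnt 0))) := fun x => by
    rw [run_cons, Gate.apply_ket _ rfl, mcx_flip, if_pos (by simp)]; rfl
  rw [e, run_append, run_append, hX]
  set y := Function.update R.state (cnt 0) (!R.state (cnt 0)) with hy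
  have hback : Function.update y (cnt 0) (!y (cnt 0)) = R.state := by simp [hy]
  have hact : g.Active y ↔ (∀ i, R.sel i = false) ∧ ∀ j : Fin m, R.cnt j.succ = false := by
    have h1 : ∀ σ : Fin m ⊕ Fin κ, y (sel σ) = R.sel σ := fun σ => by simp [hy]
    have h2 : ∀ j : Fin m, y (cnt j.succ) = R.cnt j.succ := fun j => by simp [hy]
    unfold Gate.Active
    rw [List.forall_mem_append]
    simp only [hg, List.forall_mem_map, List.mem_finRange, true_implies, ne_eq, reduceCtorEq,
      not_false_eq_true, h1, h2, Wire.cnt.injEq, Fin.succ_ne_zero]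
    refine and_congr_left fun _ => ⟨fun h σ => ?_, fun h i => h _⟩
    simpa using h (finSumFinEquiv σ)
  have hy0 : y g.target = !R.cnt 0 := by simp [hy, hg]
  have hgy : run [g] (ket y) = (if (∀ i, R.sel i = false) ∧ ∀ j, R.cnt j = false
      then (-1 : ℂ) else 1) • ket y := by
    change g.apply (ket y) = _
    by_cases h : g.Active y
    · rw [g.apply_ket_of_active h]
      have h' := hact.1 h
      have hup : ∀ b, y g.target = b → Function.update y g.target b = y := by
        rintro b rfl; simp
      cases hb : R.cnt 0
      · rw [hb, Bool.not_false] at hy0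
        have hall : ∀ j, R.cnt j = false := fun j => by
          refine Fin.cases hb h'.2 j
        rw [hup _ hy0, if_pos ⟨h'.1, hall⟩, hy0]
        simp [hg, Base.mat]
      · rw [hb, Bool.not_true] at hy0
        rw [hup _ hy0, if_neg fun hh => by simp [hh.2 0] at hb, hy0]
        simp [hg, Base.mat]
    · rw [g.apply_ket_of_not_active h, if_neg fun h1 => h (hact.2 ⟨h1.1, fun j => h1.2 _⟩),
        one_smul]
  rw [hgy, run_smul, hX, hback]

theorem exists_reg (x : Wire m κ → Bool) : ∃ R : Reg m κ, R.state = x :=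
  ⟨⟨fun i => x (.sel i), fun i j => x (.mat i j), fun i => x (.syn i), fun i => x (.cnt i),
    fun i => x (.taken i), fun i => x (.used i), fun i => x (.piv i), fun i => x (.seek i),
    fun i => x (.src i), fun i => x (.bad i), fun i => x (.wt i)⟩, by funext q; cases q <;> rfl⟩

/-- Once the idle qubits are fixed, zeros in `sel` and `cnt` leave a single basis state, so the sign
flip is the reflection in the hyperplane orthogonal to it. -/
theorem run_flipZero (H' : Matrix (Fin m) (Fin κ) (ZMod 2)) (s : Fin m → ZMod 2)
    {ψ : QState (Wire m κ)} (h : IdleEq (Reg.loaded H' s).state ψ) :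
    run (flipZero m κ) ψ =
      ψ - (2 * ψ (Reg.loaded H' s).state) • ket (Reg.loaded H' s).state := by
  have hket : ∀ x, ψ x • run (flipZero m κ) (ket x) = ψ x • ket x -
      (if x = (Reg.loaded H' s).state then 2 * ψ x else 0) • ket x := by
    intro x
    by_cases hx : ψ x = 0
    · simp [hx]
    obtain ⟨R, rfl⟩ := exists_reg x
    rw [run_flipZero_ket, smul_smul, ← sub_smul]
    congr 1
    have : R.state = (Reg.loaded H' s).state ↔
        (∀ i, R.sel i = false) ∧ ∀ j, R.cnt j = false := by
      constructor
      · intro e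
        have := Reg.state_injective e
        subst this
        exact ⟨fun _ => rfl, fun _ => rfl⟩
      · rintro ⟨h1, h2⟩
        funext q
        cases q with
        | sel i => exact h1 i
        | cnt j => exact h2 j
        | _ => exact h _ hx _ trivial
    simp only [this]
    split_ifs <;> ring
  conv_lhs => rw [sum_smul_ket ψ, run_sum]
  simp only [run_smul, hket, Finset.sum_sub_distrib, ← sum_smul_ket ψ]
  simp

/-- The superposition of the selections with the given amplitudes. -/
noncomputable def selState (H' : Matrix (Fin m) (Fin κ) (ZMod 2)) (s : Fin m → ZMod 2)
    (f : Finset (Fin m ⊕ Fin κ) → ℝ) : QState (Wire m κ) :=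
  ∑ S ∈ Finset.powersetCard m Finset.univ, (f S : ℂ) • ket (Reg.partial H' s S).state

theorem uniformState_eq (H' : Matrix (Fin m) (Fin κ) (ZMod 2)) (s : Fin m → ZMod 2) :
    uniformState H' s = selState H' s fun _ => (Real.sqrt ((m + κ).choose m : ℝ))⁻¹ := by
  rw [uniformState, selState, Finset.smul_sum]
  push_cast
  rfl

theorem Reg.partial_state_injective (H' : Matrix (Fin m) (Fin κ) (ZMod 2)) (s : Fin m → ZMod 2)
    {S T : Finset (Fin m ⊕ Fin κ)}
    (h : (Reg.partial H' s S).state = (Reg.partial H' s T).state) : S = T := by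
  ext σ
  have := congrFun h (Wire.sel σ)
  simpa [Reg.partial, Reg.selected] using this

theorem selState_apply (H' : Matrix (Fin m) (Fin κ) (ZMod 2)) (s : Fin m → ZMod 2)
    (f : Finset (Fin m ⊕ Fin κ) → ℝ) {S : Finset (Fin m ⊕ Fin κ)} (hS : S.card = m) :
    selState H' s f (Reg.partial H' s S).state = f S := by
  rw [selState, Finset.sum_apply, Finset.sum_eq_single S]
  · simp [ket_apply]
  · intro T _ hT
    have : (Reg.partial H' s S).state ≠ (Reg.partial H' s T).state := fun h =>
      hT (Reg.partial_state_injective H' s h).symm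
    simp [ket_apply, this]
  · exact fun h => absurd (Finset.mem_powersetCard.2 ⟨Finset.subset_univ _, hS⟩) h

theorem idleEq_selState (H' : Matrix (Fin m) (Fin κ) (ZMod 2)) (s : Fin m → ZMod 2)
    (f : Finset (Fin m ⊕ Fin κ) → ℝ) : IdleEq (Reg.loaded H' s).state (selState H' s f) := by
  intro x hx q hq
  rw [selState, Finset.sum_apply] at hx
  obtain ⟨S, -, hS⟩ := Finset.exists_ne_zero_of_sum_ne_zero hx
  have : x = (Reg.partial H' s S).state := by
    by_contra h
    simp [ket_apply, h] at hS
  subst this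
  cases q <;> first | rfl | exact absurd hq id

theorem braket_uniformState (H' : Matrix (Fin m) (Fin κ) (ZMod 2)) (s : Fin m → ZMod 2)
    (ψ : QState (Wire m κ)) :
    braket (uniformState H' s) ψ = ((Real.sqrt ((m + κ).choose m : ℝ))⁻¹ : ℂ) *
      ∑ S ∈ Finset.powersetCard m Finset.univ, ψ (Reg.partial H' s S).state := by
  simp only [braket, uniformState, Pi.smul_apply, Finset.sum_apply, smul_eq_mul, ket_apply]
  simp only [star_mul', star_sum, RCLike.star_def, map_inv₀, Complex.conj_ofReal]
  simp only [mul_assoc, ← Finset.mul_sum, Finset.sum_mul]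
  rw [Finset.sum_comm]
  congr 1
  refine Finset.sum_congr rfl fun S _ => ?_
  simp [apply_ite (starRingEnd ℂ)]

/-- One step of amplitude amplification, in terms of the amplitudes of the selections. -/
theorem run_amplify (H' : Matrix (Fin m) (Fin κ) (ZMod 2)) (s : Fin m → ZMod 2)
    (hm : 0 < m) {ω : ℕ} (hω : ω ≤ m) [DecidablePred (GoodSet (sysCol H') s ω)]
    (f : Finset (Fin m ⊕ Fin κ) → ℝ) :
    run (amplify m κ ω) (selState H' s f) = selState H' s fun S =>
      (if GoodSet (sysCol H') s ω S then -f S else f S) - 2 / ((m + κ).choose m : ℝ) *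
        ∑ T ∈ Finset.powersetCard m Finset.univ,
          (if GoodSet (sysCol H') s ω T then -f T else f T) := by
  have h1 : run (flipTarget m κ ω) (selState H' s f) =
      selState H' s fun S => if GoodSet (sysCol H') s ω S then -f S else f S := by
    rw [selState, run_sum, selState]
    refine Finset.sum_congr rfl fun S hS => ?_
    rw [run_smul, Reg.partial, run_flipTarget_selected H' s S _ hm (Finset.mem_powersetCard.1 hS).2
      hω, smul_smul]
    congr 1
    split_ifs <;> simp
  rw [amplify, run_append, run_append, run_append, h1]
  set w := selState H' s fun S => if GoodSet (sysCol H') s ω S then -f S else f S with hw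
  -- Conjugating the reflection by `superpose` gives `w` minus twice its projection onto the uniform
  -- state.
  rw [run_flipZero H' s ((idleEq_selState H' s _).run fun g hg => inv_superpose_target hg),
    run_sub, run_run_inv, run_smul, run_superpose, ← braket_ket (Reg.loaded H' s).state (run (Circuit.inv (superpose m κ)) w),
    braket_run_left, run_superpose,
    braket_uniformState]
  have h2 : ∑ S ∈ Finset.powersetCard m Finset.univ, w (Reg.partial H' s S).state =
      ((∑ S ∈ Finset.powersetCard m Finset.univ,
        (if GoodSet (sysCol H') s ω S then -f S else f S) : ℝ) : ℂ) := by
    push_cast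
    refine Finset.sum_congr rfl fun S hS => ?_
    rw [hw, selState_apply H' s _ (Finset.mem_powersetCard.1 hS).2]
  rw [h2, uniformState_eq]
  simp only [selState, Finset.smul_sum, ← Finset.sum_sub_distrib]
  refine Finset.sum_congr rfl fun S _ => ?_
  rw [smul_smul, ← sub_smul]
  congr 1
  have hD : (((m + κ).choose m : ℝ) : ℂ) =
      (Real.sqrt ((m + κ).choose m : ℝ) : ℂ) * (Real.sqrt ((m + κ).choose m : ℝ) : ℂ) := by
    rw [← Complex.ofReal_mul, Real.mul_self_sqrt (by positivity)]
  push_cast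
  push_cast at hD
  rw [hD]
  field_simp

/-- The state after `j` steps of amplitude amplification. -/
theorem run_amplify_iterate (H' : Matrix (Fin m) (Fin κ) (ZMod 2)) (s : Fin m → ZMod 2)
    (hm : 0 < m) {ω : ℕ} (hω : ω ≤ m) [DecidablePred (GoodSet (sysCol H') s ω)] {θ : ℝ}
    (hθ : Real.sin θ ^ 2 * ((m + κ).choose m : ℝ) =
      ((Finset.powersetCard m Finset.univ).filter (GoodSet (sysCol H') s ω)).card)
    (hs : Real.sin θ ≠ 0) (j : ℕ) :
    run (List.replicate j (amplify m κ ω)).flatten (uniformState H' s) = selState H' s fun S =>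
      (-1) ^ j * (if GoodSet (sysCol H') s ω S
        then Real.sin ((2 * j + 1) * θ) / (Real.sin θ * Real.sqrt ((m + κ).choose m : ℝ))
        else Real.cos ((2 * j + 1) * θ) / (Real.cos θ * Real.sqrt ((m + κ).choose m : ℝ))) := by
  set D : ℝ := ((m + κ).choose m : ℝ) with hDdef
  have hD : 0 < D := by rw [hDdef]; exact_mod_cast Nat.choose_pos (Nat.le_add_right m κ)
  set P : Finset (Finset (Fin m ⊕ Fin κ)) := Finset.powersetCard m Finset.univ with hP
  have hcard : (P.card : ℝ) = D := by
    rw [hP, Finset.card_powersetCard, Finset.card_univ]; simp [hDdef]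
  have hbad : ((P.filter fun S => ¬ GoodSet (sysCol H') s ω S).card : ℝ) =
      Real.cos θ ^ 2 * D := by
    have h1 : ((P.filter fun S => GoodSet (sysCol H') s ω S).card : ℝ) +
        ((P.filter fun S => ¬ GoodSet (sysCol H') s ω S).card : ℝ) = P.card := by
      exact_mod_cast Finset.card_filter_add_card_filter_not (s := P) (GoodSet (sysCol H') s ω)
    have h2 := Real.sin_sq_add_cos_sq θ
    rw [hcard] at h1
    linear_combination h1 + hθ - D * h2
  -- If cos θ = 0, all sets are good, so the branch that divides by cos θ is never taken.
  have hcos : ∀ S ∈ P, ¬ GoodSet (sysCol H') s ω S → Real.cos θ ≠ 0 := by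
    intro S hS hg h0
    rw [h0] at hbad
    have : (P.filter fun S => ¬ GoodSet (sysCol H') s ω S).card = 0 := by
      exact_mod_cast (by simpa using hbad :
        ((P.filter fun S => ¬ GoodSet (sysCol H') s ω S).card : ℝ) = 0)
    exact absurd (Finset.mem_filter.2 ⟨hS, hg⟩) (by rw [Finset.card_eq_zero.1 this]; simp)
  have hsq : Real.sqrt D ≠ 0 := (Real.sqrt_pos.2 hD).ne'
  have hsqD : Real.sqrt D * Real.sqrt D = D := Real.mul_self_sqrt hD.le
  induction j with
  | zero =>
    rw [List.replicate_zero, List.flatten_nil, uniformState_eq]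
    change selState H' s _ = _
    unfold selState
    refine Finset.sum_congr rfl fun S hS => ?_
    congr 2
    dsimp only
    split_ifs with h
    · simp only [Nat.cast_zero, mul_zero, zero_add, one_mul, pow_zero]
      rw [div_mul_cancel_left₀ hs]
    · simp only [Nat.cast_zero, mul_zero, zero_add, one_mul, pow_zero]
      rw [div_mul_cancel_left₀ (hcos S hS h)]
  | succ j ih =>
    rw [List.replicate_succ', List.flatten_append, run_append, ih, List.flatten_singleton,
      run_amplify H' s hm hω]
    set A := Real.sin ((2 * j + 1) * θ) with hA
    set B := Real.cos ((2 * j + 1) * θ) with hB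
    have hsum : ∑ T ∈ P, (if GoodSet (sysCol H') s ω T then
          -((-1) ^ j * (if GoodSet (sysCol H') s ω T then A / (Real.sin θ * Real.sqrt D)
            else B / (Real.cos θ * Real.sqrt D)))
          else ((-1) ^ j * (if GoodSet (sysCol H') s ω T then A / (Real.sin θ * Real.sqrt D)
            else B / (Real.cos θ * Real.sqrt D)))) =
        (-1) ^ j * Real.sqrt D * (Real.cos θ * B - Real.sin θ * A) := by
      have e : ∀ T ∈ P, (if GoodSet (sysCol H') s ω T then
          -((-1) ^ j * (if GoodSet (sysCol H') s ω T then A / (Real.sin θ * Real.sqrt D)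
            else B / (Real.cos θ * Real.sqrt D)))
          else ((-1) ^ j * (if GoodSet (sysCol H') s ω T then A / (Real.sin θ * Real.sqrt D)
            else B / (Real.cos θ * Real.sqrt D)))) = if GoodSet (sysCol H') s ω T then
            -((-1) ^ j * (A / (Real.sin θ * Real.sqrt D)))
            else (-1) ^ j * (B / (Real.cos θ * Real.sqrt D)) := by
        intro T _; split_ifs <;> rfl
      rw [Finset.sum_congr rfl e, Finset.sum_ite, Finset.sum_const, Finset.sum_const, nsmul_eq_mul,
        nsmul_eq_mul, hbad, ← hθ]
      -- If cos θ = 0, the quotient by it is zero by convention, and it is multiplied by cos² θ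
      -- anyway.
      by_cases hc : Real.cos θ = 0
      · rw [hc]; field_simp; rw [Real.sq_sqrt hD.le]; ring
      · field_simp; rw [Real.sq_sqrt hD.le]; ring
    rw [hsum]
    unfold selState
    refine Finset.sum_congr rfl fun S hS => ?_
    congr 2
    have hang : ((2 * ((j + 1 : ℕ) : ℝ) + 1) * θ) = (2 * j + 1) * θ + 2 * θ := by push_cast; ring
    -- The rotation by 2θ. The factor (-1)^j is the global phase omitted from the amplification
    -- step.
    rw [hang, Real.sin_add, Real.cos_add, ← hA, ← hB, Real.sin_two_mul, Real.cos_two_mul]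
    dsimp only
    rw [← hDdef, pow_succ]
    have hsc := Real.sin_sq_add_cos_sq θ
    split_ifs with h
    · field_simp
      rw [Real.sq_sqrt hD.le]
      linear_combination 2 * A * D * hsc
    · have hc := hcos S hS h
      field_simp
      rw [Real.sq_sqrt hD.le]
      ring

end ISD

namespace ISD
variable {m κ : ℕ}
open Circuit Wire

/-! ### The success probability of the quantum circuit -/

/-- sin² = (1 - cos)/2 and the cosine sum telescopes. The factor sin 2θ is not divided out, as it
may vanish. -/
theorem four_mul_sum_sin_sq (θ : ℝ) (K : ℕ) :
    4 * Real.sin (2 * θ) * ∑ j ∈ Finset.range K, Real.sin ((2 * j + 1) * θ) ^ 2 =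
      2 * K * Real.sin (2 * θ) - Real.sin (4 * K * θ) := by
  induction K with
  | zero => simp
  | succ K ih =>
    rw [Finset.sum_range_succ, mul_add, ih]
    have h1 : Real.sin (4 * ((K + 1 : ℕ) : ℝ) * θ) =
        Real.sin (2 * ((2 * K + 1) * θ) + 2 * θ) := by congr 1; push_cast; ring
    have h2 : Real.sin (4 * (K : ℝ) * θ) =
        Real.sin (2 * ((2 * K + 1) * θ) - 2 * θ) := by congr 1; ring
    have h3 : Real.sin ((2 * K + 1) * θ) ^ 2 = 1 / 2 - Real.cos (2 * ((2 * K + 1) * θ)) / 2 :=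
      Real.sin_sq_eq_half_sub _
    rw [h1, h2, h3, Real.sin_add, Real.sin_sub]
    push_cast
    ring

/-- The sum equals (4K³ - K)/3. The bound serves the small-angle case, where the squared sines are
compared with the squares of the angles. -/
theorem cube_le_sum_odd_sq (K : ℕ) :
    (K : ℝ) ^ 3 ≤ ∑ j ∈ Finset.range K, ((2 * j + 1 : ℝ)) ^ 2 := by
  have h : ∀ K : ℕ, 3 * ∑ j ∈ Finset.range K, ((2 * j + 1 : ℝ)) ^ 2 = 4 * (K : ℝ) ^ 3 - K := by
    intro K
    induction K with
    | zero => simp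
    | succ K ih => rw [Finset.sum_range_succ, mul_add, ih]; push_cast; ring
  have h1 := h K
  have h2 : (K : ℝ) ≤ (K : ℝ) ^ 3 := by exact_mod_cast Nat.le_self_pow (by norm_num) K
  linarith

/-- The average success probability of amplitude amplification with a random number of steps. -/
theorem le_sum_sin_sq {θ a : ℝ} (hθ0 : 0 < θ) (hθ : θ ≤ Real.pi / 2) (ha : 0 < a) {K : ℕ}
    (hK0 : 0 < K) (hK : Real.pi / (4 * a) ≤ K) :
    K * (1 / 4 * min 1 (Real.sin θ ^ 2 / a ^ 2)) ≤
      ∑ j ∈ Finset.range K, Real.sin ((2 * j + 1) * θ) ^ 2 := by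
  have hKr : (0 : ℝ) < K := by exact_mod_cast hK0
  have hpi := Real.pi_pos
  have key := four_mul_sum_sin_sq θ K
  set X := ∑ j ∈ Finset.range K, Real.sin ((2 * j + 1) * θ) ^ 2 with hX
  have hmin : (K : ℝ) * (1 / 4 * min 1 (Real.sin θ ^ 2 / a ^ 2)) ≤ K * (1 / 4) := by
    have := min_le_left 1 (Real.sin θ ^ 2 / a ^ 2)
    nlinarith
  -- If sin 2θ ≥ 1/K, the oscillating term in `key` is at most half of the main term 2K sin 2θ, and
  -- the mean is at least 1/4.
  by_cases h1 : 1 / (K : ℝ) ≤ Real.sin (2 * θ)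
  · refine hmin.trans ?_
    have hpos : 0 < Real.sin (2 * θ) := (by positivity : 0 < 1 / (K : ℝ)).trans_le h1
    have h2 : 1 ≤ K * Real.sin (2 * θ) := by rw [div_le_iff₀ hKr] at h1; linarith
    have h3 := Real.sin_le_one (4 * K * θ)
    have : Real.sin (2 * θ) * (K * (1 / 4)) ≤ Real.sin (2 * θ) * X := by nlinarith
    exact le_of_mul_le_mul_left this hpos
  push Not at h1
  -- Otherwise θ is close to 0 or to π/2. Near 0, all angles (2j+1)θ stay below π/2, so Jordan's
  -- inequality sin x ≥ 2x/π applies to each term; K ≥ π/(4a) then brings in `a`.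
  rcases lt_or_ge θ (Real.pi / 4) with h2 | h2
  · have h3 := Real.mul_le_sin (x := 2 * θ) (by linarith) (by linarith)
    have h4 : 2 * K * θ ≤ Real.pi / 2 := by
      have h5 : 2 / Real.pi * (2 * θ) < 1 / K := h3.trans_lt h1
      rw [div_mul_eq_mul_div, div_lt_div_iff₀ hpi hKr] at h5
      linarith
    have h5 : ∀ j ∈ Finset.range K, (2 / Real.pi * θ) ^ 2 * (2 * j + 1 : ℝ) ^ 2 ≤
        Real.sin ((2 * j + 1) * θ) ^ 2 := by
      intro j hj
      have hj' : (j : ℝ) + 1 ≤ K := by exact_mod_cast Finset.mem_range.1 hj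
      have h6 : (2 * (j : ℝ) + 1) * θ ≤ Real.pi / 2 := by nlinarith
      have h7 := Real.mul_le_sin (x := (2 * j + 1) * θ) (by positivity) h6
      rw [← mul_pow]
      refine pow_le_pow_left₀ (by positivity) ?_ 2
      calc _ = 2 / Real.pi * ((2 * j + 1) * θ) := by ring
        _ ≤ _ := h7
    have h6 := Finset.sum_le_sum h5
    rw [← Finset.mul_sum] at h6
    refine le_trans ?_ h6
    have h7 := cube_le_sum_odd_sq K
    refine le_trans ?_ (mul_le_mul_of_nonneg_left h7 (by positivity))
    have h8 : Real.sin θ ≤ θ := Real.sin_le hθ0.le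
    have h9 : 0 ≤ Real.sin θ := Real.sin_nonneg_of_nonneg_of_le_pi hθ0.le (by linarith)
    have h10 : Real.sin θ / a / 2 ≤ 2 / Real.pi * θ * K := by
      calc Real.sin θ / a / 2 ≤ θ / a / 2 := by gcongr
        _ = 2 / Real.pi * θ * (Real.pi / (4 * a)) := by field_simp; norm_num
        _ ≤ _ := by gcongr
    have h11 : 1 / 4 * min 1 (Real.sin θ ^ 2 / a ^ 2) ≤ (2 / Real.pi * θ * K) ^ 2 := by
      calc _ ≤ 1 / 4 * (Real.sin θ ^ 2 / a ^ 2) := by gcongr; exact min_le_right _ _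
        _ = (Real.sin θ / a / 2) ^ 2 := by ring
        _ ≤ _ := by gcongr
    calc _ ≤ (K : ℝ) * (2 / Real.pi * θ * K) ^ 2 := by gcongr
      _ = _ := by ring
  · refine hmin.trans ?_
    rcases hθ.lt_or_eq with h3 | h3
    -- Near π/2, in terms of the small angle φ, the oscillating term has the favourable sign, and
    -- the mean is even at least 1/2.
    · set φ := Real.pi - 2 * θ with hφ
      have hsin : Real.sin (2 * θ) = Real.sin φ := by rw [hφ, Real.sin_pi_sub]
      have hpos : 0 < Real.sin (2 * θ) := Real.sin_pos_of_pos_of_lt_pi (by linarith) (by linarith)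
      have h4 := Real.mul_le_sin (x := φ) (by linarith) (by linarith)
      have h5 : 2 / Real.pi * φ < 1 / K := by rw [hsin] at h1; exact h4.trans_lt h1
      rw [div_mul_eq_mul_div, div_lt_div_iff₀ hpi hKr] at h5
      have h6 : Real.sin (4 * K * θ) = - Real.sin (2 * K * φ) := by
        have : 4 * K * θ = K * (2 * Real.pi) - 2 * K * φ := by rw [hφ]; ring
        rw [this, Real.sin_nat_mul_two_pi_sub]
      have h7 : 0 ≤ Real.sin (2 * K * φ) :=
        Real.sin_nonneg_of_nonneg_of_le_pi (by have : 0 ≤ φ := by linarith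
                                               positivity) (by linarith)
      rw [h6] at key
      have : Real.sin (2 * θ) * (K * (1 / 4)) ≤ Real.sin (2 * θ) * X := by nlinarith
      exact le_of_mul_le_mul_left this hpos
    -- At θ = π/2 the identity `key` degenerates to 0 = 0, but every term of the sum is 1.
    · have : X = K := by
        rw [hX, Finset.sum_congr rfl fun j _ => (?_ : _ = (1 : ℝ))]
        · simp
        · have hc : Real.cos ((2 * j + 1) * θ) = 0 := by
            rw [Real.cos_eq_zero_iff]
            exact ⟨j, by rw [h3]; push_cast; ring⟩
          have := Real.sin_sq_add_cos_sq ((2 * j + 1) * θ)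
          rw [hc] at this
          linarith
      rw [this]; linarith

/-- The selected columns. -/
def selection (x : Wire m κ → Bool) : Finset (Fin m ⊕ Fin κ) :=
  Finset.univ.filter fun σ => x (sel σ) = true

theorem selection_partial (H' : Matrix (Fin m) (Fin κ) (ZMod 2)) (s : Fin m → ZMod 2)
    (S : Finset (Fin m ⊕ Fin κ)) : selection (Reg.partial H' s S).state = S := by
  ext σ
  simp [selection, Reg.partial, Reg.selected]

open Classical in
/-- The number of sets of columns that yield a solution. -/
noncomputable def goodCount (v : Fin m ⊕ Fin κ → Fin m → ZMod 2) (s : Fin m → ZMod 2) (ω : ℕ) : ℕ :=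
  ((Finset.powersetCard m Finset.univ).filter (GoodSet v s ω)).card

theorem sin_sq_le_measure (H' : Matrix (Fin m) (Fin κ) (ZMod 2)) (s : Fin m → ZMod 2)
    (hm : 0 < m) {ω : ℕ} (hω : ω ≤ m) {θ : ℝ}
    (hθ : Real.sin θ ^ 2 * ((m + κ).choose m : ℝ) = goodCount (sysCol H') s ω)
    (hs : Real.sin θ ≠ 0) (j : ℕ) :
    ENNReal.ofReal (Real.sin ((2 * j + 1) * θ) ^ 2) ≤
      (quantumPrange H' s ω j).measure.toOuterMeasure
        {x | GoodSet (sysCol H') s ω (selection x)} := by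
  classical
  have hrun : run (quantumPrange H' s ω j) (zeroState (Wire m κ)) =
      run (List.replicate j (amplify m κ ω)).flatten (uniformState H' s) := by
    rw [quantumPrange, run_append, run_append, zeroState_eq, run_ket (classical_load H' s),
      act_load, run_superpose]
  set G := (Finset.powersetCard m Finset.univ).filter (GoodSet (sysCol H') s ω) with hG
  have hcard : (G.card : ℝ) = Real.sin θ ^ 2 * ((m + κ).choose m : ℝ) := by
    rw [hθ, goodCount]
  rw [run_amplify_iterate H' s hm hω hcard.symm hs] at hrun
  rw [PMF.toOuterMeasure_apply_fintype]
  have hinj : Set.InjOn (fun S => (Reg.partial H' s S).state) (G : Set (Finset (Fin m ⊕ Fin κ))) :=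
    fun S _ T _ h => Reg.partial_state_injective H' s h
  -- Only the basis states of the good sets are counted; they share the probability sin²((2j+1)θ)
  -- equally.
  refine le_trans ?_ (Finset.sum_le_sum_of_subset
    (Finset.subset_univ (G.image fun S => (Reg.partial H' s S).state)))
  rw [Finset.sum_image hinj]
  have hD : (0 : ℝ) < ((m + κ).choose m : ℝ) := by
    exact_mod_cast Nat.choose_pos (Nat.le_add_right m κ)
  have hterm : ∀ S ∈ G, Set.indicator {x | GoodSet (sysCol H') s ω (selection x)}
      (⇑(quantumPrange H' s ω j).measure) (Reg.partial H' s S).state =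
      ENNReal.ofReal (Real.sin ((2 * j + 1) * θ) ^ 2 / G.card) := by
    intro S hS
    have hgood : GoodSet (sysCol H') s ω S := (Finset.mem_filter.1 hS).2
    rw [Set.indicator_of_mem (by simpa [selection_partial] using hgood)]
    change ENNReal.ofReal _ = _
    congr 1
    rw [hrun, selState_apply H' s _ hgood.1, if_pos hgood, hcard, Complex.norm_real,
      Real.norm_eq_abs, sq_abs, mul_pow, ← pow_mul, mul_comm j 2, pow_mul, neg_one_sq, one_pow,
      one_mul, div_pow, mul_pow, Real.sq_sqrt hD.le]
  rw [Finset.sum_congr rfl hterm, Finset.sum_const, nsmul_eq_mul, ← ENNReal.ofReal_natCast,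
    ← ENNReal.ofReal_mul (by positivity)]
  have hne : (G.card : ℝ) ≠ 0 := by rw [hcard]; positivity
  rw [mul_div_cancel₀ _ hne]

/-- The success probability of the quantum circuit, averaged over the number of steps. -/
theorem le_sum_measure (H' : Matrix (Fin m) (Fin κ) (ZMod 2)) (s : Fin m → ZMod 2)
    (hm : 0 < m) {ω : ℕ} (hω : ω ≤ m) :
    ENNReal.ofReal ((maxSteps m κ ω + 1 : ℕ) * (1 / 4 * min 1
      ((goodCount (sysCol H') s ω : ℝ) / ((m + κ).choose m : ℝ) /
        ((m.choose ω : ℝ) / ((m + κ).choose ω : ℝ))))) ≤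
      ∑ j : Fin (maxSteps m κ ω + 1), (quantumPrange H' s ω j).measure.toOuterMeasure
        {x | GoodSet (sysCol H') s ω (selection x)} := by
  have hD : (0 : ℝ) < ((m + κ).choose m : ℝ) := by
    exact_mod_cast Nat.choose_pos (Nat.le_add_right m κ)
  have ha : (0 : ℝ) < (m.choose ω : ℝ) / ((m + κ).choose ω : ℝ) := by
    have h1 := Nat.choose_pos hω
    have h2 := Nat.choose_pos (hω.trans (Nat.le_add_right m κ))
    positivity
  -- Without good sets the bound is zero; otherwise θ > 0, as the amplitude formula requires.
  rcases Nat.eq_zero_or_pos (goodCount (sysCol H') s ω) with h0 | hg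
  · simp [h0]
  have hle : (goodCount (sysCol H') s ω : ℝ) ≤ ((m + κ).choose m : ℝ) := by
    classical
    have : goodCount (sysCol H') s ω ≤ (m + κ).choose m := by
      refine (Finset.card_filter_le _ _).trans ?_
      rw [Finset.card_powersetCard, Finset.card_univ]
      simp
    exact_mod_cast this
  have hg' : (0 : ℝ) < goodCount (sysCol H') s ω := by exact_mod_cast hg
  set p := (goodCount (sysCol H') s ω : ℝ) / ((m + κ).choose m : ℝ) with hp
  have hp0 : 0 < p := by positivity
  have hp1 : p ≤ 1 := div_le_one_of_le₀ hle hD.le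
  set θ := Real.arcsin (Real.sqrt p) with hθ
  have hsin : Real.sin θ = Real.sqrt p :=
    Real.sin_arcsin ((by norm_num : (-1 : ℝ) ≤ 0).trans (Real.sqrt_nonneg _))
      (Real.sqrt_le_one.2 hp1)
  have hsin2 : Real.sin θ ^ 2 = p := by rw [hsin, Real.sq_sqrt hp0.le]
  have hθ0 : 0 < θ := Real.arcsin_pos.2 (Real.sqrt_pos.2 hp0)
  have hmain := le_sum_sin_sq hθ0 (Real.arcsin_le_pi_div_two _) (Real.sqrt_pos.2 ha)
    (Nat.succ_pos (maxSteps m κ ω)) (by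
      push_cast
      exact (Nat.le_ceil _).trans (by rw [maxSteps]; linarith))
  rw [hsin2, Real.sq_sqrt ha.le] at hmain
  refine (ENNReal.ofReal_le_ofReal hmain).trans ?_
  rw [ENNReal.ofReal_sum_of_nonneg fun _ _ => by positivity, ← Fin.sum_univ_eq_sum_range
    fun j => ENNReal.ofReal (Real.sin ((2 * j + 1) * θ) ^ 2)]
  refine Finset.sum_le_sum fun j _ => ?_
  refine sin_sq_le_measure H' s hm hω ?_ (by rw [hsin]; exact (Real.sqrt_pos.2 hp0).ne') j
  rw [hsin2, hp, div_mul_cancel₀ _ hD.ne']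

end ISD

namespace ISD

/-! ### Classical Gaussian elimination -/

namespace Tableau

variable {m N : ℕ}

/-- The state of the elimination after the columns in `D` have been tried; `U` is the composition
of the row operations. -/
structure Reduced (A : Matrix (Fin m) (Fin N) (ZMod 2)) (s : Fin m → ZMod 2) (D : Set (Fin N))
    (T : Tableau m N) (U : (Fin m → ZMod 2) ≃ₗ[ZMod 2] (Fin m → ZMod 2)) : Prop where
  col : ∀ j, T.A.col j = U (A.col j)
  syn : T.s = U s
  unit : ∀ r j, T.pivot r = some j → T.A.col j = Pi.single r 1
  mem : ∀ r j, T.pivot r = some j → j ∈ D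
  zero : ∀ r, T.pivot r = none → ∀ j ∈ D, T.A r j = 0

variable {A : Matrix (Fin m) (Fin N) (ZMod 2)} {s : Fin m → ZMod 2} {D : Set (Fin N)}
  {T : Tableau m N} {U : (Fin m → ZMod 2) ≃ₗ[ZMod 2] (Fin m → ZMod 2)}

/-- The decisive part of the invariant is that rows without a pivot vanish on all tried columns. It
persists because the new pivot row is itself such a row, and adding it does not disturb them there.
-/
theorem Reduced.step (h : Reduced A s D T U) (c : Fin N) :
    ∃ U', Reduced A s (insert c D) (T.step c) U' := by
  unfold Tableau.step
  cases hf : (List.finRange m).find? fun r => decide (T.pivot r = none ∧ T.A r c = 1) with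
  | none =>
    refine ⟨U, h.col, h.syn, h.unit, fun r j hr => Or.inr (h.mem r j hr), ?_⟩
    rintro r hr j (rfl | hj)
    · have := List.find?_eq_none.1 hf r (List.mem_finRange r)
      rcases zmod_two_eq (T.A r j) with h0 | h0
      · exact h0
      · simp only [decide_eq_true_eq, not_and] at this
        exact absurd h0 (this hr)
    · exact h.zero r hr j hj
  | some r =>
    have hr : T.pivot r = none ∧ T.A r c = 1 := by simpa using List.find?_some hf
    have hE : ∀ j, (fun i => if i ≠ r ∧ T.A i c = 1 then T.A i j + T.A r j else T.A i j) =
        clearEquiv (T.A.col c) r (T.A.col j) := fun j => rfl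
    have hpiv : ∀ r' j, T.pivot r' = some j → r' ≠ r := by
      rintro r' j h1 rfl
      rw [hr.1] at h1
      exact absurd h1 (by simp)
    refine ⟨U.trans (clearEquiv (T.A.col c) r), ?_, ?_, ?_, ?_, ?_⟩
    · intro j
      rw [LinearEquiv.trans_apply, ← h.col]
      rfl
    · rw [LinearEquiv.trans_apply, ← h.syn]
      rfl
    · intro r' j hr'
      dsimp only at hr'
      by_cases h1 : r' = r
      · subst h1
        rw [Function.update_self, Option.some.injEq] at hr'
        subst hr'
        exact clearEquiv_column _ hr.2
      · rw [Function.update_of_ne h1] at hr'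
        have h2 := h.unit r' j hr'
        change clearEquiv (T.A.col c) r (T.A.col j) = _
        rw [h2, clearEquiv_single _ h1]
    · intro r' j hr'
      dsimp only at hr'
      by_cases h1 : r' = r
      · subst h1
        rw [Function.update_self, Option.some.injEq] at hr'
        exact Or.inl hr'.symm
      · rw [Function.update_of_ne h1] at hr'
        exact Or.inr (h.mem r' j hr')
    · intro r' hr' j hj
      dsimp only at hr'
      have h1 : r' ≠ r := by
        rintro rfl
        simp at hr'
      rw [Function.update_of_ne h1] at hr'
      rcases hj with rfl | hj
      · change clearEquiv (T.A.col j) r (T.A.col j) r' = 0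
        rw [clearEquiv_column (T.A.col j) hr.2, Pi.single_eq_of_ne h1]
      · have h2 := h.zero r' hr' j hj
        have h3 := h.zero r hr.1 j hj
        dsimp only
        rw [h2, h3]
        simp

theorem reduced_gauss (A : Matrix (Fin m) (Fin N) (ZMod 2)) (s : Fin m → ZMod 2)
    (cols : List (Fin N)) : ∃ U, Reduced A s {j | j ∈ cols} (gauss A s cols) U := by
  have key : ∀ (l : List (Fin N)) (D : Set (Fin N)) (T : Tableau m N) U, Reduced A s D T U →
      ∃ U', Reduced A s (D ∪ {j | j ∈ l}) (l.foldl Tableau.step T) U' := by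
    intro l
    induction l with
    | nil => intro D T U h; exact ⟨U, by simpa using h⟩
    | cons c l ih =>
      intro D T U h
      obtain ⟨U', h'⟩ := h.step c
      obtain ⟨U'', h''⟩ := ih _ _ _ h'
      refine ⟨U'', ?_⟩
      have e : D ∪ {j | j ∈ c :: l} = insert c D ∪ {j | j ∈ l} := by
        ext j
        simp only [Set.mem_union, Set.mem_ofPred_eq, List.mem_cons, Set.mem_insert_iff]
        tauto
      rw [e]
      exact h''
  obtain ⟨U, h⟩ := key cols ∅ ⟨A, s, fun _ => none⟩ (LinearEquiv.refl _ _)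
    ⟨fun _ => rfl, rfl, fun r j h => absurd h (by simp), fun r j h => absurd h (by simp),
      fun r _ j h => absurd h (by simp)⟩
  rw [Set.empty_union] at h
  exact ⟨U, h⟩

theorem Reduced.pivot_injective (h : Reduced A s D T U) {r r' : Fin m} {j : Fin N}
    (hr : T.pivot r = some j) (hr' : T.pivot r' = some j) : r = r' := by
  have h1 := (h.unit r j hr).symm.trans (h.unit r' j hr')
  by_contra hne
  have h2 := congrFun h1 r
  rw [Pi.single_eq_same, Pi.single_eq_of_ne hne] at h2
  exact one_ne_zero h2

/-- Gaussian elimination on independent columns finds the solution. -/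
theorem solution_gauss (A : Matrix (Fin m) (Fin N) (ZMod 2)) (s : Fin m → ZMod 2)
    (cols : List (Fin N)) (hli : LinearIndepOn (ZMod 2) A.col {j | j ∈ cols})
    {x : Fin N → ZMod 2} (hx : ∀ j, j ∉ cols → x j = 0) (hs : ∑ j, x j • A.col j = s) :
    (gauss A s cols).solution = x := by
  classical
  obtain ⟨U, h⟩ := reduced_gauss A s cols
  set T := gauss A s cols with hT
  -- A column without a pivot would have support only in pivot rows, and so be a combination of the
  -- pivot columns, against independence.
  have hpiv : ∀ c ∈ cols, ∃ r, T.pivot r = some c := by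
    intro c hc
    by_contra hne
    push Not at hne
    refine hli.notMem_span hc ?_
    have hcol : A.col c = ∑ r, T.A r c • U.symm (Pi.single r 1) := by
      apply U.injective
      rw [← h.col, map_sum]
      simp only [map_smul, LinearEquiv.apply_symm_apply]
      exact pi_eq_sum_univ' (T.A.col c)
    rw [hcol]
    refine Submodule.sum_mem _ fun r _ => ?_
    cases hr : T.pivot r with
    | none => rw [h.zero r hr c hc, zero_smul]; exact Submodule.zero_mem _
    | some j =>
      refine Submodule.smul_mem _ _ (Submodule.subset_span ⟨j, ⟨h.mem r j hr, ?_⟩, ?_⟩)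
      · rintro rfl; exact hne r hr
      · rw [← h.unit r j hr, h.col, LinearEquiv.symm_apply_apply]
  -- A row is needed as default value of `ρ` outside `cols`; if there are no rows, everything is
  -- zero.
  by_cases hm : ∃ r : Fin m, True
  swap
  · have h0 : ∀ j, x j = 0 := fun j => by
      by_contra hj
      have : j ∈ cols := by by_contra hj'; exact hj (hx j hj')
      obtain ⟨r, -⟩ := hpiv j this
      exact hm ⟨r, trivial⟩
    funext j
    rw [h0 j, solution]
    exact Finset.sum_eq_zero fun r _ => absurd ⟨r, trivial⟩ hm
  obtain ⟨r₁, -⟩ := hm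
  have hρ : ∀ j, ∃ r, j ∈ cols → T.pivot r = some j := fun j => by
    by_cases hj : j ∈ cols
    · obtain ⟨r, hr⟩ := hpiv j hj
      exact ⟨r, fun _ => hr⟩
    · exact ⟨r₁, fun h => absurd h hj⟩
  choose ρ hρ using hρ
  have hinj : Set.InjOn ρ (cols.toFinset : Set (Fin N)) := by
    intro i hi j hj hij
    have h1 := hρ i (by simpa using hi)
    have h2 := hρ j (by simpa using hj)
    rw [hij, h2] at h1
    exact (Option.some.inj h1).symm
  have key : ∀ j ∈ cols, x j = T.s (ρ j) := fun j hj => by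
    rw [h.syn]
    exact unit_columns_solution (v := A.col) U hinj
      (fun i hi => by rw [← h.col]; exact h.unit _ _ (hρ i (by simpa using hi)))
      (fun i hi => hx i (by simpa using hi)) hs (by simpa using hj)
  funext j
  by_cases hj : j ∈ cols
  · rw [key j hj, solution, Finset.sum_eq_single (ρ j)]
    · rw [if_pos (hρ j hj)]
    · intro r _ hr
      rw [if_neg fun h1 => hr (h.pivot_injective h1 (hρ j hj))]
    · exact fun h => absurd (Finset.mem_univ _) h
  · rw [hx j hj, solution]
    exact Finset.sum_eq_zero fun r _ => if_neg fun h1 => hj (h.mem r j h1)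

/-- A row without a pivot would vanish on all columns after the row operations. The corresponding
nonzero functional would then vanish on the columns in `S`, which span. -/
theorem full_gauss (A : Matrix (Fin m) (Fin N) (ZMod 2)) (s : Fin m → ZMod 2)
    {S : Finset (Fin N)} (hS : S.card = m) (hli : LinearIndepOn (ZMod 2) A.col (S : Set (Fin N))) :
    (gauss A s (List.finRange N)).Full := by
  obtain ⟨U, h⟩ := reduced_gauss A s (List.finRange N)
  intro r hr
  have hspan : Submodule.span (ZMod 2) (Set.range fun i : (S : Set (Fin N)) => A.col i) = ⊤ :=
    LinearIndependent.span_eq_top_of_card_eq_finrank' hli (by simp [hS])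
  have hz : LinearMap.proj r ∘ₗ U.toLinearMap = (0 : (Fin m → ZMod 2) →ₗ[ZMod 2] ZMod 2) := by
    refine LinearMap.ext_on_range hspan fun i => ?_
    have := h.zero r hr i (by simp)
    rw [LinearMap.comp_apply, LinearEquiv.coe_coe, ← h.col]
    exact this
  have := LinearMap.congr_fun hz (U.symm (Pi.single r 1))
  simp at this

/-! ### The systematic form -/

/-- The columns of the systematic form, as columns of the original matrix. -/
def IsColMap (T : Tableau m N) (f : Fin m ⊕ Fin (N - m) → Fin N) : Prop :=
  (∀ r, T.pivot r = some (f (Sum.inl r))) ∧ ∀ c : Fin (N - m), T.rest[(c : ℕ)]? = some (f (Sum.inr c))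

/-- With every row having its own pivot column, exactly `N - m` columns remain in `rest`, so the
default value in `systematic` is never used. -/
theorem Reduced.exists_colMap (h : Reduced A s D T U) (hF : T.Full) :
    ∃ f : Fin m ⊕ Fin (N - m) ≃ Fin N, IsColMap T f := by
  classical
  have hp : ∀ r, ∃ j, T.pivot r = some j := fun r => Option.ne_none_iff_exists'.1 (hF r)
  choose p hp using hp
  have hpinj : Function.Injective p := fun r r' hr =>
    h.pivot_injective (hp r) (by rw [hp r', hr])
  have hmN : m ≤ N := by simpa using Fintype.card_le_of_injective p hpinj
  have hrest : ∀ j, j ∈ T.rest ↔ ∀ r, p r ≠ j := by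
    intro j
    simp [rest, hp]
  have hnodup : T.rest.Nodup := (List.nodup_finRange N).filter _
  have hlen : T.rest.length = N - m := by
    rw [← List.toFinset_card_of_nodup hnodup]
    have : T.rest.toFinset = Finset.univ \ Finset.univ.image p := by
      ext j; simp [hrest]
    rw [this, Finset.card_sdiff_of_subset (Finset.subset_univ _),
      Finset.card_image_of_injective _ hpinj]
    simp
  let f : Fin m ⊕ Fin (N - m) → Fin N := Sum.elim p fun c => T.rest[(c : ℕ)]'(by rw [hlen]; exact c.2)
  have hinj : Function.Injective f := by
    rintro (r | c) (r' | c') he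
    · exact congrArg Sum.inl (hpinj he)
    · exact absurd he ((hrest _).1 (List.getElem_mem _) r)
    · exact absurd he.symm ((hrest _).1 (List.getElem_mem _) r')
    · have := (hnodup.getElem_inj_iff).1 he
      exact congrArg Sum.inr (Fin.ext this)
  have hbij : Function.Bijective f := by
    rw [Fintype.bijective_iff_injective_and_card]
    exact ⟨hinj, by simp; omega⟩
  refine ⟨Equiv.ofBijective f hbij, hp, fun c => ?_⟩
  exact List.getElem?_eq_getElem (by rw [hlen]; exact c.2)

theorem Reduced.sysCol_systematic (h : Reduced A s D T U) {f : Fin m ⊕ Fin (N - m) → Fin N}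
    (hf : IsColMap T f) (σ : Fin m ⊕ Fin (N - m)) :
    sysCol T.systematic σ = U (A.col (f σ)) := by
  rw [← h.col]
  cases σ with
  | inl r => rw [h.unit r _ (hf.1 r)]; rfl
  | inr c =>
    funext r
    simp [sysCol, systematic, hf.2 c, Matrix.col]

theorem mem_columns {f : Fin m ⊕ Fin (N - m) → Fin N} (hf : IsColMap T f)
    (b : Fin m ⊕ Fin (N - m) → Bool) (j : Fin N) :
    j ∈ T.columns b ↔ ∃ σ, b σ = true ∧ f σ = j := by
  simp only [columns, List.mem_append, List.mem_filterMap, List.mem_filter, List.mem_finRange,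
    true_and, hf.1, Option.some.injEq, Sum.exists, List.bind_eq_flatMap, List.pure_def,
    List.mem_flatMap, List.mem_singleton]
  refine or_congr Iff.rfl ⟨?_, ?_⟩
  · rintro ⟨a, ⟨c, hc, rfl⟩, ha⟩
    rw [hf.2] at ha
    exact ⟨c, hc, Option.some.inj ha⟩
  · rintro ⟨c, hc, rfl⟩
    exact ⟨c, ⟨c, hc, rfl⟩, hf.2 c⟩

theorem length_columns_le (T : Tableau m N) (b : Fin m ⊕ Fin (N - m) → Bool) :
    (T.columns b).length ≤ m + (N - m) := by
  rw [columns, List.length_append]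
  refine add_le_add ((List.length_filterMap_le _ _).trans ?_)
    ((List.length_filterMap_le _ _).trans ?_)
  · exact (List.length_filter_le _ _).trans (by simp)
  · simp only [List.bind_eq_flatMap, List.pure_def, List.length_flatMap, List.length_singleton,
      List.map_const', List.sum_replicate, smul_eq_mul, mul_one]
    exact (List.length_filter_le _ _).trans (by simp)

end Tableau

theorem LinearIndepOn.of_equiv {ι ι' : Type*} {m : ℕ} (f : ι ≃ ι')
    (U : (Fin m → ZMod 2) ≃ₗ[ZMod 2] (Fin m → ZMod 2)) {v : ι → Fin m → ZMod 2}
    {w : ι' → Fin m → ZMod 2} (hv : ∀ i, v i = U (w (f i))) (S : Finset ι) :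
    LinearIndepOn (ZMod 2) v (S : Set ι) ↔
      LinearIndepOn (ZMod 2) w ((S.map f.toEmbedding : Finset ι') : Set ι') := by
  have e : v = U.toLinearMap ∘ (w ∘ f) := funext hv
  rw [e, Finset.coe_map]
  constructor
  · intro h
    exact LinearIndepOn.image_of_comp f w (h.of_comp U.toLinearMap)
  · intro h
    exact (h.comp_of_image f.injective.injOn).map_injOn U.toLinearMap U.injective.injOn

/-- Row operations and reordering of columns preserve independence, solutions and weights. This
carries good sets between the systematic form seen by the circuit and the shortened matrix. -/
theorem goodSet_iff_of_equiv {ι ι' : Type*} [Fintype ι] [Fintype ι'] {m : ℕ} (f : ι ≃ ι')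
    (U : (Fin m → ZMod 2) ≃ₗ[ZMod 2] (Fin m → ZMod 2)) {v : ι → Fin m → ZMod 2}
    {w : ι' → Fin m → ZMod 2} (hv : ∀ i, v i = U (w (f i))) {s t : Fin m → ZMod 2} (ht : t = U s)
    (ω : ℕ) (S : Finset ι) : GoodSet v t ω S ↔ GoodSet w s ω (S.map f.toEmbedding) := by
  unfold GoodSet
  rw [Finset.card_map, ← LinearIndepOn.of_equiv f U hv S]
  refine and_congr_right fun _ => and_congr_right fun _ => ?_
  have hnorm : ∀ x : ι' → ZMod 2, hammingNorm (x ∘ f) = hammingNorm x := by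
    intro x
    classical
    refine Finset.card_bij (fun i _ => f i) ?_ ?_ ?_
    · intro i hi; simpa using hi
    · intro i _ j _ h; exact f.injective h
    · intro j hj; exact ⟨f.symm j, by simpa using hj, by simp⟩
  have hsum : ∀ x : ι' → ZMod 2, ∑ i, (x ∘ f) i • v i = t ↔ ∑ i, x i • w i = s := by
    intro x
    have : ∑ i, (x ∘ f) i • v i = U (∑ i, x i • w i) := by
      rw [map_sum, ← f.sum_comp]
      exact Finset.sum_congr rfl fun i _ => by rw [map_smul, hv]; rfl
    rw [this, ht, U.injective.eq_iff]
  constructor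
  · rintro ⟨x, h1, h2, h3⟩
    have e : (x ∘ f.symm) ∘ f = x := by funext i; simp
    refine ⟨x ∘ f.symm, fun j hj => h1 _ fun h => hj ?_, ?_, ?_⟩
    · exact Finset.mem_map.2 ⟨_, h, by simp⟩
    · rw [← hsum, e]; exact h2
    · rw [← hnorm, e]; exact h3
  · rintro ⟨x, h1, h2, h3⟩
    refine ⟨x ∘ f, fun i hi => h1 _ fun h => hi ?_, (hsum x).2 h2, (hnorm x).trans h3⟩
    simpa using h

end ISD

namespace ISD
variable {m κ : ℕ}
open Circuit Wire

/-! ### The cost of the circuit -/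

namespace Circuit

variable {Q : Type}

theorem cost_append (c d : Circuit Q) : Circuit.cost (c ++ d) = Circuit.cost c + Circuit.cost d := by
  simp [Circuit.cost]

theorem cost_cons (g : Gate Q) (c : Circuit Q) :
    Circuit.cost (g :: c) = g.cost + Circuit.cost c := by
  simp [Circuit.cost]

theorem cost_nil : Circuit.cost ([] : Circuit Q) = 0 := rfl

theorem cost_inv (c : Circuit Q) : Circuit.cost (Circuit.inv c) = Circuit.cost c := by
  unfold Circuit.cost Circuit.inv
  rw [List.map_reverse, List.sum_reverse, List.map_map]
  rfl

theorem cost_flatMap_le {α : Type*} (l : List α) (f : α → Circuit Q) {b : ℕ}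
    (h : ∀ a ∈ l, Circuit.cost (f a) ≤ b) : Circuit.cost (l.flatMap f) ≤ l.length * b := by
  induction l with
  | nil => simp [Circuit.cost]
  | cons a l ih =>
    rw [List.flatMap_cons, cost_append, List.length_cons, Nat.add_mul, one_mul, add_comm]
    exact add_le_add (ih fun x hx => h x (by simp [hx])) (h a (by simp))

theorem cost_map_le {α : Type*} (l : List α) (f : α → Gate Q) {b : ℕ}
    (h : ∀ a ∈ l, (f a).cost ≤ b) : Circuit.cost (l.map f) ≤ l.length * b := by
  induction l with
  | nil => simp [Circuit.cost]
  | cons a l ih =>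
    rw [List.map_cons, cost_cons, List.length_cons, Nat.add_mul, one_mul, add_comm]
    exact add_le_add (ih fun x hx => h x (by simp [hx])) (h a (by simp))

theorem cost_mcx (ctrl : List (Q × Bool)) (t : Q) : (mcx ctrl t).cost = ctrl.length + 1 := rfl

end Circuit

theorem cost_superpose (m κ : ℕ) :
    Circuit.cost (superpose m κ) ≤ 1 + (m + κ) * (m * 2 + m * 6) := by
  unfold superpose
  rw [cost_cons]
  refine add_le_add le_rfl ?_
  refine (cost_flatMap_le _ _ (b := m * 2 + m * 6) fun i _ => ?_).trans (by simp)
  dsimp only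
  rw [cost_append]
  refine add_le_add ?_ ?_
  · exact (cost_map_le _ _ (b := 2) fun j _ => le_rfl).trans (by simp)
  · exact (cost_flatMap_le _ _ (b := 6) fun j _ => le_rfl).trans (by simp)

theorem cost_load (H' : Matrix (Fin m) (Fin κ) (ZMod 2)) (s : Fin m → ZMod 2) :
    Circuit.cost (load H' s) ≤ m * κ + m := by
  unfold load
  rw [cost_append]
  refine add_le_add ?_ ?_
  · refine (cost_flatMap_le _ _ (b := κ) fun r _ => ?_).trans (by simp)
    refine (cost_flatMap_le _ _ (b := 1) fun c _ => ?_).trans (by simp)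
    split_ifs
    · exact le_rfl
    · exact Nat.zero_le _
  · refine (cost_flatMap_le _ _ (b := 1) fun c _ => ?_).trans (by simp)
    split_ifs
    · exact le_rfl
    · exact Nat.zero_le _

theorem cost_assignRow (m : ℕ) (c : Fin κ) : Circuit.cost (assignRow m c) ≤ m * (m + 3) := by
  unfold assignRow
  refine (cost_map_le _ _ (b := m + 3) fun r _ => ?_).trans (by simp)
  rw [cost_mcx]
  simp only [List.length_cons, List.length_map]
  have := List.length_filter_le (· < r) (List.finRange m)
  rw [List.length_finRange] at this
  omega

theorem cost_pivotSearch (m : ℕ) (c : Fin κ) : Circuit.cost (pivotSearch m c) ≤ 1 + m * 8 := by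
  unfold pivotSearch
  rw [cost_cons]
  refine add_le_add le_rfl ?_
  exact (cost_flatMap_le _ _ (b := 8) fun r _ => le_rfl).trans (by simp)

theorem cost_addRow (ctrl : List (Wire m κ × Bool)) (c : Fin κ) (i r : Fin m) :
    Circuit.cost (addRow ctrl c i r) ≤ (κ + 1) * (ctrl.length + 2) := by
  unfold addRow
  rw [cost_append, Nat.add_mul, one_mul]
  refine add_le_add ?_ ?_
  · refine (cost_map_le _ _ (b := ctrl.length + 2) fun r _ => ?_).trans ?_
    · rw [cost_mcx]; simp
    · refine Nat.mul_le_mul_right _ ((List.length_filter_le _ _).trans (by simp))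
  · rw [cost_cons, cost_nil, cost_mcx]; simp

theorem cost_eliminate (m : ℕ) (c : Fin κ) :
    Circuit.cost (eliminate m c) ≤ 2 * (m * (m * ((κ + 1) * 4))) := by
  unfold eliminate
  rw [cost_append, two_mul]
  refine add_le_add ?_ ?_
  all_goals
    refine (cost_flatMap_le _ _ (b := m * ((κ + 1) * 4)) fun r _ => ?_).trans (by simp)
    refine (cost_flatMap_le _ _ (b := (κ + 1) * 4) fun i _ => cost_addRow _ _ _ _).trans ?_
    exact Nat.mul_le_mul_right _ ((List.length_filter_le _ _).trans (by simp))

theorem cost_releaseRow (m : ℕ) (c : Fin κ) :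
    Circuit.cost (releaseRow m c) ≤ m * 4 + m * (m + 3) := by
  unfold releaseRow
  rw [cost_append]
  refine add_le_add ?_ ?_
  · exact (cost_flatMap_le _ _ (b := 4) fun r _ => le_rfl).trans (by simp)
  · refine (cost_map_le _ _ (b := m + 3) fun r _ => ?_).trans (by simp)
    rw [cost_mcx]
    simp only [List.length_cons, List.length_map]
    have := List.length_filter_le (r < ·) (List.finRange m)
    rw [List.length_finRange] at this
    omega

theorem cost_solve (m κ : ℕ) : Circuit.cost (solve m κ) ≤
    m * 2 + κ * (m * (m + 3) + (1 + m * 8) + 3 + 2 * (m * (m * ((κ + 1) * 4))) + (1 + m * 8) +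
      (m * 4 + m * (m + 3))) := by
  unfold solve
  rw [cost_append]
  refine add_le_add ?_ ?_
  · exact (cost_map_le _ _ (b := 2) fun r _ => le_rfl).trans (by simp)
  · refine (cost_flatMap_le _ _ fun c _ => ?_).trans_eq (by rw [List.length_finRange])
    simp only [cost_append, cost_inv]
    have h1 := cost_assignRow m c
    have h2 := cost_pivotSearch m c
    have h3 := cost_eliminate m c
    have h4 := cost_releaseRow m c
    have h5 : Circuit.cost [mcx [(sel (Sum.inr c), true), (seek (Fin.last m), true)]
      (bad c : Wire m κ)] = 3 := rfl
    omega

theorem cost_accumulate (m κ : ℕ) : Circuit.cost (accumulate m κ) ≤ 1 + m * (m * 6) := by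
  unfold accumulate
  rw [cost_cons]
  refine add_le_add le_rfl ?_
  refine (cost_flatMap_le _ _ (b := m * 6) fun r _ => ?_).trans (by simp)
  exact (cost_flatMap_le _ _ (b := 6) fun j _ => le_rfl).trans (by simp)

theorem cost_flipTarget (m κ ω : ℕ) : Circuit.cost (flipTarget m κ ω) =
    2 * Circuit.cost (solve m κ) + 2 * Circuit.cost (accumulate m κ) + κ + 1 := by
  unfold flipTarget
  simp only [cost_append, cost_inv, cost_cons, cost_nil, Gate.cost, List.length_map,
    List.length_finRange]
  ring

theorem cost_flipZero (m κ : ℕ) : Circuit.cost (flipZero m κ) = 2 * m + κ + 3 := by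
  unfold flipZero
  simp only [cost_cons, cost_nil, Gate.cost, mcx, List.length_append, List.length_map,
    List.length_finRange, List.length_nil]
  ring

theorem cost_amplify_le {b : ℕ} (hb : 1 ≤ b) (h : m + κ ≤ b) (ω : ℕ) :
    Circuit.cost (amplify m κ ω) ≤ 150 * b ^ 4 := by
  have e : Circuit.cost (amplify m κ ω) = Circuit.cost (flipTarget m κ ω) +
      2 * Circuit.cost (superpose m κ) + Circuit.cost (flipZero m κ) := by
    unfold amplify
    simp only [cost_append, cost_inv]
    ring
  have hm : m ≤ b := by omega
  have hκ : κ ≤ b := by omega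
  -- The order four comes from the row additions: κ columns, m² pairs of rows, and up to κ + 1 gates
  -- for each pair.
  have h1 : Circuit.cost (solve m κ) ≤ 51 * b ^ 4 := by
    refine (cost_solve m κ).trans ?_
    calc _ ≤ b * 2 + b * (b * (b + 3) + (1 + b * 8) + 3 + 2 * (b * (b * ((b + 1) * 4))) +
          (1 + b * 8) + (b * 4 + b * (b + 3))) := by gcongr
      _ = 8 * b ^ 4 + 10 * b ^ 3 + 26 * b ^ 2 + 7 * b := by ring
      _ ≤ 8 * b ^ 4 + 10 * b ^ 4 + 26 * b ^ 4 + 7 * b ^ 4 := by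
        gcongr
        · norm_num
        · norm_num
        · exact Nat.le_self_pow (by norm_num) b
      _ = 51 * b ^ 4 := by ring
  have hp : ∀ j ≤ 4, b ^ j ≤ b ^ 4 := fun j hj => Nat.pow_le_pow_right hb hj
  have p0 := hp 0 (by norm_num)
  have p1 := hp 1 (by norm_num)
  have p2 := hp 2 (by norm_num)
  rw [pow_zero] at p0
  rw [pow_one] at p1
  have h2 : Circuit.cost (accumulate m κ) ≤ 1 + 6 * b ^ 2 := by
    refine (cost_accumulate m κ).trans ?_
    calc _ ≤ 1 + b * (b * 6) := by gcongr
      _ = _ := by ring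
  have h3 : Circuit.cost (superpose m κ) ≤ 1 + 8 * b ^ 2 := by
    refine (cost_superpose m κ).trans ?_
    calc _ ≤ 1 + b * (b * 2 + b * 6) := by gcongr
      _ = _ := by ring
  rw [e, cost_flipTarget, cost_flipZero]
  omega

theorem cost_quantumPrange_le {b : ℕ} (hb : 1 ≤ b) (h : m + κ ≤ b)
    (H' : Matrix (Fin m) (Fin κ) (ZMod 2)) (s : Fin m → ZMod 2) (ω j : ℕ) :
    Circuit.cost (quantumPrange H' s ω j) ≤ 150 * b ^ 4 * (j + 1) := by
  have hrep : ∀ j, Circuit.cost (List.replicate j (amplify m κ ω)).flatten =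
      j * Circuit.cost (amplify m κ ω) := by
    intro j
    induction j with
    | zero => simp [Circuit.cost]
    | succ j ih => rw [List.replicate_succ, List.flatten_cons, cost_append, ih]; ring
  have hm : m ≤ b := by omega
  have hκ : κ ≤ b := by omega
  unfold quantumPrange
  rw [cost_append, cost_append, hrep]
  have h1 : Circuit.cost (load H' s) ≤ b ^ 2 + b := by
    refine (cost_load H' s).trans ?_
    calc _ ≤ b * b + b := by gcongr
      _ = _ := by ring
  have h3 : Circuit.cost (superpose m κ) ≤ 1 + 8 * b ^ 2 := by
    refine (cost_superpose m κ).trans ?_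
    calc _ ≤ 1 + b * (b * 2 + b * 6) := by gcongr
      _ = _ := by ring
  have hp : ∀ j ≤ 4, b ^ j ≤ b ^ 4 := fun j hj => Nat.pow_le_pow_right hb hj
  have p0 := hp 0 (by norm_num)
  have p1 := hp 1 (by norm_num)
  have p2 := hp 2 (by norm_num)
  rw [pow_zero] at p0
  rw [pow_one] at p1
  have h4 : j * Circuit.cost (amplify m κ ω) ≤ j * (150 * b ^ 4) :=
    Nat.mul_le_mul_left _ (cost_amplify_le hb h ω)
  calc _ ≤ 150 * b ^ 4 + j * (150 * b ^ 4) := by omega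
    _ = _ := by ring

theorem passTime_le {n N j M l : ℕ} (hn : 1 ≤ n) (hN : N ≤ n) (hmN : m ≤ N) (hj : j ≤ M)
    (hl : l ≤ N) {H' : Matrix (Fin m) (Fin (N - m)) (ZMod 2)} {s : Fin m → ZMod 2} {ω : ℕ} :
    prepareCost m n N + (Nat.clog 2 (M + 1) + Circuit.cost (quantumPrange H' s ω j)) +
      finishCost m n N l ≤ 170 * n ^ 4 * (M + 1) := by
  have hc := cost_quantumPrange_le hn (b := n) (by omega) H' s ω j
  have hc' : 150 * n ^ 4 * (j + 1) ≤ 150 * n ^ 4 * (M + 1) := by gcongr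
  have hm : m ≤ n := by omega
  have hl' : l ≤ n := by omega
  have h1 : prepareCost m n N ≤ 2 * n ^ 2 + n * (n + n * (n + 1)) := by
    unfold prepareCost Tableau.stepCost
    calc _ ≤ n * n + n * n + n * (n + n * (n + 1)) := by gcongr
      _ = _ := by ring
  have h2 : finishCost m n N l ≤ n * (n + n * (n + 1)) + n + (n * n + n) := by
    unfold finishCost Tableau.stepCost
    gcongr
  have h3 : Nat.clog 2 (M + 1) ≤ M + 1 :=
    Nat.clog_le_of_le_pow (Nat.lt_two_pow_self).le
  have hp : ∀ j ≤ 4, n ^ j ≤ n ^ 4 := fun j hj => Nat.pow_le_pow_right hn hj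
  have p0 := hp 0 (by norm_num)
  have p1 := hp 1 (by norm_num)
  have p2 := hp 2 (by norm_num)
  have p3 := hp 3 (by norm_num)
  rw [pow_zero] at p0
  rw [pow_one] at p1
  have e : n * (n + n * (n + 1)) = n ^ 3 + 2 * n ^ 2 := by ring
  have e' : n * n = n ^ 2 := by ring
  rw [e] at h1 h2
  rw [e'] at h2
  have h4 : M + 1 ≤ n ^ 4 * (M + 1) := Nat.le_mul_of_pos_left _ (by omega)
  have h5 : n ^ 4 ≤ n ^ 4 * (M + 1) := Nat.le_mul_of_pos_right _ (by omega)
  nlinarith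

/-- π/4 ≤ 1 bounds the main term by 1/a. The ceiling and the extra step each cost at most 1, which
is at most 1/a because a ≤ 1. -/
theorem maxSteps_add_one_le (hω : ω ≤ m) :
    ((maxSteps m κ ω + 1 : ℕ) : ℝ) ≤
      3 / Real.sqrt ((m.choose ω : ℝ) / ((m + κ).choose ω : ℝ)) := by
  set a := Real.sqrt ((m.choose ω : ℝ) / ((m + κ).choose ω : ℝ)) with ha
  have h1 : (0 : ℝ) < m.choose ω := by exact_mod_cast Nat.choose_pos hω
  have h2 : (m.choose ω : ℝ) ≤ (m + κ).choose ω := by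
    exact_mod_cast Nat.choose_le_choose ω (Nat.le_add_right m κ)
  have ha0 : 0 < a := Real.sqrt_pos.2 (div_pos h1 (h1.trans_le h2))
  have ha1 : a ≤ 1 := Real.sqrt_le_one.2 ((div_le_one (h1.trans_le h2)).2 h2)
  have h3 : (maxSteps m κ ω : ℝ) < Real.pi / (4 * a) + 1 := by
    unfold maxSteps
    exact Nat.ceil_lt_add_one (by positivity)
  have h4 : Real.pi / (4 * a) ≤ 1 / a := by
    rw [div_le_div_iff₀ (by positivity) ha0]
    have := Real.pi_le_four
    nlinarith
  have h5 : 1 ≤ 1 / a := (one_le_div ha0).2 ha1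
  have h6 : 3 / a = 1 / a + 1 / a + 1 / a := by ring
  push_cast
  rw [h6]
  linarith

end ISD

namespace ISD

/-! ### Repeating a pass -/

theorem tsum_bind_mul {α β : Type*} (μ : PMF α) (f : α → PMF β) (g : β → ℝ≥0∞) :
    ∑' b, (μ.bind f) b * g b = ∑' a, μ a * ∑' b, f a b * g b := by
  simp only [PMF.bind_apply, ← ENNReal.tsum_mul_right, ← ENNReal.tsum_mul_left, mul_assoc]
  exact ENNReal.tsum_comm

theorem tsum_pure_mul {β : Type*} (b : β) (g : β → ℝ≥0∞) :
    ∑' x, (PMF.pure b) x * g x = g b := by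
  rw [tsum_eq_single b]
  · simp
  · intro x hx; simp [hx]

theorem toOuterMeasure_add_compl {α : Type*} (μ : PMF α) (s : Set α) :
    μ.toOuterMeasure s + μ.toOuterMeasure sᶜ = 1 := by
  classical
  rw [PMF.toOuterMeasure_apply, PMF.toOuterMeasure_apply, ← ENNReal.tsum_add, ← μ.tsum_coe]
  refine tsum_congr fun x => ?_
  by_cases hx : x ∈ s <;> simp [hx]

section Repeat

variable {α : Type} (pass : PMF (Option α × ℕ))

theorem repeatPass_succ (r : ℕ) : repeatPass pass (r + 1) = pass.bind fun y =>
    match y with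
    | (some e, t) => PMF.pure (some e, t)
    | (none, t) => (repeatPass pass r).bind fun z => PMF.pure (z.1, t + z.2) := rfl

/-- Failure of all passes means failure of each, and the passes are independent. -/
theorem repeatPass_fail (r : ℕ) : (repeatPass pass r).toOuterMeasure {z | z.1 = none} =
    pass.toOuterMeasure {z | z.1 = none} ^ r := by
  induction r with
  | zero =>
    change (PMF.pure ((none : Option α), 0)).toOuterMeasure _ = _
    rw [PMF.toOuterMeasure_pure_apply]
    simp
  | succ r ih =>
    rw [repeatPass_succ, PMF.toOuterMeasure_bind_apply, pow_succ', ← ih,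
      PMF.toOuterMeasure_apply pass, ← ENNReal.tsum_mul_right]
    refine tsum_congr fun y => ?_
    obtain ⟨_ | e, t⟩ := y
    · rw [Set.indicator_of_mem (by simp)]
      congr 1
      dsimp only
      rw [PMF.toOuterMeasure_bind_apply, PMF.toOuterMeasure_apply]
      refine tsum_congr fun z => ?_
      rw [PMF.toOuterMeasure_pure_apply]
      by_cases hz : z.1 = none <;> simp [hz]
    · rw [Set.indicator_of_notMem (by simp), zero_mul]
      dsimp only
      rw [PMF.toOuterMeasure_pure_apply]
      simp

theorem tendsto_repeatPass_success (h : pass.toOuterMeasure {z | z.1 ≠ none} ≠ 0) :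
    Filter.Tendsto (fun r => (repeatPass pass r).toOuterMeasure {z | z.1 ≠ none})
      Filter.atTop (nhds 1) := by
  have hc : ∀ μ : PMF (Option α × ℕ), μ.toOuterMeasure {z | z.1 ≠ none} =
      1 - μ.toOuterMeasure {z | z.1 = none} := fun μ => by
    have h1 := toOuterMeasure_add_compl μ {z | z.1 = none}
    refine ENNReal.eq_sub_of_add_eq ?_ (by rw [add_comm]; exact h1)
    exact ne_top_of_le_ne_top ENNReal.one_ne_top (h1 ▸ le_self_add)
  have hlt : pass.toOuterMeasure {z | z.1 = none} < 1 := by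
    by_contra hge
    rw [hc, tsub_eq_zero_of_le (not_lt.1 hge)] at h
    exact h rfl
  have h0 := ENNReal.Tendsto.sub (tendsto_const_nhds (x := (1 : ℝ≥0∞)) (f := Filter.atTop))
    (ENNReal.tendsto_pow_atTop_nhds_zero_of_lt_one hlt) (Or.inl ENNReal.one_ne_top)
  rw [tsub_zero] at h0
  refine h0.congr fun r => ?_
  rw [hc, repeatPass_fail]

/-- With failure probability q = 1 - p the expected times satisfy E(r+1) ≤ T + q E(r), and T/p is
the fixed point of the right side. The bound is uniform in `r`, so it passes to the supremum. -/
theorem expected_repeatPass_le {T : ℕ} (hT : ∀ z ∈ pass.support, z.2 ≤ T)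
    (hp : pass.toOuterMeasure {z | z.1 ≠ none} ≠ 0) (r : ℕ) :
    ∑' z, repeatPass pass r z * (z.2 : ℝ≥0∞) ≤
      T / pass.toOuterMeasure {z | z.1 ≠ none} := by
  set p := pass.toOuterMeasure {z | z.1 ≠ none} with hpd
  set q := pass.toOuterMeasure {z | z.1 = none} with hqd
  have hqp : q + p = 1 := toOuterMeasure_add_compl pass {z | z.1 = none}
  have hpt : p ≠ ⊤ := ne_top_of_le_ne_top ENNReal.one_ne_top (hqp ▸ le_add_self)
  induction r with
  | zero =>
    change ∑' z, (PMF.pure ((none : Option α), (0 : ℕ))) z * (z.2 : ℝ≥0∞) ≤ _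
    rw [tsum_pure_mul]
    simp
  | succ r ih =>
    rw [repeatPass_succ, tsum_bind_mul]
    have h1 : ∑' y, pass y * ∑' b, (match y with
        | (some e, t) => PMF.pure (some e, t)
        | (none, t) => (repeatPass pass r).bind fun z => PMF.pure (z.1, t + z.2) :
          PMF (Option α × ℕ)) b * (b.2 : ℝ≥0∞) ≤
        ∑' y, (pass y * T + {z : Option α × ℕ | z.1 = none}.indicator pass y * (T / p)) := by
      refine ENNReal.tsum_le_tsum fun y => ?_
      by_cases hy : pass y = 0
      · simp [hy]
      have hy' : (y.2 : ℝ≥0∞) ≤ T := by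
        exact_mod_cast hT y ((PMF.mem_support_iff _ _).2 hy)
      obtain ⟨_ | e, t⟩ := y
      · rw [Set.indicator_of_mem (by simp), ← mul_add]
        refine mul_le_mul_right ?_ _
        dsimp only
        rw [tsum_bind_mul]
        simp only [tsum_pure_mul, Nat.cast_add, mul_add]
        rw [ENNReal.tsum_add, ENNReal.tsum_mul_right, PMF.tsum_coe, one_mul]
        exact add_le_add hy' ih
      · rw [Set.indicator_of_notMem (by simp), zero_mul, add_zero]
        refine mul_le_mul_right ?_ _
        dsimp only
        rw [tsum_pure_mul]
        exact hy'
    refine h1.trans ?_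
    rw [ENNReal.tsum_add, ENNReal.tsum_mul_right, ENNReal.tsum_mul_right, PMF.tsum_coe, one_mul,
      ← PMF.toOuterMeasure_apply, ← hqd]
    have h2 : (T : ℝ≥0∞) = p * (T / p) := (ENNReal.mul_div_cancel hp hpt).symm
    calc (T : ℝ≥0∞) + q * (T / p) = p * (T / p) + q * (T / p) := by rw [← h2]
      _ = (q + p) * (T / p) := by ring
      _ ≤ T / p := by rw [hqp, one_mul]

theorem mem_support_of_repeatPass {r : ℕ} {e : α} {t : ℕ}
    (h : (some e, t) ∈ (repeatPass pass r).support) : ∃ t', (some e, t') ∈ pass.support := by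
  induction r generalizing t with
  | zero =>
    change (some e, t) ∈ (PMF.pure ((none : Option α), 0)).support at h
    simp at h
  | succ r ih =>
    rw [repeatPass_succ, PMF.mem_support_bind_iff] at h
    obtain ⟨y, hy, h⟩ := h
    obtain ⟨_ | e', t'⟩ := y
    · dsimp only at h
      rw [PMF.mem_support_bind_iff] at h
      obtain ⟨z, hz, h⟩ := h
      rw [PMF.support_pure, Set.mem_singleton_iff, Prod.mk.injEq] at h
      refine ih (t := z.2) ?_
      rw [h.1]
      exact hz
    · dsimp only at h
      rw [PMF.support_pure, Set.mem_singleton_iff, Prod.mk.injEq] at h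
      refine ⟨t', ?_⟩
      rw [h.1]
      exact hy

end Repeat

/-! ### One pass of Hybrid-Prange -/

variable {n k : ℕ}

section Pass

variable (H : Matrix (Fin (n - k)) (Fin n) (ZMod 2)) (s : Fin (n - k) → ZMod 2) (ω : ℕ) (δ : ℝ)

/-- The matrix of the shortened code. -/
noncomputable def shortened (P : Equiv.Perm (Fin n)) :
    Matrix (Fin (n - k)) (Fin (shortLength n k δ)) (ZMod 2) :=
  fun r i => H r (P (Fin.castLE (shortLength_le n k δ) i))

/-- Extension by zeros, and the permutation of the coordinates. -/
noncomputable def extend (P : Equiv.Perm (Fin n)) (e₁ : Fin (shortLength n k δ) → ZMod 2) :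
    Fin n → ZMod 2 := fun l =>
  if h : ((P.symm l : Fin n) : ℕ) < shortLength n k δ then e₁ ⟨(P.symm l : Fin n), h⟩ else 0

/-- The columns of the shortened matrix that belong to a measurement result. -/
noncomputable def measuredColumns (P : Equiv.Perm (Fin n)) (x : HybridWire n k δ → Bool) :
    List (Fin (shortLength n k δ)) :=
  (Tableau.gauss (shortened H δ P) s (List.finRange _)).columns fun i => x (Wire.sel i)

/-- The vector computed from a measurement result. -/
noncomputable def candidate (P : Equiv.Perm (Fin n)) (x : HybridWire n k δ → Bool) :
    Fin n → ZMod 2 :=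
  extend δ P (Tableau.gauss (shortened H δ P) s (measuredColumns H s δ P x)).solution

theorem hybridPass_eq : hybridPass H s ω δ =
    (PMF.uniformOfFintype (Equiv.Perm (Fin n))).bind fun P =>
      if (Tableau.gauss (shortened H δ P) s (List.finRange _)).Full then
        (PMF.uniformOfFintype
          (Fin (maxSteps (n - k) (shortLength n k δ - (n - k)) ω + 1))).bind fun j =>
        (quantumPrange (Tableau.gauss (shortened H δ P) s (List.finRange _)).systematic
          (Tableau.gauss (shortened H δ P) s (List.finRange _)).s ω j).measure.bind fun x =>
        PMF.pure (if IsSolution H s ω (candidate H s δ P x) then some (candidate H s δ P x)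
            else none,
          prepareCost (n - k) n (shortLength n k δ) +
            (Nat.clog 2 (maxSteps (n - k) (shortLength n k δ - (n - k)) ω + 1) +
              Circuit.cost (quantumPrange
                (Tableau.gauss (shortened H δ P) s (List.finRange _)).systematic
                (Tableau.gauss (shortened H δ P) s (List.finRange _)).s ω j)) +
            finishCost (n - k) n (shortLength n k δ) (measuredColumns H s δ P x).length)
      else PMF.pure (none, prepareCost (n - k) n (shortLength n k δ)) := rfl

variable {H s ω δ}

theorem isSolution_of_mem_support {e : Fin n → ZMod 2} {t : ℕ}
    (h : (some e, t) ∈ (hybridPass H s ω δ).support) : IsSolution H s ω e := by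
  rw [hybridPass_eq, PMF.mem_support_bind_iff] at h
  obtain ⟨P, -, h⟩ := h
  split_ifs at h
  · rw [PMF.mem_support_bind_iff] at h
    obtain ⟨j, -, h⟩ := h
    rw [PMF.mem_support_bind_iff] at h
    obtain ⟨x, -, h⟩ := h
    rw [PMF.support_pure, Set.mem_singleton_iff, Prod.mk.injEq] at h
    split_ifs at h with h1
    · rw [Option.some.inj h.1]
      exact h1
    · exact absurd h.1 (by simp)
  · rw [PMF.support_pure, Set.mem_singleton_iff, Prod.mk.injEq] at h
    exact absurd h.1 (by simp)

theorem time_le_of_mem_support (hn : 1 ≤ n) (hN : n - k ≤ shortLength n k δ)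
    {z : Option (Fin n → ZMod 2) × ℕ} (h : z ∈ (hybridPass H s ω δ).support) :
    z.2 ≤ 170 * n ^ 4 * (maxSteps (n - k) (shortLength n k δ - (n - k)) ω + 1) := by
  have hNn := shortLength_le n k δ
  rw [hybridPass_eq, PMF.mem_support_bind_iff] at h
  obtain ⟨P, -, h⟩ := h
  split_ifs at h
  · rw [PMF.mem_support_bind_iff] at h
    obtain ⟨j, -, h⟩ := h
    rw [PMF.mem_support_bind_iff] at h
    obtain ⟨x, -, h⟩ := h
    rw [PMF.support_pure, Set.mem_singleton_iff] at h
    rw [h]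
    refine passTime_le hn hNn hN (by omega) ?_
    exact (Tableau.length_columns_le _ _).trans (by omega)
  · rw [PMF.support_pure, Set.mem_singleton_iff] at h
    rw [h]
    -- A discarded guess costs only the preparation, a summand of the bound for a full pass; the
    -- remaining parameters are dummies.
    refine le_trans ?_ (passTime_le (j := 0) (l := 0) (H' := 0) (s := 0) (ω := ω) hn hNn hN
      (Nat.zero_le _) (Nat.zero_le _))
    rw [add_assoc]
    exact Nat.le_add_right _ _

/-- All requirements on the algorithm reduce to a positive lower bound `p` for the success
probability of a single pass, as the time of a pass is bounded surely. -/
theorem hybridSolves_of {p : ℝ} (hn : 1 ≤ n) (hN : n - k ≤ shortLength n k δ) (hp : 0 < p)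
    (h : ENNReal.ofReal p ≤ (hybridPass H s ω δ).toOuterMeasure {z | z.1 ≠ none}) {B : ℝ}
    (hB : ((170 * n ^ 4 * (maxSteps (n - k) (shortLength n k δ - (n - k)) ω + 1) : ℕ) : ℝ) / p ≤ B) :
    HybridSolves H s ω δ B := by
  have h0 : (hybridPass H s ω δ).toOuterMeasure {z | z.1 ≠ none} ≠ 0 :=
    ((ENNReal.ofReal_pos.2 hp).trans_le h).ne'
  refine ⟨tendsto_repeatPass_success _ h0, fun r e t he => ?_, ?_⟩
  · obtain ⟨t', ht'⟩ := mem_support_of_repeatPass _ he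
    exact isSolution_of_mem_support ht'
  · refine iSup_le fun r => ?_
    refine (expected_repeatPass_le _ (fun z hz => time_le_of_mem_support hn hN hz) h0 r).trans ?_
    refine (ENNReal.div_le_div_left h _).trans ?_
    rw [← ENNReal.ofReal_natCast, ← ENNReal.ofReal_div_of_pos hp]
    exact ENNReal.ofReal_le_ofReal hB

end Pass

end ISD

namespace ISD

/-! ### Counting permutations and subsets -/

/-- Double counting of pairs of a permutation and an `m`-set that it places within the first `N`
positions. By symmetry the number of permutations is the same for every `m`-set. -/
theorem card_perm_mapsTo_mul {n N m : ℕ} (hN : N ≤ n) {W : Finset (Fin n)} (hW : W.card = m) :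
    n.choose m * (Finset.univ.filter fun P : Equiv.Perm (Fin n) =>
      ∀ w ∈ W, ((P.symm w : Fin n) : ℕ) < N).card = n.factorial * N.choose m := by
  classical
  let A : Equiv.Perm (Fin n) → Finset (Fin n) → Prop := fun P W =>
    ∀ w ∈ W, ((P.symm w : Fin n) : ℕ) < N
  have hsymm : ∀ W' ∈ Finset.powersetCard m (Finset.univ : Finset (Fin n)),
      (Finset.univ.filter fun P => A P W').card = (Finset.univ.filter fun P => A P W).card := by
    intro W' hW'
    have hc : W.card = W'.card := by rw [hW, (Finset.mem_powersetCard.1 hW').2]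
    let Q : Equiv.Perm (Fin n) := (Finset.equivOfCardEq hc).extendSubtype
    have hQ : ∀ w, Q w ∈ W' ↔ w ∈ W := fun w => by
      by_cases hw : w ∈ W
      · exact iff_of_true ((Finset.equivOfCardEq hc).extendSubtype_mem w hw) hw
      · exact iff_of_false ((Finset.equivOfCardEq hc).extendSubtype_not_mem w hw) hw
    symm
    refine Finset.card_equiv (Equiv.mulLeft Q) fun P => ?_
    simp only [Finset.mem_filter, Finset.mem_univ, true_and, A, Equiv.coe_mulLeft]
    have hs : ∀ w, (Q * P).symm (Q w) = P.symm w := fun w => by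
      rw [Equiv.symm_apply_eq]; simp
    constructor
    · intro h w hw
      obtain ⟨w, rfl⟩ := Q.surjective w
      rw [hs]
      exact h w ((hQ w).1 hw)
    · intro h w hw
      rw [← hs]
      exact h _ ((hQ w).2 hw)
  have hcount : ∀ P : Equiv.Perm (Fin n),
      ((Finset.powersetCard m (Finset.univ : Finset (Fin n))).filter fun W => A P W).card =
        N.choose m := by
    intro P
    let φ : Fin N ↪ Fin n := (Fin.castLEEmb hN).trans P.toEmbedding
    have : ((Finset.powersetCard m (Finset.univ : Finset (Fin n))).filter fun W => A P W) =
        Finset.powersetCard m ((Finset.univ : Finset (Fin N)).map φ) := by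
      ext W
      simp only [Finset.mem_filter, Finset.mem_powersetCard, Finset.subset_univ, true_and]
      rw [and_comm]
      refine and_congr_left fun _ => ⟨fun h w hw => ?_, fun h w hw => ?_⟩
      · exact Finset.mem_map.2 ⟨⟨_, h w hw⟩, Finset.mem_univ _, by simp [φ]⟩
      · obtain ⟨i, -, rfl⟩ := Finset.mem_map.1 (h hw)
        simp [φ]
    rw [this, Finset.card_powersetCard, Finset.card_map, Finset.card_univ, Fintype.card_fin]
  have hdouble := Finset.sum_card_bipartiteAbove_eq_sum_card_bipartiteBelow A
    (s := Finset.univ) (t := Finset.powersetCard m (Finset.univ : Finset (Fin n)))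
  unfold Finset.bipartiteAbove Finset.bipartiteBelow at hdouble
  rw [Finset.sum_congr rfl fun P _ => hcount P, Finset.sum_congr rfl hsymm, Finset.sum_const,
    Finset.sum_const, Finset.card_powersetCard, Finset.card_univ, Finset.card_univ,
    Fintype.card_perm, Fintype.card_fin, smul_eq_mul, smul_eq_mul] at hdouble
  exact hdouble.symm

theorem card_supersets_le {ι : Type*} [Fintype ι] [DecidableEq ι] (E : Finset ι) (m : ℕ)
    (F : Finset (Finset ι)) (hF : ∀ S ∈ F, S.card = m ∧ E ⊆ S) :
    F.card ≤ (Fintype.card ι - E.card).choose (m - E.card) := by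
  have : Fintype.card ι - E.card = (Finset.univ \ E).card := by
    rw [Finset.card_sdiff_of_subset (Finset.subset_univ _), Finset.card_univ]
  rw [this, ← Finset.card_powersetCard]
  refine Finset.card_le_card_of_injOn (· \ E) ?_ ?_
  · intro S hS
    obtain ⟨h1, h2⟩ := hF S hS
    refine Finset.mem_coe.2 (Finset.mem_powersetCard.2
      ⟨Finset.sdiff_subset_sdiff (Finset.subset_univ _) subset_rfl, ?_⟩)
    rw [Finset.card_sdiff_of_subset h2, h1]
  · intro S hS T hT h
    rw [← Finset.sdiff_union_of_subset (hF S hS).2, ← Finset.sdiff_union_of_subset (hF T hT).2]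
    exact congrArg (· ∪ E) h

/-! ### The success probability of a pass -/

variable {n k : ℕ}

/-- The coordinates that a permutation moves to the front. -/
noncomputable def front (δ : ℝ) (P : Equiv.Perm (Fin n)) : Fin (shortLength n k δ) ↪ Fin n :=
  (Fin.castLEEmb (shortLength_le n k δ)).trans P.toEmbedding

theorem mem_range_front {δ : ℝ} {P : Equiv.Perm (Fin n)} {l : Fin n} :
    l ∈ Set.range (front (k := k) δ P) ↔ ((P.symm l : Fin n) : ℕ) < shortLength n k δ := by
  constructor
  · rintro ⟨i, rfl⟩
    simp [front]
  · intro h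
    exact ⟨⟨_, h⟩, by simp [front]⟩

theorem extend_front (δ : ℝ) (P : Equiv.Perm (Fin n)) (y : Fin (shortLength n k δ) → ZMod 2)
    (i : Fin (shortLength n k δ)) : extend δ P y (front δ P i) = y i := by
  have : P.symm (front δ P i) = Fin.castLE (shortLength_le n k δ) i := by simp [front]
  unfold extend
  rw [dif_pos (by rw [this]; exact i.2)]
  congr 1
  have h := congrArg Fin.val this
  exact Fin.ext h

theorem extend_of_notMem {δ : ℝ} {P : Equiv.Perm (Fin n)} (y : Fin (shortLength n k δ) → ZMod 2)
    {l : Fin n} (h : l ∉ Set.range (front (k := k) δ P)) : extend δ P y l = 0 := by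
  unfold extend
  exact dif_neg fun h1 => h (mem_range_front.2 h1)

section

variable (H : Matrix (Fin (n - k)) (Fin n) (ZMod 2)) (s : Fin (n - k) → ZMod 2) (ω : ℕ) (δ : ℝ)
  (P : Equiv.Perm (Fin n))

theorem hammingNorm_of_front {e : Fin n → ZMod 2} {y : Fin (shortLength n k δ) → ZMod 2}
    (h0 : ∀ l, l ∉ Set.range (front (k := k) δ P) → e l = 0) (h : ∀ i, e (front δ P i) = y i) :
    hammingNorm e = hammingNorm y := by
  unfold hammingNorm
  rw [Finset.card_filter, Finset.card_filter]
  refine (Fintype.sum_of_injective (front δ P) (front δ P).injective _ _ ?_ ?_).symm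
  · intro l hl; rw [h0 l hl]; simp
  · intro i; rw [h]

theorem mulVec_of_front {e : Fin n → ZMod 2} {y : Fin (shortLength n k δ) → ZMod 2}
    (h0 : ∀ l, l ∉ Set.range (front (k := k) δ P) → e l = 0) (h : ∀ i, e (front δ P i) = y i) :
    H.mulVec e = ∑ i, y i • (shortened H δ P).col i := by
  funext r
  rw [Finset.sum_apply]
  unfold Matrix.mulVec dotProduct
  refine (Fintype.sum_of_injective (front δ P) (front δ P).injective _ _ ?_ ?_).symm
  · intro l hl; rw [h0 l hl, mul_zero]
  · intro i
    rw [h, mul_comm]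
    rfl

variable {H s ω δ P}

/-- A measured good set corresponds to independent columns of the shortened matrix, on which the
classical elimination finds the solution of weight `ω`. Extension by zeros keeps syndrome and
weight. -/
theorem isSolution_candidate {x : HybridWire n k δ → Bool}
    (hF : (Tableau.gauss (shortened H δ P) s (List.finRange _)).Full)
    (hx : GoodSet (sysCol (Tableau.gauss (shortened H δ P) s (List.finRange _)).systematic)
      (Tableau.gauss (shortened H δ P) s (List.finRange _)).s ω (selection x)) :
    IsSolution H s ω (candidate H s δ P x) := by
  classical
  obtain ⟨U, hU⟩ := Tableau.reduced_gauss (shortened H δ P) s (List.finRange _)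
  obtain ⟨f, hf⟩ := hU.exists_colMap hF
  rw [goodSet_iff_of_equiv f U (hU.sysCol_systematic hf) hU.syn] at hx
  obtain ⟨-, hli, y, hy0, hys, hyω⟩ := hx
  have hmem : ∀ j, j ∈ measuredColumns H s δ P x ↔ j ∈ (selection x).map f.toEmbedding := by
    intro j
    unfold measuredColumns
    rw [Tableau.mem_columns hf]
    simp only [selection, Finset.mem_map, Finset.mem_filter, Finset.mem_univ, true_and]
    rfl
  have hset : {j | j ∈ measuredColumns H s δ P x} =
      ((selection x).map f.toEmbedding : Finset (Fin (shortLength n k δ))) := by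
    ext j; exact hmem j
  have hsol : (Tableau.gauss (shortened H δ P) s (measuredColumns H s δ P x)).solution = y :=
    Tableau.solution_gauss _ _ _ (by rw [hset]; exact hli)
      (fun j hj => hy0 j fun h => hj ((hmem j).2 h)) hys
  unfold candidate IsSolution
  rw [hsol, mulVec_of_front H δ P (y := y) (fun l hl => extend_of_notMem y hl)
    (extend_front δ P y), hammingNorm_of_front δ P (y := y) (fun l hl => extend_of_notMem y hl)
    (extend_front δ P y)]
  exact ⟨hys, hyω⟩

/-- The sets of `m` independent columns that contain the support of `e`. -/
noncomputable def infoSets {m : ℕ} (H : Matrix (Fin m) (Fin n) (ZMod 2)) (e : Fin n → ZMod 2) :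
    Finset (Finset (Fin n)) := by
  classical exact (Finset.powersetCard m Finset.univ).filter fun W =>
    (∀ i ∉ W, e i = 0) ∧ LinearIndepOn (ZMod 2) H.col (W : Set (Fin n))

/-- The information sets that a permutation moves to the front. -/
noncomputable def frontInfoSets (H : Matrix (Fin (n - k)) (Fin n) (ZMod 2)) (e : Fin n → ZMod 2)
    (δ : ℝ) (P : Equiv.Perm (Fin n)) : Finset (Finset (Fin n)) :=
  (infoSets H e).filter fun W => ∀ w ∈ W, ((P.symm w : Fin n) : ℕ) < shortLength n k δ

theorem mem_frontInfoSets {e : Fin n → ZMod 2} {W : Finset (Fin n)} :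
    W ∈ frontInfoSets H e δ P ↔ W.card = n - k ∧ (∀ i ∉ W, e i = 0) ∧
      LinearIndepOn (ZMod 2) H.col (W : Set (Fin n)) ∧
      ∀ w ∈ W, w ∈ Set.range (front (k := k) δ P) := by
  unfold frontInfoSets infoSets
  simp only [Finset.mem_filter, Finset.mem_powersetCard, Finset.subset_univ, true_and,
    mem_range_front, and_assoc]

/-- The part of a set of columns that belongs to the shortened code. -/
noncomputable def pull (δ : ℝ) (P : Equiv.Perm (Fin n)) (W : Finset (Fin n)) :
    Finset (Fin (shortLength n k δ)) := Finset.univ.filter fun i => front δ P i ∈ W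

theorem map_pull {W : Finset (Fin n)} (hW : ∀ w ∈ W, w ∈ Set.range (front (k := k) δ P)) :
    (pull (k := k) δ P W).map (front δ P) = W := by
  ext w
  simp only [pull, Finset.mem_map, Finset.mem_filter, Finset.mem_univ, true_and]
  constructor
  · rintro ⟨i, h, rfl⟩; exact h
  · intro h
    obtain ⟨i, rfl⟩ := hW w h
    exact ⟨i, h, rfl⟩

theorem pull_injOn (H : Matrix (Fin (n - k)) (Fin n) (ZMod 2)) (e : Fin n → ZMod 2) (δ : ℝ)
    (P : Equiv.Perm (Fin n)) :
    Set.InjOn (pull (k := k) δ P) (frontInfoSets H e δ P : Set (Finset (Fin n))) := by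
  intro W hW W' hW' h
  rw [← map_pull (mem_frontInfoSets.1 hW).2.2.2, h, map_pull (mem_frontInfoSets.1 hW').2.2.2]

theorem goodSet_pull {e : Fin n → ZMod 2} (he : hammingNorm e = ω) {W : Finset (Fin n)}
    (hW : W ∈ frontInfoSets H e δ P) :
    GoodSet (shortened H δ P).col (H.mulVec e) ω (pull δ P W) := by
  obtain ⟨h1, h2, h3, h4⟩ := mem_frontInfoSets.1 hW
  have hm := map_pull h4
  have h0 : ∀ l, l ∉ Set.range (front (k := k) δ P) → e l = 0 := fun l hl =>
    h2 l fun h => hl (h4 l h)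
  refine ⟨by rw [← h1, ← hm, Finset.card_map, hm], ?_, fun i => e (front δ P i), ?_, ?_, ?_⟩
  · refine LinearIndepOn.comp_of_image (v := H.col) (f := front δ P) ?_
      (front δ P).injective.injOn
    rw [← Finset.coe_map, hm]
    exact h3
  · intro i hi
    exact h2 _ fun h => hi (by simpa [pull] using h)
  · exact (mulVec_of_front H δ P h0 fun _ => rfl).symm
  · rw [← he]
    exact (hammingNorm_of_front δ P h0 fun _ => rfl).symm

/-- All these sets contain the support of `e`, which lies in front as soon as one of them exists.
The bound ensures that the minimum with 1 in the circuit estimate loses nothing. -/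
theorem card_frontInfoSets_le {e : Fin n → ZMod 2} (he : hammingNorm e = ω) :
    (frontInfoSets H e δ P).card ≤ (shortLength n k δ - ω).choose (n - k - ω) := by
  classical
  rcases (frontInfoSets H e δ P).eq_empty_or_nonempty with h | ⟨W₀, hW₀⟩
  · rw [h]; simp
  obtain ⟨-, h2, -, h4⟩ := mem_frontInfoSets.1 hW₀
  have hE : (Finset.univ.filter fun i => e (front (k := k) δ P i) ≠ 0).card = ω := by
    rw [← he, hammingNorm_of_front δ P (fun l hl => h2 l fun h => hl (h4 l h)) fun _ => rfl]
    rfl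
  rw [← Finset.card_image_of_injOn (pull_injOn H e δ P)]
  refine (card_supersets_le (Finset.univ.filter fun i => e (front δ P i) ≠ 0) (n - k) _ ?_).trans
    (by rw [hE, Fintype.card_fin])
  intro S hS
  obtain ⟨W, hW, rfl⟩ := Finset.mem_image.1 hS
  refine ⟨(goodSet_pull he hW).1, fun i hi => ?_⟩
  by_contra h
  exact (Finset.mem_filter.1 hi).2 ((mem_frontInfoSets.1 hW).2.1 _ fun h' => h (by
    simpa [pull] using h'))

/-- Only an inequality: other solutions of weight `ω` may contribute further good sets. -/
theorem card_frontInfoSets_le_goodCount {e : Fin n → ZMod 2} (he : hammingNorm e = ω)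
    (hF : (Tableau.gauss (shortened H δ P) (H.mulVec e) (List.finRange _)).Full) :
    (frontInfoSets H e δ P).card ≤
      goodCount (sysCol (Tableau.gauss (shortened H δ P) (H.mulVec e) (List.finRange _)).systematic)
        (Tableau.gauss (shortened H δ P) (H.mulVec e) (List.finRange _)).s ω := by
  classical
  obtain ⟨U, hU⟩ := Tableau.reduced_gauss (shortened H δ P) (H.mulVec e) (List.finRange _)
  obtain ⟨f, hf⟩ := hU.exists_colMap hF
  unfold goodCount
  refine Finset.card_le_card_of_injOn (fun W => (pull δ P W).map f.symm.toEmbedding) ?_ ?_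
  · intro W hW
    have hg : GoodSet (sysCol (Tableau.gauss (shortened H δ P) (H.mulVec e)
        (List.finRange _)).systematic) (Tableau.gauss (shortened H δ P) (H.mulVec e)
        (List.finRange _)).s ω ((pull δ P W).map f.symm.toEmbedding) := by
      rw [goodSet_iff_of_equiv f U (hU.sysCol_systematic hf) hU.syn, Finset.map_map]
      have : f.symm.toEmbedding.trans f.toEmbedding = Function.Embedding.refl _ := by
        ext i; simp
      rw [this, Finset.map_refl]
      exact goodSet_pull he hW
    exact Finset.mem_coe.2 (Finset.mem_filter.2
      ⟨Finset.mem_powersetCard.2 ⟨Finset.subset_univ _, hg.1⟩, hg⟩)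
  · intro W hW W' hW' h
    exact pull_injOn H e δ P hW hW' (Finset.map_injective _ h)

/-- The identity C(N, m) C(m, ω) = C(N, ω) C(N-ω, m-ω) turns the proportion of good sets divided by
a² into their number over C(N-ω, m-ω). The bound is linear in the number of information sets and can
be averaged over `P`. -/
theorem le_success_of_perm (hm : 0 < n - k) (hω : ω ≤ n - k) (hN : n - k ≤ shortLength n k δ)
    {e : Fin n → ZMod 2} (he : hammingNorm e = ω)
    (hF : (Tableau.gauss (shortened H δ P) (H.mulVec e) (List.finRange _)).Full) :
    ENNReal.ofReal (1 / 4 * ((frontInfoSets H e δ P).card /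
      ((shortLength n k δ - ω).choose (n - k - ω) : ℝ))) ≤
    ((PMF.uniformOfFintype
      (Fin (maxSteps (n - k) (shortLength n k δ - (n - k)) ω + 1))).bind fun j =>
        (quantumPrange (Tableau.gauss (shortened H δ P) (H.mulVec e) (List.finRange _)).systematic
          (Tableau.gauss (shortened H δ P) (H.mulVec e) (List.finRange _)).s ω j).measure
        ).toOuterMeasure {x | GoodSet (sysCol (Tableau.gauss (shortened H δ P) (H.mulVec e)
          (List.finRange _)).systematic)
      (Tableau.gauss (shortened H δ P) (H.mulVec e) (List.finRange _)).s ω (selection x)} := by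
  have hc := card_frontInfoSets_le_goodCount he hF
  have hle := le_sum_measure (Tableau.gauss (shortened H δ P) (H.mulVec e)
    (List.finRange _)).systematic (Tableau.gauss (shortened H δ P) (H.mulVec e)
    (List.finRange _)).s hm hω
  have hc' := card_frontInfoSets_le (H := H) (δ := δ) (P := P) he
  set T := Tableau.gauss (shortened H δ P) (H.mulVec e) (List.finRange _)
  set c := (frontInfoSets H e δ P).card
  set g := goodCount (sysCol T.systematic) T.s ω
  set N := shortLength n k δ
  set M := maxSteps (n - k) (N - (n - k)) ω
  have hmN : n - k + (N - (n - k)) = N := by omega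
  have hpos : ∀ a b : ℕ, b ≤ a → (0 : ℝ) < a.choose b := fun a b h => by
    exact_mod_cast Nat.choose_pos h
  have p1 := hpos N (n - k) hN
  have p2 := hpos N ω (hω.trans hN)
  have p3 := hpos (n - k) ω hω
  have p4 := hpos (N - ω) (n - k - ω) (by omega)
  have hmul : (N.choose (n - k) : ℝ) * (n - k).choose ω =
      N.choose ω * (N - ω).choose (n - k - ω) := by
    exact_mod_cast Nat.choose_mul hω
  rw [PMF.toOuterMeasure_bind_apply, tsum_fintype]
  simp only [PMF.uniformOfFintype_apply, Fintype.card_fin]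
  rw [← Finset.mul_sum]
  have h1 : ENNReal.ofReal (1 / 4 * (c / ((N - ω).choose (n - k - ω) : ℝ))) ≤
      ((M + 1 : ℕ) : ℝ≥0∞)⁻¹ * ENNReal.ofReal ((M + 1 : ℕ) * (1 / 4 * min 1
        ((g : ℝ) / ((n - k + (N - (n - k))).choose (n - k) : ℝ) /
        (((n - k).choose ω : ℝ) / ((n - k + (N - (n - k))).choose ω : ℝ))))) := by
    rw [ENNReal.ofReal_mul (p := ((M + 1 : ℕ) : ℝ)) (Nat.cast_nonneg _),
      ENNReal.ofReal_natCast, ← mul_assoc, ENNReal.inv_mul_cancel (by simp) (by simp), one_mul]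
    refine ENNReal.ofReal_le_ofReal (mul_le_mul_of_nonneg_left ?_ (by norm_num))
    refine le_min ?_ ?_
    · exact (div_le_one p4).2 (by exact_mod_cast hc')
    · rw [hmN]
      have : (g : ℝ) / N.choose (n - k) / ((n - k).choose ω / N.choose ω) =
          g / (N - ω).choose (n - k - ω) := by
        rw [div_div_div_eq, div_eq_div_iff (by positivity) p4.ne', hmul]
        ring
      rw [this]
      gcongr
  refine h1.trans ?_
  exact mul_le_mul_right hle _

variable (H δ) in
theorem le_success (hm : 0 < n - k) (hω : ω ≤ n - k) (hN : n - k ≤ shortLength n k δ)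
    {e : Fin n → ZMod 2} (he : hammingNorm e = ω) :
    ENNReal.ofReal (1 / 4 * (((infoSets H e).card / ((n - ω).choose (n - k - ω) : ℝ)) *
      (((shortLength n k δ).choose ω : ℝ) / n.choose ω))) ≤
    (hybridPass H (H.mulVec e) ω δ).toOuterMeasure {z | z.1 ≠ none} := by
  classical
  set N := shortLength n k δ with hNdef
  have hNn : N ≤ n := shortLength_le n k δ
  rw [hybridPass_eq, PMF.toOuterMeasure_bind_apply, tsum_fintype]
  simp only [PMF.uniformOfFintype_apply]
  rw [← Finset.mul_sum]
  have hperm : ∀ P : Equiv.Perm (Fin n), ENNReal.ofReal (1 / 4 * ((frontInfoSets H e δ P).card /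
      ((N - ω).choose (n - k - ω) : ℝ))) ≤
      (if (Tableau.gauss (shortened H δ P) (H.mulVec e) (List.finRange _)).Full then
        (PMF.uniformOfFintype
          (Fin (maxSteps (n - k) (shortLength n k δ - (n - k)) ω + 1))).bind fun j =>
        (quantumPrange (Tableau.gauss (shortened H δ P) (H.mulVec e) (List.finRange _)).systematic
          (Tableau.gauss (shortened H δ P) (H.mulVec e) (List.finRange _)).s ω j).measure.bind
            fun x =>
        PMF.pure (if IsSolution H (H.mulVec e) ω (candidate H (H.mulVec e) δ P x) then
            some (candidate H (H.mulVec e) δ P x) else none,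
          prepareCost (n - k) n (shortLength n k δ) +
            (Nat.clog 2 (maxSteps (n - k) (shortLength n k δ - (n - k)) ω + 1) +
              Circuit.cost (quantumPrange
                (Tableau.gauss (shortened H δ P) (H.mulVec e) (List.finRange _)).systematic
                (Tableau.gauss (shortened H δ P) (H.mulVec e) (List.finRange _)).s ω j)) +
            finishCost (n - k) n (shortLength n k δ)
              (measuredColumns H (H.mulVec e) δ P x).length)
      else PMF.pure (none, prepareCost (n - k) n (shortLength n k δ))).toOuterMeasure
        {z | z.1 ≠ none} := by
    intro P
    by_cases hF : (Tableau.gauss (shortened H δ P) (H.mulVec e) (List.finRange _)).Full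
    · refine (le_success_of_perm hm hω hN he hF).trans ?_
      rw [if_pos hF, PMF.toOuterMeasure_bind_apply, PMF.toOuterMeasure_bind_apply]
      refine ENNReal.tsum_le_tsum fun j => mul_le_mul_right ?_ _
      rw [PMF.toOuterMeasure_apply, PMF.toOuterMeasure_bind_apply]
      refine ENNReal.tsum_le_tsum fun x => ?_
      by_cases hx : GoodSet (sysCol (Tableau.gauss (shortened H δ P) (H.mulVec e)
          (List.finRange _)).systematic)
          (Tableau.gauss (shortened H δ P) (H.mulVec e) (List.finRange _)).s ω (selection x)
      · rw [Set.indicator_of_mem (by exact hx), PMF.toOuterMeasure_pure_apply,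
          if_pos (isSolution_candidate hF hx), if_pos (by simp), mul_one]
      · rw [Set.indicator_of_notMem (by exact hx)]
        exact zero_le
    -- An information set in front would force full rank. For a discarded guess the bound to be
    -- shown is therefore zero.
    · have : frontInfoSets H e δ P = ∅ := by
        rw [Finset.eq_empty_iff_forall_notMem]
        intro W hW
        have hg := goodSet_pull he hW
        exact hF (Tableau.full_gauss _ _ hg.1 hg.2.1)
      rw [this]
      simp
  refine le_trans ?_ (mul_le_mul_right (Finset.sum_le_sum fun P _ => hperm P) _)
  rw [← ENNReal.ofReal_sum_of_nonneg (fun P _ => by positivity), Fintype.card_perm,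
    Fintype.card_fin, ← ENNReal.ofReal_natCast, ← ENNReal.ofReal_inv_of_pos
    (by exact_mod_cast n.factorial_pos), ← ENNReal.ofReal_mul (by positivity)]
  refine ENNReal.ofReal_le_ofReal (le_of_eq ?_)
  have hdouble := Finset.sum_card_bipartiteAbove_eq_sum_card_bipartiteBelow
    (fun (P : Equiv.Perm (Fin n)) (W : Finset (Fin n)) => ∀ w ∈ W, ((P.symm w : Fin n) : ℕ) < N)
    (s := Finset.univ) (t := infoSets H e)
  unfold Finset.bipartiteAbove Finset.bipartiteBelow at hdouble
  -- Exchange the sums: each information set is moved to the front by the same number of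
  -- permutations.
  have hW : n.choose (n - k) * ∑ P, (frontInfoSets H e δ P).card =
      (infoSets H e).card * (n.factorial * N.choose (n - k)) := by
    have : ∑ P, (frontInfoSets H e δ P).card = _ := hdouble
    rw [this, Finset.mul_sum, ← smul_eq_mul (a := (infoSets H e).card), ← Finset.sum_const]
    refine Finset.sum_congr rfl fun W hW => card_perm_mapsTo_mul hNn ?_
    exact (Finset.mem_powersetCard.1 (Finset.mem_filter.1 hW).1).2
  have hpos : ∀ a b : ℕ, b ≤ a → (0 : ℝ) < a.choose b := fun a b h => by
    exact_mod_cast Nat.choose_pos h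
  have p1 := hpos N (n - k) hN
  have p2 := hpos N ω (hω.trans hN)
  have p3 := hpos (n - k) ω hω
  have p4 := hpos (N - ω) (n - k - ω) (by omega)
  have p5 := hpos n (n - k) (by omega)
  have p6 := hpos n ω (by omega)
  have p7 := hpos (n - ω) (n - k - ω) (by omega)
  have p8 : (0 : ℝ) < n.factorial := by exact_mod_cast n.factorial_pos
  have hmul : (N.choose (n - k) : ℝ) * (n - k).choose ω =
      N.choose ω * (N - ω).choose (n - k - ω) := by
    exact_mod_cast Nat.choose_mul hω
  have hmul' : (n.choose (n - k) : ℝ) * (n - k).choose ω =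
      n.choose ω * (n - ω).choose (n - k - ω) := by
    exact_mod_cast Nat.choose_mul hω
  have hW' : (n.choose (n - k) : ℝ) * ∑ P, ((frontInfoSets H e δ P).card : ℝ) =
      (infoSets H e).card * (n.factorial * N.choose (n - k)) := by exact_mod_cast hW
  have e1 : (n.factorial : ℝ)⁻¹ * ∑ P, (1 / 4 * (((frontInfoSets H e δ P).card : ℝ) /
      ((N - ω).choose (n - k - ω) : ℝ))) = 1 / 4 * ((n.factorial : ℝ)⁻¹ *
      (∑ P, ((frontInfoSets H e δ P).card : ℝ)) / (N - ω).choose (n - k - ω)) := by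
    rw [← Finset.mul_sum, ← Finset.sum_div]
    ring
  have e2 : ∑ P, ((frontInfoSets H e δ P).card : ℝ) =
      (infoSets H e).card * (n.factorial * N.choose (n - k)) / n.choose (n - k) := by
    rw [eq_div_iff p5.ne', ← hW']
    ring
  rw [e1, e2]
  congr 1
  have e3 : (N.choose (n - k) : ℝ) = N.choose ω * (N - ω).choose (n - k - ω) /
      (n - k).choose ω := by rw [eq_div_iff p3.ne', hmul]
  have e4 : (n.choose (n - k) : ℝ) = n.choose ω * (n - ω).choose (n - k - ω) /
      (n - k).choose ω := by rw [eq_div_iff p3.ne', hmul']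
  rw [e3, e4]
  field_simp

end

end ISD

namespace ISD

/-! ### Independence of columns of a random matrix -/

section

open Classical in
/-- The families of vectors that are independent on `S` and on `T`. -/
noncomputable def indepFamilies (m n : ℕ) (S T : Finset (Fin n)) :
    Finset (Fin n → Fin m → ZMod 2) :=
  Finset.univ.filter fun c =>
    LinearIndepOn (ZMod 2) c (S : Set (Fin n)) ∧ LinearIndepOn (ZMod 2) c (T : Set (Fin n))

open Classical in
theorem card_notMem_span {m n : ℕ} {c : Fin n → Fin m → ZMod 2} {S : Finset (Fin n)}
    (h : LinearIndepOn (ZMod 2) c (S : Set (Fin n))) :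
    ((Finset.univ.filter fun v => v ∉ Submodule.span (ZMod 2) (c '' S)).card : ℝ) =
      2 ^ m - 2 ^ S.card := by
  have h1 : Fintype.card (Submodule.span (ZMod 2) (c '' S)) = 2 ^ S.card := by
    rw [Module.card_eq_pow_finrank (K := ZMod 2), ZMod.card, Set.image_eq_range]
    congr 1
    have := finrank_span_eq_card (R := ZMod 2) (b := fun i : (S : Set (Fin n)) => c i) h
    rw [this]
    simp
  have h2 := Finset.card_filter_add_card_filter_not (s := (Finset.univ : Finset (Fin m → ZMod 2)))
    (fun v => v ∈ Submodule.span (ZMod 2) (c '' S))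
  have h3 : (Finset.univ.filter fun v => v ∈ Submodule.span (ZMod 2) (c '' S)).card =
      2 ^ S.card := by
    rw [← h1, Fintype.card_subtype]
  have h4 : (Finset.univ : Finset (Fin m → ZMod 2)).card = 2 ^ m := by
    rw [Finset.card_univ, Fintype.card_fun, ZMod.card, Fintype.card_fin]
  rw [h3, h4] at h2
  rw [eq_sub_iff_add_eq, add_comm]
  exact_mod_cast h2

/-- Given the other vectors, the one at `a` only has to avoid the span of those in `T`, which has
2^|T| elements. -/
theorem card_indepFamilies_insert {m n : ℕ} {S T : Finset (Fin n)} {a : Fin n} (hS : a ∉ S)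
    (hT : a ∉ T) : ((indepFamilies m n S (insert a T)).card : ℝ) =
      (indepFamilies m n S T).card * (1 - 2 ^ T.card / 2 ^ m) := by
  classical
  have hup : ∀ (c : Fin n → Fin m → ZMod 2) v (U : Finset (Fin n)), a ∉ U →
      Set.EqOn (Function.update c a v) c (U : Set (Fin n)) := fun c v U hU i hi => by
    rw [Function.update_of_ne]
    rintro rfl
    exact hU hi
  have hli : ∀ (c : Fin n → Fin m → ZMod 2) v (U : Finset (Fin n)), a ∉ U →
      (LinearIndepOn (ZMod 2) (Function.update c a v) (U : Set (Fin n)) ↔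
        LinearIndepOn (ZMod 2) c (U : Set (Fin n))) := fun c v U hU =>
    linearIndepOn_congr (hup c v U hU)
  have hmem : ∀ c, c ∈ indepFamilies m n S (insert a T) ↔ c ∈ indepFamilies m n S T ∧
      c a ∉ Submodule.span (ZMod 2) (c '' T) := fun c => by
    simp only [indepFamilies, Finset.mem_filter, Finset.mem_univ, true_and, Finset.coe_insert]
    rw [linearIndepOn_insert (by exact_mod_cast hT), and_assoc]
  -- The bijection exchanges the entry at `a` with the extra vector `v`, which is an involution on
  -- pairs.
  have hbij : ((indepFamilies m n S T).sigma fun c =>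
      Finset.univ.filter fun v => v ∉ Submodule.span (ZMod 2) (c '' T)).card =
      ((indepFamilies m n S (insert a T)) ×ˢ (Finset.univ : Finset (Fin m → ZMod 2))).card := by
    refine Finset.card_bij' (fun x _ => (Function.update x.1 a x.2, x.1 a))
      (fun y _ => ⟨Function.update y.1 a y.2, y.1 a⟩) ?_ ?_ ?_ ?_
    · rintro ⟨c, v⟩ h
      simp only [Finset.mem_sigma, Finset.mem_filter, Finset.mem_univ, true_and] at h
      simp only [Finset.mem_product, Finset.mem_univ, and_true, hmem, Function.update_self]
      refine ⟨?_, ?_⟩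
      · have := h.1
        simp only [indepFamilies, Finset.mem_filter, Finset.mem_univ, true_and] at this ⊢
        rwa [hli _ _ _ hS, hli _ _ _ hT]
      · rw [(hup c v T hT).image_eq]
        exact h.2
    · rintro ⟨c, v⟩ h
      simp only [Finset.mem_product, Finset.mem_univ, and_true, hmem] at h
      simp only [Finset.mem_sigma, Finset.mem_filter, Finset.mem_univ, true_and]
      refine ⟨?_, ?_⟩
      · have := h.1
        simp only [indepFamilies, Finset.mem_filter, Finset.mem_univ, true_and] at this ⊢
        rwa [hli _ _ _ hS, hli _ _ _ hT]
      · rw [(hup c v T hT).image_eq]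
        exact h.2
    · rintro ⟨c, v⟩ h
      simp
    · rintro ⟨c, v⟩ h
      simp
  have hreal := congrArg (Nat.cast (R := ℝ)) hbij
  rw [Finset.card_sigma, Nat.cast_sum, Finset.card_product, Finset.card_univ, Fintype.card_fun,
    ZMod.card, Fintype.card_fin, Finset.sum_congr rfl fun c hc => card_notMem_span
      ((Finset.mem_filter.1 hc).2.2), Finset.sum_const, nsmul_eq_mul] at hreal
  push_cast at hreal
  have h2 : (2 : ℝ) ^ m ≠ 0 := by positivity
  field_simp
  linarith

theorem card_indepFamilies_union {m n : ℕ} {S T : Finset (Fin n)} (D : Finset (Fin n))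
    (hS : Disjoint D S) (hT : Disjoint D T) : ((indepFamilies m n S (D ∪ T)).card : ℝ) =
      (indepFamilies m n S T).card *
        ∏ i ∈ Finset.range D.card, (1 - 2 ^ (T.card + i) / 2 ^ m : ℝ) := by
  classical
  induction D using Finset.induction_on with
  | empty => simp
  | insert a D ha ih =>
    rw [Finset.disjoint_insert_left] at hS hT
    have hDT : (D ∪ T).card = T.card + D.card := by
      rw [Finset.card_union_of_disjoint hT.2, add_comm]
    rw [Finset.insert_union, card_indepFamilies_insert hS.1 (by simp [ha, hT.1]), ih hS.2 hT.2,
      Finset.card_insert_of_notMem ha, Finset.prod_range_succ, hDT, mul_assoc]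

/-- A union bound: (2^r - 1)/2^m is the sum of the 2^i/2^m over i < r. -/
theorem one_sub_le_prod_one_sub_pow {m r : ℕ} (hr : r ≤ m) :
    1 - (2 ^ r - 1) / 2 ^ m ≤ ∏ i ∈ Finset.range r, (1 - 2 ^ i / 2 ^ m : ℝ) := by
  induction r with
  | zero => simp
  | succ r ih =>
    have h1 := ih (by omega)
    have h0 : (0 : ℝ) < 2 ^ m := by positivity
    have h2 : (2 : ℝ) ^ r / 2 ^ m ≤ 1 :=
      (div_le_one h0).2 (pow_le_pow_right₀ (by norm_num) (by omega))
    have h3 : (1 : ℝ) ≤ 2 ^ r := one_le_pow₀ (by norm_num)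
    rw [Finset.prod_range_succ]
    have h4 := mul_le_mul_of_nonneg_right h1 (sub_nonneg.2 h2)
    refine le_trans ?_ h4
    have e : (1 - (2 ^ r - 1) / 2 ^ m) * (1 - 2 ^ r / 2 ^ m) - (1 - (2 ^ (r + 1) - 1) / 2 ^ m) =
        ((2 : ℝ) ^ r - 1) / 2 ^ m * (2 ^ r / 2 ^ m) := by
      rw [pow_succ]; ring
    have h5 : (0 : ℝ) ≤ ((2 : ℝ) ^ r - 1) / 2 ^ m * (2 ^ r / 2 ^ m) := by
      have : (0 : ℝ) ≤ (2 : ℝ) ^ r - 1 := by linarith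
      positivity
    linarith

/-- The probability that a uniformly random square matrix is invertible. -/
noncomputable def invProb (m : ℕ) : ℝ := ∏ i ∈ Finset.range m, (1 - 2 ^ i / 2 ^ m : ℝ)

theorem one_sub_pow_div_mem {m i : ℕ} (hi : i ≤ m) :
    0 ≤ (1 - 2 ^ i / 2 ^ m : ℝ) ∧ (1 - 2 ^ i / 2 ^ m : ℝ) ≤ 1 := by
  have h0 : (0 : ℝ) < 2 ^ m := by positivity
  have h2 : (2 : ℝ) ^ i / 2 ^ m ≤ 1 :=
    (div_le_one h0).2 (pow_le_pow_right₀ (by norm_num) hi)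
  have : (0 : ℝ) ≤ 2 ^ i / 2 ^ m := by positivity
  constructor <;> linarith

/-- The union bound over all `m` factors would give only 2^(-m). The last factor, equal to 1/2, is
split off, and the others multiply to at least 1/2. -/
theorem quarter_le_invProb (m : ℕ) : 1 / 4 ≤ invProb m := by
  unfold invProb
  cases m with
  | zero => norm_num
  | succ m =>
    rw [Finset.prod_range_succ]
    have h1 := one_sub_le_prod_one_sub_pow (Nat.le_add_right m 1)
    have h0 : (0 : ℝ) < 2 ^ m := by positivity
    have e : (1 - 2 ^ m / 2 ^ (m + 1) : ℝ) = 1 / 2 := by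
      rw [pow_succ]; field_simp; norm_num
    have h2 : (1 / 2 : ℝ) ≤ 1 - (2 ^ m - 1) / 2 ^ (m + 1) := by
      rw [pow_succ, le_sub_comm, div_le_iff₀ (by positivity)]
      linarith
    rw [e]
    linarith

theorem card_indepFamilies_empty {m n : ℕ} {S : Finset (Fin n)} (hS : S.card = m) :
    ((indepFamilies m n S ∅).card : ℝ) =
      Fintype.card (Fin n → Fin m → ZMod 2) * invProb m := by
  classical
  have h := card_indepFamilies_union (m := m) (S := ∅) (T := ∅) S (Finset.disjoint_empty_right _)
    (Finset.disjoint_empty_right _)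
  have e1 : indepFamilies m n ∅ (S ∪ ∅) = indepFamilies m n S ∅ := by
    ext c; simp [indepFamilies]
  have e2 : indepFamilies m n ∅ ∅ = Finset.univ := by
    ext c; simp [indepFamilies]
  rw [e1, e2, hS, Finset.card_univ] at h
  simpa [invProb] using h

/-- Independence on `S` includes independence on `T ∩ S`, so `T` contributes only the factor `q` of
its j = |T \ S| other vectors. As `invProb m` is `q` times a product that is at least 1 - 2^(-j),
`q` exceeds it by at most 2^(-j). -/
theorem card_indepFamilies_le {m n : ℕ} {S T : Finset (Fin n)} (hS : S.card = m)
    (hT : T.card = m) : ((indepFamilies m n S T).card : ℝ) ≤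
      Fintype.card (Fin n → Fin m → ZMod 2) *
        (invProb m ^ 2 + invProb m * (1 / 2) ^ (T \ S).card) := by
  classical
  set j := (T \ S).card with hj
  have hjm : j + (T ∩ S).card = m := by
    rw [hj, Finset.card_sdiff_add_card_inter, hT]
  have h := card_indepFamilies_union (m := m) (S := S) (T := T ∩ S) (T \ S)
    Finset.sdiff_disjoint (Finset.disjoint_sdiff_inter _ _)
  have e1 : indepFamilies m n S (T ∩ S) = indepFamilies m n S ∅ := by
    ext c
    simp only [indepFamilies, Finset.mem_filter, Finset.mem_univ, true_and]
    refine and_congr_right fun hc => iff_of_true (hc.mono ?_) ?_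
    · exact_mod_cast Finset.inter_subset_right
    · simp
  rw [Finset.sdiff_union_inter, e1, card_indepFamilies_empty hS, ← hj] at h
  rw [h, mul_assoc]
  refine mul_le_mul_of_nonneg_left ?_ (by positivity)
  set q := ∏ i ∈ Finset.range j, (1 - 2 ^ ((T ∩ S).card + i) / 2 ^ m : ℝ) with hq
  have hq0 : 0 ≤ q := Finset.prod_nonneg fun i hi =>
    (one_sub_pow_div_mem (by have := Finset.mem_range.1 hi; omega)).1
  have hq1 : q ≤ 1 := Finset.prod_le_one (fun i hi =>
    (one_sub_pow_div_mem (by have := Finset.mem_range.1 hi; omega)).1) fun i hi =>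
    (one_sub_pow_div_mem (by have := Finset.mem_range.1 hi; omega)).2
  have hsplit : invProb m = (∏ i ∈ Finset.range (T ∩ S).card, (1 - 2 ^ i / 2 ^ m : ℝ)) * q := by
    rw [hq, ← Finset.prod_range_add, add_comm (T ∩ S).card, hjm, invProb]
  have ha := one_sub_le_prod_one_sub_pow (show (T ∩ S).card ≤ m by omega)
  have hpow : (2 : ℝ) ^ (T ∩ S).card / 2 ^ m = (1 / 2) ^ j := by
    rw [← hjm, pow_add, one_div, inv_pow]
    field_simp
  have hp0 : 0 ≤ invProb m := by have := quarter_le_invProb m; linarith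
  have h6 : q ≤ invProb m + (1 / 2) ^ j := by
    set A := ∏ i ∈ Finset.range (T ∩ S).card, (1 - 2 ^ i / 2 ^ m : ℝ)
    have h7 : 1 - (1 / 2) ^ j ≤ A := by
      rw [← hpow]
      refine le_trans ?_ ha
      have : ((2 : ℝ) ^ (T ∩ S).card - 1) / 2 ^ m ≤ 2 ^ (T ∩ S).card / 2 ^ m := by gcongr; linarith
      linarith
    have h8 : (0 : ℝ) ≤ (1 / 2) ^ j := by positivity
    rw [hsplit]
    nlinarith
  calc invProb m * q ≤ invProb m * (invProb m + (1 / 2) ^ j) := by gcongr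
    _ = _ := by ring

end

/-! ### The number of information sets of a random matrix -/

/-- The sets of `m` coordinates that contain the support of `e`. -/
noncomputable def supportSets {n : ℕ} (m : ℕ) (e : Fin n → ZMod 2) : Finset (Finset (Fin n)) :=
  (Finset.powersetCard m Finset.univ).filter fun W => ∀ i ∉ W, e i = 0

theorem card_supportSets {n m : ℕ} {e : Fin n → ZMod 2} (he : hammingNorm e ≤ m) :
    (supportSets m e).card = (n - hammingNorm e).choose (m - hammingNorm e) := by
  classical
  set E := Finset.univ.filter fun i => e i ≠ 0 with hE
  have hEc : E.card = hammingNorm e := rfl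
  have hmem : ∀ W, W ∈ supportSets m e ↔ W.card = m ∧ E ⊆ W := fun W => by
    simp only [supportSets, Finset.mem_filter, Finset.mem_powersetCard, Finset.subset_univ,
      true_and]
    refine and_congr_right fun _ => ⟨fun h i hi => ?_, fun h i hi => ?_⟩
    · by_contra h'
      exact (Finset.mem_filter.1 hi).2 (h i h')
    · by_contra h'
      exact hi (h (Finset.mem_filter.2 ⟨Finset.mem_univ _, h'⟩))
  refine le_antisymm ?_ ?_
  · have := card_supersets_le E m (supportSets m e) fun S hS => (hmem S).1 hS
    rwa [hEc, Fintype.card_fin] at this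
  · have : n - hammingNorm e = (Finset.univ \ E).card := by
      rw [Finset.card_sdiff_of_subset (Finset.subset_univ _), Finset.card_univ, Fintype.card_fin,
        hEc]
    rw [this, ← Finset.card_powersetCard]
    have hd : ∀ S ∈ Finset.powersetCard (m - hammingNorm e) (Finset.univ \ E), Disjoint S E :=
      fun S hS => Finset.disjoint_of_subset_left (Finset.mem_powersetCard.1 hS).1
        Finset.sdiff_disjoint
    refine Finset.card_le_card_of_injOn (· ∪ E) ?_ ?_
    · intro S hS
      refine Finset.mem_coe.2 ((hmem _).2 ⟨?_, Finset.subset_union_right⟩)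
      rw [Finset.card_union_of_disjoint (hd S hS), (Finset.mem_powersetCard.1 hS).2, hEc]
      omega
    · intro S hS S' hS' h
      rw [← Finset.union_sdiff_cancel_right (hd S hS), ← Finset.union_sdiff_cancel_right (hd S' hS')]
      exact congrArg (· \ E) h

theorem card_card_lt_le {n : ℕ} (hn : 1 ≤ n) (J : ℕ) :
    ((Finset.univ : Finset (Finset (Fin n))).filter fun S => S.card < J).card ≤ J * n ^ J := by
  classical
  have : ((Finset.univ : Finset (Finset (Fin n))).filter fun S => S.card < J) ⊆
      (Finset.range J).biUnion fun i => Finset.powersetCard i Finset.univ := by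
    intro S hS
    exact Finset.mem_biUnion.2 ⟨S.card, Finset.mem_range.2 (Finset.mem_filter.1 hS).2,
      Finset.mem_powersetCard.2 ⟨Finset.subset_univ _, rfl⟩⟩
  refine (Finset.card_le_card this).trans (Finset.card_biUnion_le.trans ?_)
  calc ∑ i ∈ Finset.range J, (Finset.powersetCard i (Finset.univ : Finset (Fin n))).card
      ≤ ∑ i ∈ Finset.range J, n ^ J := by
        refine Finset.sum_le_sum fun i hi => ?_
        rw [Finset.card_powersetCard, Finset.card_univ, Fintype.card_fin]
        exact (Nat.choose_le_pow n i).trans (Nat.pow_le_pow_right hn (Finset.mem_range.1 hi).le)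
    _ = J * n ^ J := by simp

/-- Sets with at least `J` elements outside `W` contribute at most 2^(-J) each. Any other `W'` is
determined by the two differences `W' \ W` and `W \ W'`, both with fewer than `J` elements. -/
theorem sum_half_pow_le {n : ℕ} (hn : 1 ≤ n) (J : ℕ) (F : Finset (Finset (Fin n)))
    {W : Finset (Fin n)} (hF : ∀ W' ∈ F, W'.card = W.card) :
    ∑ W' ∈ F, (1 / 2 : ℝ) ^ (W' \ W).card ≤ F.card * (1 / 2) ^ J + (J * n ^ J) ^ 2 := by
  classical
  rw [← Finset.sum_filter_add_sum_filter_not F fun W' => (W' \ W).card < J, add_comm]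
  refine add_le_add ?_ ?_
  · calc ∑ W' ∈ F.filter (fun W' => ¬(W' \ W).card < J), (1 / 2 : ℝ) ^ (W' \ W).card
        ≤ ∑ W' ∈ F.filter (fun W' => ¬(W' \ W).card < J), (1 / 2 : ℝ) ^ J := by
          refine Finset.sum_le_sum fun W' hW' => ?_
          exact pow_le_pow_of_le_one (by norm_num) (by norm_num)
            (not_lt.1 (Finset.mem_filter.1 hW').2)
      _ ≤ F.card * (1 / 2) ^ J := by
          rw [Finset.sum_const, nsmul_eq_mul]
          gcongr
          exact Finset.filter_subset _ _
  · calc ∑ W' ∈ F.filter (fun W' => (W' \ W).card < J), (1 / 2 : ℝ) ^ (W' \ W).card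
        ≤ ∑ W' ∈ F.filter (fun W' => (W' \ W).card < J), 1 :=
          Finset.sum_le_sum fun W' _ => pow_le_one₀ (by norm_num) (by norm_num)
      _ = ((F.filter fun W' => (W' \ W).card < J).card : ℝ) := by simp
      _ ≤ (J * n ^ J) ^ 2 := by
        have : (F.filter fun W' => (W' \ W).card < J).card ≤ (J * n ^ J) * (J * n ^ J) := by
          refine le_trans ?_ (Nat.mul_le_mul (card_card_lt_le hn J) (card_card_lt_le hn J))
          rw [← Finset.card_product]
          refine Finset.card_le_card_of_injOn (fun W' => (W' \ W, W \ W')) ?_ ?_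
          · intro W' hW'
            obtain ⟨h1, h2⟩ := Finset.mem_filter.1 hW'
            have h3 : (W \ W').card = (W' \ W).card := Finset.card_sdiff_comm (hF W' h1).symm
            simp [h2, h3]
          · intro W₁ _ W₂ _ h
            have e : ∀ X : Finset (Fin n), X = (W \ (W \ X)) ∪ (X \ W) := fun X => by
              ext i; simp; tauto
            rw [e W₁, e W₂, (Prod.mk.inj h).1, (Prod.mk.inj h).2]
        rw [sq]
        exact_mod_cast this

end ISD

/-! ### First and second moments of the number of information sets -/

namespace ISD

section

variable {m n : ℕ}

open Classical in
/-- The number of sets of `m` independent columns that contain the support of `e`. -/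
noncomputable def infoCount (m : ℕ) (e : Fin n → ZMod 2) (c : Fin n → Fin m → ZMod 2) : ℝ :=
  ∑ W ∈ supportSets m e, if LinearIndepOn (ZMod 2) c (W : Set (Fin n)) then 1 else 0

theorem card_infoSets (H : Matrix (Fin m) (Fin n) (ZMod 2)) (e : Fin n → ZMod 2) :
    ((infoSets H e).card : ℝ) = infoCount m e H.col := by
  classical
  have : infoSets H e = (supportSets m e).filter fun W : Finset (Fin n) =>
      LinearIndepOn (ZMod 2) H.col (W : Set (Fin n)) := by
    unfold infoSets supportSets
    rw [Finset.filter_filter]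
  rw [this, infoCount, ← Finset.natCast_card_filter]

theorem sum_infoCount (e : Fin n → ZMod 2) : ∑ c, infoCount m e c =
    (supportSets m e).card * (Fintype.card (Fin n → Fin m → ZMod 2) * invProb m) := by
  classical
  unfold infoCount
  rw [Finset.sum_comm, ← nsmul_eq_mul, ← Finset.sum_const]
  refine Finset.sum_congr rfl fun W hW => ?_
  have hc : W.card = m := (Finset.mem_powersetCard.1 (Finset.mem_filter.1 hW).1).2
  rw [← card_indepFamilies_empty hc, ← Finset.natCast_card_filter]
  congr 2
  ext c
  simp [indepFamilies]

theorem sum_infoCount_sq_le (e : Fin n → ZMod 2) : ∑ c, infoCount m e c ^ 2 ≤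
    Fintype.card (Fin n → Fin m → ZMod 2) * ((supportSets m e).card ^ 2 * invProb m ^ 2 +
      invProb m * ∑ W ∈ supportSets m e, ∑ W' ∈ supportSets m e,
        (1 / 2) ^ (W' \ W).card) := by
  classical
  have hc : ∀ W ∈ supportSets m e, W.card = m := fun W hW =>
    (Finset.mem_powersetCard.1 (Finset.mem_filter.1 hW).1).2
  have h1 : ∑ c, infoCount m e c ^ 2 = ∑ W ∈ supportSets m e, ∑ W' ∈ supportSets m e,
      ((indepFamilies m n W W').card : ℝ) := by
    unfold infoCount
    simp only [sq, Finset.sum_mul_sum]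
    rw [Finset.sum_comm]
    refine Finset.sum_congr rfl fun W _ => ?_
    rw [Finset.sum_comm]
    refine Finset.sum_congr rfl fun W' _ => ?_
    rw [indepFamilies, Finset.natCast_card_filter]
    refine Finset.sum_congr rfl fun c _ => ?_
    by_cases a : LinearIndepOn (ZMod 2) c (W : Set (Fin n)) <;>
      by_cases b : LinearIndepOn (ZMod 2) c (W' : Set (Fin n)) <;> simp [a, b]
  rw [h1]
  calc _ ≤ ∑ W ∈ supportSets m e, ∑ W' ∈ supportSets m e,
        (Fintype.card (Fin n → Fin m → ZMod 2) : ℝ) *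
        (invProb m ^ 2 + invProb m * (1 / 2) ^ (W' \ W).card) :=
        Finset.sum_le_sum fun W hW => Finset.sum_le_sum fun W' hW' =>
          card_indepFamilies_le (hc W hW) (hc W' hW')
    _ = _ := by
        simp only [← Finset.mul_sum, Finset.sum_add_distrib, Finset.sum_const, nsmul_eq_mul]
        ring

open Classical in
/-- By Chebyshev's inequality, most matrices have many information sets. -/
theorem card_infoCount_lt_le (hn : 1 ≤ n) (e : Fin n → ZMod 2)
    (hK : 0 < (supportSets m e).card) (J : ℕ) :
    ((Finset.univ.filter fun c : Fin n → Fin m → ZMod 2 =>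
      infoCount m e c < (supportSets m e).card / 8).card : ℝ) ≤
    Fintype.card (Fin n → Fin m → ZMod 2) *
      (16 * ((1 / 2) ^ J + (J * n ^ J) ^ 2 / (supportSets m e).card)) := by
  set K : ℝ := ((supportSets m e).card : ℝ) with hKd
  set T : ℝ := (Fintype.card (Fin n → Fin m → ZMod 2) : ℝ) with hT
  set p := invProb m with hp
  set B := Finset.univ.filter fun c : Fin n → Fin m → ZMod 2 => infoCount m e c < K / 8 with hB
  have hK0 : 0 < K := Nat.cast_pos.2 hK
  have hp1 : 1 / 4 ≤ p := quarter_le_invProb m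
  have hT0 : 0 ≤ T := Nat.cast_nonneg _
  set D : ℝ := K * (1 / 2) ^ J + (J * n ^ J) ^ 2 with hD
  have hD0 : 0 ≤ D := by positivity
  have hS : ∑ W ∈ supportSets m e, ∑ W' ∈ supportSets m e, (1 / 2 : ℝ) ^ (W' \ W).card ≤
      K * D := by
    rw [hKd, ← nsmul_eq_mul, ← Finset.sum_const]
    refine Finset.sum_le_sum fun W hW => ?_
    refine sum_half_pow_le hn J _ fun W' hW' => ?_
    rw [(Finset.mem_powersetCard.1 (Finset.mem_filter.1 hW).1).2,
      (Finset.mem_powersetCard.1 (Finset.mem_filter.1 hW').1).2]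
  have hvar : ∑ c : Fin n → Fin m → ZMod 2, (infoCount m e c - K * p) ^ 2 ≤ T * (p * (K * D)) := by
    have e1 : ∑ c : Fin n → Fin m → ZMod 2, (infoCount m e c - K * p) ^ 2 =
        ∑ c, infoCount m e c ^ 2 - 2 * (K * p) * ∑ c, infoCount m e c + T * (K * p) ^ 2 := by
      have e2 : T * (K * p) ^ 2 = ∑ _c : Fin n → Fin m → ZMod 2, (K * p) ^ 2 := by
        rw [Finset.sum_const, Finset.card_univ, nsmul_eq_mul]
      rw [Finset.mul_sum, ← Finset.sum_sub_distrib, e2, ← Finset.sum_add_distrib]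
      exact Finset.sum_congr rfl fun c _ => by ring
    rw [e1, sum_infoCount]
    have h2 := sum_infoCount_sq_le (m := m) e
    have h3 : T * (p * ∑ W ∈ supportSets m e, ∑ W' ∈ supportSets m e,
        (1 / 2 : ℝ) ^ (W' \ W).card) ≤ T * (p * (K * D)) := by gcongr
    rw [← hKd, ← hT, ← hp] at *
    nlinarith
  -- As p ≥ 1/4, the threshold K/8 is at most half the mean Kp, so every family in `B` deviates from
  -- the mean by at least Kp/2.
  have hlow : (B.card : ℝ) * (K * p / 2) ^ 2 ≤
      ∑ c : Fin n → Fin m → ZMod 2, (infoCount m e c - K * p) ^ 2 := by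
    rw [← nsmul_eq_mul, ← Finset.sum_const]
    refine le_trans (Finset.sum_le_sum fun c hc => ?_)
      (Finset.sum_le_sum_of_subset_of_nonneg (Finset.subset_univ B) fun c _ _ => sq_nonneg _)
    have h4 : infoCount m e c < K / 8 := (Finset.mem_filter.1 hc).2
    have h5 : K / 8 ≤ K * p / 2 := by nlinarith
    have h6 : 0 ≤ K * p / 2 := by positivity
    nlinarith
  have h7 := hlow.trans hvar
  have h8 : T * (16 * ((1 / 2) ^ J + (J * n ^ J) ^ 2 / K)) = 16 * T * D / K := by
    rw [hD]; field_simp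
  -- Chebyshev gives |B| ≤ 4TD/(pK), and p ≥ 1/4 turns the constant into 16.
  rw [h8, le_div_iff₀ hK0]
  have hpos : 0 < p * K := by positivity
  refine le_of_mul_le_mul_right ?_ hpos
  have h9 : (B.card : ℝ) * K * (p * K) = 4 * (B.card * (K * p / 2) ^ 2) / p := by
    field_simp; ring
  rw [h9, div_le_iff₀ (by linarith)]
  have h10 : 0 ≤ T * D * K := by positivity
  have h11 : 1 ≤ 16 * p ^ 2 := by nlinarith
  have h12 : 0 ≤ p * (T * D * K) := by positivity
  nlinarith

/-- Raising both `a` and `b` by one at least doubles the coefficient, by Pascal's rule. -/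
theorem two_pow_le_choose_add (c : ℕ) : ∀ {a b : ℕ}, c ≤ a → c ≤ b → 2 ^ c ≤ (a + b).choose a := by
  induction c with
  | zero => intro a b _ _; exact Nat.choose_pos (Nat.le_add_right a b)
  | succ c ih =>
    intro a b ha hb
    obtain ⟨a, rfl⟩ := Nat.exists_eq_add_of_le' ((Nat.le_add_left 1 c).trans ha)
    obtain ⟨b, rfl⟩ := Nat.exists_eq_add_of_le' ((Nat.le_add_left 1 c).trans hb)
    have h := ih (show c ≤ a by omega) (show c ≤ b by omega)
    have e : a + 1 + (b + 1) = (a + b + 1) + 1 := by ring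
    have h1 : (a + b).choose a ≤ (a + b + 1).choose a := Nat.choose_le_choose a (Nat.le_succ _)
    have h2 : (a + b + 1).choose (a + 1) = (a + b).choose a + (a + b).choose (a + 1) :=
      Nat.choose_succ_succ _ _
    rw [e, Nat.choose_succ_succ (a + b + 1) a, h2, pow_succ]
    omega

/-- First `J` is chosen to make 16 · 2^(-J) small; then a polynomial of degree 2J is beaten by
2^(ηn) for large `n`. -/
theorem exists_bound_failure {η ε : ℝ} (hη : 0 < η) (hε : 0 < ε) : ∃ J n₀ : ℕ, 1 ≤ n₀ ∧
    ∀ n K : ℕ, n₀ ≤ n → 2 ^ ⌊η * n⌋₊ ≤ K →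
      16 * ((1 / 2 : ℝ) ^ J + (J * n ^ J) ^ 2 / K) ≤ ε := by
  obtain ⟨J, hJ⟩ := exists_pow_lt_of_lt_one (show 0 < ε / 32 by positivity)
    (show (1 / 2 : ℝ) < 1 by norm_num)
  have hr0 : (0 : ℝ) < (1 / 2 : ℝ) ^ η := Real.rpow_pos_of_pos (by norm_num) _
  have hr1 : (1 / 2 : ℝ) ^ η < 1 := Real.rpow_lt_one (by norm_num) (by norm_num) hη
  have ht := tendsto_pow_const_mul_const_pow_of_abs_lt_one (2 * J) (r := (1 / 2 : ℝ) ^ η)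
    (by rwa [abs_of_pos hr0])
  have ht' := (ht.const_mul (2 * (J : ℝ) ^ 2)).eventually_lt_const
    (show 2 * (J : ℝ) ^ 2 * 0 < ε / 32 by rw [mul_zero]; positivity)
  obtain ⟨n₀, hn₀⟩ := Filter.eventually_atTop.1 ht'
  refine ⟨J, max 1 n₀, le_max_left _ _, fun n K hn hK => ?_⟩
  have h1 := hn₀ n ((le_max_right _ _).trans hn)
  have h2 : (2 : ℝ) ^ (η * n) / 2 ≤ K := by
    have h3 : η * n ≤ (⌊η * n⌋₊ : ℝ) + 1 := (Nat.lt_floor_add_one _).le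
    calc (2 : ℝ) ^ (η * n) / 2 ≤ (2 : ℝ) ^ ((⌊η * n⌋₊ : ℝ) + 1) / 2 := by
          gcongr
          norm_num
      _ = (2 : ℝ) ^ ⌊η * n⌋₊ := by
          rw [Real.rpow_add_one (by norm_num), Real.rpow_natCast]; ring
      _ ≤ K := by exact_mod_cast hK
  have h4 : (0 : ℝ) < (2 : ℝ) ^ (η * n) := Real.rpow_pos_of_pos (by norm_num) _
  have h5 : ((1 / 2 : ℝ) ^ η) ^ n = 1 / (2 : ℝ) ^ (η * n) := by
    rw [← Real.rpow_natCast, ← Real.rpow_mul (by norm_num), one_div,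
      Real.inv_rpow (by norm_num), one_div]
  have h6 : (J * (n : ℝ) ^ J) ^ 2 / K ≤ 2 * (J : ℝ) ^ 2 * (n ^ (2 * J) * ((1 / 2 : ℝ) ^ η) ^ n) := by
    rw [h5]
    calc (J * (n : ℝ) ^ J) ^ 2 / K ≤ (J * (n : ℝ) ^ J) ^ 2 / ((2 : ℝ) ^ (η * n) / 2) := by gcongr
      _ = _ := by rw [mul_pow, ← pow_mul, mul_comm J 2]; field_simp
  linarith

theorem rank_eq_of_linearIndepOn {H : Matrix (Fin m) (Fin n) (ZMod 2)} {W : Finset (Fin n)}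
    (hW : W.card = m) (h : LinearIndepOn (ZMod 2) H.col (W : Set (Fin n))) : H.rank = m := by
  refine le_antisymm ((Matrix.rank_le_card_height H).trans_eq (Fintype.card_fin m)) ?_
  rw [Matrix.rank_eq_finrank_span_cols]
  have h1 := finrank_span_eq_card (R := ZMod 2) (b := fun i : (W : Set (Fin n)) => H.col i) h
  have h2 : Fintype.card (W : Set (Fin n)) = m := by simp [hW]
  refine (h2.symm.trans h1.symm).trans_le (Submodule.finrank_mono (Submodule.span_mono ?_))
  rintro _ ⟨i, rfl⟩
  exact ⟨i, rfl⟩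

/-- Most matrices of full rank have many information sets that contain a given support. -/
theorem exists_forall_most_matrices {η ε : ℝ} (hη : 0 < η) (hε : 0 < ε) : ∃ n₀ : ℕ, 1 ≤ n₀ ∧
    ∀ (n m ω : ℕ), n₀ ≤ n → η * n ≤ (m : ℝ) - ω → η * n ≤ (n : ℝ) - m →
    ∀ e : Fin n → ZMod 2, hammingNorm e = ω →
      (1 - ε) * (Set.ncard {H : Matrix (Fin m) (Fin n) (ZMod 2) | H.rank = m} : ℝ) ≤
        (Set.ncard {H : Matrix (Fin m) (Fin n) (ZMod 2) | H.rank = m ∧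
          1 / 8 ≤ ((infoSets H e).card / ((n - ω).choose (m - ω) : ℝ))} : ℝ) := by
  classical
  obtain ⟨J, n₀, hn₀, hJ⟩ := exists_bound_failure hη (show 0 < ε / 4 by positivity)
  refine ⟨n₀, hn₀, fun n m ω hn h1 h2 e he => ?_⟩
  have hn1 : 1 ≤ n := hn₀.trans hn
  have hnr : (0 : ℝ) < n := by exact_mod_cast hn1
  have hηn : 0 < η * n := by positivity
  have hωm : ω < m := by
    have : (ω : ℝ) < m := by linarith
    exact_mod_cast this
  have hmn : m < n := by
    have : (m : ℝ) < n := by linarith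
    exact_mod_cast this
  have hK : (supportSets m e).card = (n - ω).choose (m - ω) := by
    rw [card_supportSets (by rw [he]; exact hωm.le), he]
  have hK2 : 2 ^ ⌊η * n⌋₊ ≤ (supportSets m e).card := by
    rw [hK, show n - ω = (m - ω) + (n - m) by omega]
    refine two_pow_le_choose_add _ ?_ ?_
    · refine Nat.floor_le_of_le ?_
      rw [Nat.cast_sub hωm.le]
      exact h1
    · refine Nat.floor_le_of_le ?_
      rw [Nat.cast_sub hmn.le]
      exact h2
  have hK0 : 0 < (supportSets m e).card := (Nat.two_pow_pos _).trans_le hK2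
  have hbad := (card_infoCount_lt_le (m := m) hn1 e hK0 J).trans
    (mul_le_mul_of_nonneg_left (hJ n _ hn hK2) (Nat.cast_nonneg _))
  set T : ℝ := (Fintype.card (Fin n → Fin m → ZMod 2) : ℝ)
  set R : Set (Matrix (Fin m) (Fin n) (ZMod 2)) := {H | H.rank = m} with hR
  set G : Set (Matrix (Fin m) (Fin n) (ZMod 2)) := {H | H.rank = m ∧
    1 / 8 ≤ ((infoSets H e).card / ((n - ω).choose (m - ω) : ℝ))} with hG
  set B : Set (Matrix (Fin m) (Fin n) (ZMod 2)) := {H | infoCount m e H.col <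
    (supportSets m e).card / 8} with hB
  have hBc : (B.ncard : ℝ) ≤ T * (ε / 4) := by
    refine le_trans ?_ hbad
    refine Nat.cast_le.2 ?_
    rw [← Set.ncard_coe_finset]
    refine Set.ncard_le_ncard_of_injOn (fun H => H.col) ?_ ?_ (Set.toFinite _)
    · intro H hH
      exact Finset.mem_coe.2 (Finset.mem_filter.2 ⟨Finset.mem_univ _, hH⟩)
    · intro H _ H' _ h
      ext i j
      exact congrFun (congrFun h j) i
  -- A fixed set of `m` columns is already independent for a quarter of all matrices. This turns the
  -- fraction ε/4 of all matrices into a fraction ε of those of full rank.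
  have hRc : T / 4 ≤ (R.ncard : ℝ) := by
    obtain ⟨W, -, hW⟩ := Finset.exists_subset_card_eq (s := (Finset.univ : Finset (Fin n)))
      (n := m) (by simp; omega)
    have h3 := card_indepFamilies_empty hW
    have h4 := quarter_le_invProb m
    have hT0 : 0 ≤ T := Nat.cast_nonneg _
    have h5 : T / 4 ≤ ((indepFamilies m n W ∅).card : ℝ) := by
      rw [h3]; nlinarith
    refine h5.trans ?_
    refine Nat.cast_le.2 ?_
    rw [← Set.ncard_coe_finset]
    refine Set.ncard_le_ncard_of_injOn (fun c => Matrix.of fun i j => c j i) ?_ ?_ (Set.toFinite _)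
    · intro c hc
      exact rank_eq_of_linearIndepOn hW (Finset.mem_filter.1 hc).2.1
    · intro c _ c' _ h
      funext j i
      exact congrFun (congrFun h i) j
  have hsub : R ⊆ G ∪ B := by
    intro H hH
    by_cases hb : H ∈ B
    · exact Or.inr hb
    · refine Or.inl ⟨hH, ?_⟩
      have hb' : ((supportSets m e).card : ℝ) / 8 ≤ infoCount m e H.col := not_lt.1 hb
      rw [card_infoSets, ← hK, le_div_iff₀ (by exact_mod_cast hK0)]
      linarith
  have hcard : (R.ncard : ℝ) ≤ G.ncard + B.ncard := by
    have := (Set.ncard_le_ncard hsub (Set.toFinite _)).trans (Set.ncard_union_le G B)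
    exact_mod_cast this
  nlinarith

end

end ISD

namespace ISD

/-! ### Binomial coefficients and entropy -/

/-- Together with the next lemma: h/(y+h) ≤ log((y+h)/y) ≤ h/y, without denominators, both from log
x ≤ x - 1. -/
theorem mul_log_add_sub_log_le {y h : ℝ} (hy : 0 < y) (hh : 0 ≤ h) :
    y * (Real.log (y + h) - Real.log y) ≤ h := by
  rw [← Real.log_div (by positivity) hy.ne']
  have h1 := Real.log_le_sub_one_of_pos (show 0 < (y + h) / y by positivity)
  calc y * Real.log ((y + h) / y) ≤ y * ((y + h) / y - 1) := by gcongr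
    _ = h := by field_simp; ring

theorem le_add_mul_log_add_sub_log {y h : ℝ} (hy : 0 < y) (hh : 0 ≤ h) :
    h ≤ (y + h) * (Real.log (y + h) - Real.log y) := by
  have h1 := Real.log_le_sub_one_of_pos (show 0 < y / (y + h) by positivity)
  rw [Real.log_div hy.ne' (by positivity)] at h1
  have h2 : (y + h) * (Real.log y - Real.log (y + h)) ≤ (y + h) * (y / (y + h) - 1) := by gcongr
  have h3 : (y + h) * (y / (y + h) - 1) = -h := by field_simp; ring
  linarith

/-- A crude Stirling formula by induction; errors of order log a suffice, since polynomial factors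
are free. -/
theorem log_factorial_bounds {a : ℕ} (ha : 1 ≤ a) :
    a * Real.log a - a ≤ Real.log a.factorial ∧
      Real.log a.factorial ≤ a * Real.log a - a + 1 + Real.log a := by
  induction a, ha using Nat.le_induction with
  | base => simp
  | succ a ha ih =>
    have ha0 : (0 : ℝ) < a := by exact_mod_cast ha
    have h1 := mul_log_add_sub_log_le ha0 zero_le_one
    have h2 := le_add_mul_log_add_sub_log ha0 zero_le_one
    have h3 : Real.log (a + 1).factorial = Real.log (a + 1) + Real.log a.factorial := by
      rw [Nat.factorial_succ, Nat.cast_mul, Real.log_mul (by positivity)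
        (by exact_mod_cast a.factorial_ne_zero)]
      push_cast
      rfl
    rw [h3]
    push_cast
    constructor <;> linarith

/-- The exponent of the binomial coefficient `C(y, ω)`. -/
noncomputable def entropyExp (ω y : ℝ) : ℝ :=
  y * Real.log y - ω * Real.log ω - (y - ω) * Real.log (y - ω)

/-- The linear Stirling terms of the three factorials cancel. The remaining errors are at most 2 + 2
log n, and 1 ≤ log n because n ≥ 3. -/
theorem abs_log_choose_sub_le {n x ω : ℕ} (hn : 3 ≤ n) (hx : x ≤ n) (h1 : 1 ≤ ω) (hω : ω < x) :
    |Real.log (x.choose ω) - entropyExp ω x| ≤ 4 * Real.log n := by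
  have hlog : ∀ a : ℕ, 1 ≤ a → a ≤ n → 0 ≤ Real.log a ∧ Real.log a ≤ Real.log n := fun a h h' =>
    ⟨Real.log_nonneg (by exact_mod_cast h),
      Real.log_le_log (by exact_mod_cast h) (by exact_mod_cast h')⟩
  have hn1 : 1 ≤ Real.log n := by
    rw [← Real.log_exp 1]
    refine Real.log_le_log (Real.exp_pos 1) (Real.exp_one_lt_three.le.trans ?_)
    exact_mod_cast hn
  have e : Real.log (x.choose ω) = Real.log x.factorial - Real.log ω.factorial -
      Real.log (x - ω).factorial := by
    have h2 := Nat.choose_mul_factorial_mul_factorial hω.le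
    rw [← h2]
    have c1 : ((x.choose ω : ℕ) : ℝ) ≠ 0 := by exact_mod_cast (Nat.choose_pos hω.le).ne'
    have c2 : ((ω.factorial : ℕ) : ℝ) ≠ 0 := by exact_mod_cast ω.factorial_ne_zero
    have c3 : (((x - ω).factorial : ℕ) : ℝ) ≠ 0 := by exact_mod_cast (x - ω).factorial_ne_zero
    push_cast
    rw [Real.log_mul (mul_ne_zero c1 c2) c3, Real.log_mul c1 c2]
    ring
  obtain ⟨a1, a2⟩ := log_factorial_bounds (show 1 ≤ x by omega)
  obtain ⟨b1, b2⟩ := log_factorial_bounds h1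
  obtain ⟨c1, c2⟩ := log_factorial_bounds (show 1 ≤ x - ω by omega)
  obtain ⟨l1, l2⟩ := hlog x (by omega) hx
  obtain ⟨l3, l4⟩ := hlog ω h1 (by omega)
  obtain ⟨l5, l6⟩ := hlog (x - ω) (by omega) (by omega)
  rw [Nat.cast_sub hω.le] at c1 c2 l5 l6
  rw [e, entropyExp, abs_le]
  constructor <;> linarith

/-- The derivative is log(y / (y - ω)) > 0. -/
theorem entropyExp_strictMonoOn {ω : ℝ} (hω : 0 < ω) :
    StrictMonoOn (entropyExp ω) (Set.Ioi ω) := by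
  have hd : ∀ y ∈ Set.Ioi ω, HasDerivAt (entropyExp ω) (Real.log y - Real.log (y - ω)) y := by
    intro y hy
    have hy' : ω < y := hy
    have h1 := Real.hasDerivAt_mul_log (hω.trans hy').ne'
    have h2 := (Real.hasDerivAt_mul_log (sub_pos.2 hy').ne').comp y ((hasDerivAt_id y).sub_const ω)
    have h3 := (h1.sub_const (ω * Real.log ω)).sub h2
    have h4 : HasDerivAt (entropyExp ω) (Real.log y + 1 - (Real.log (y - ω) + 1) * 1) y := h3
    rwa [show Real.log y + 1 - (Real.log (y - ω) + 1) * 1 = Real.log y - Real.log (y - ω) by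
      ring] at h4
  refine strictMonoOn_of_deriv_pos (convex_Ioi ω)
    (fun y hy => (hd y hy).continuousAt.continuousWithinAt) fun y hy => ?_
  rw [interior_Ioi] at hy
  rw [(hd y hy).deriv, sub_pos]
  have hy' : ω < y := hy
  exact Real.log_lt_log (by linarith) (by linarith)

/-- The cost of rounding the length. The first-order terms `h` of both products cancel, leaving at
most h (log(y+h) - log(y-ω)). -/
theorem entropyExp_add_sub_le {ω y h b : ℝ} (hω : 0 ≤ ω) (hy : 1 ≤ y - ω) (hh : 0 ≤ h)
    (h1 : h ≤ 1) (hb : y + h ≤ b) :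
    entropyExp ω (y + h) - entropyExp ω y ≤ Real.log b := by
  have hy0 : 0 < y := by linarith
  have hz0 : 0 < y - ω := by linarith
  have h2 := mul_log_add_sub_log_le hy0 hh
  have h3 := le_add_mul_log_add_sub_log hz0 hh
  have h4 : 0 ≤ Real.log (y - ω) := Real.log_nonneg hy
  have h5 : Real.log (y + h) ≤ Real.log b := Real.log_le_log (by linarith) hb
  have h6 : 0 ≤ Real.log (y + h) := Real.log_nonneg (by linarith)
  have e : y + h - ω = y - ω + h := by ring
  unfold entropyExp
  rw [e]
  have h7 : h * Real.log (y + h) ≤ Real.log b := by nlinarith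
  have h8 : 0 ≤ h * Real.log (y - ω) := by positivity
  nlinarith

/-- The terms of `tExp` are entropy exponents over the common denominator n log 2, which cancels in
the quotient. -/
theorem mul_H₂_eq {n x τ : ℝ} (hn : 0 < n) (hτ : 0 < τ) (hx : τ < x) :
    x * H₂ (τ / x) = entropyExp (τ * n) (x * n) / (n * Real.log 2) := by
  have hx0 : 0 < x := hτ.trans hx
  have h2 : Real.log 2 ≠ 0 := (Real.log_pos (by norm_num)).ne'
  have e1 : 1 - τ / x = (x - τ) / x := by field_simp
  have e2 : x * n - τ * n = (x - τ) * n := by ring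
  have hxτ : 0 < x - τ := sub_pos.2 hx
  unfold H₂ entropyExp
  rw [e1, e2, Real.logb, Real.logb, Real.log_div hτ.ne' hx0.ne', Real.log_div hxτ.ne' hx0.ne',
    Real.log_mul hx0.ne' hn.ne', Real.log_mul hτ.ne' hn.ne', Real.log_mul hxτ.ne' hn.ne']
  field_simp
  ring

/-! ### The parameters of the shortened code -/

section

variable {n k : ℕ} {δ : ℝ}

theorem guessed_eq (hn : 0 < n) : guessed n k δ = ⌈(1 - δ) * k⌉₊ := by
  have : (n : ℝ) ≠ 0 := by exact_mod_cast hn.ne'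
  unfold guessed
  rw [mul_assoc, div_mul_cancel₀ _ this]

theorem guessed_le (hn : 0 < n) (hδ : δ ∈ Set.Icc (0 : ℝ) 1) : guessed n k δ ≤ k := by
  rw [guessed_eq hn]
  refine Nat.ceil_le.2 ?_
  have : (0 : ℝ) ≤ k := Nat.cast_nonneg k
  nlinarith [hδ.1]

theorem sub_le_shortLength (hn : 0 < n) (hδ : δ ∈ Set.Icc (0 : ℝ) 1) :
    n - k ≤ shortLength n k δ := by
  have := guessed_le (k := k) hn hδ
  unfold shortLength
  omega

theorem shortLength_bounds (hn : 0 < n) (hk : k ≤ n) (hδ : δ ∈ Set.Icc (0 : ℝ) 1) :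
    (shortLength n k δ : ℝ) ≤ n - (1 - δ) * k ∧ n - (1 - δ) * k ≤ shortLength n k δ + 1 := by
  have h1 := guessed_le (k := k) hn hδ
  have h0 : 0 ≤ (1 - δ) * k := mul_nonneg (by linarith [hδ.2]) (Nat.cast_nonneg k)
  have e : (shortLength n k δ : ℝ) = n - guessed n k δ := by
    unfold shortLength
    rw [Nat.cast_sub (h1.trans hk)]
  rw [e, guessed_eq hn]
  have h2 := Nat.le_ceil ((1 - δ) * k)
  have h3 := (Nat.ceil_lt_add_one h0).le
  constructor <;> linarith

end

/-- Up to O(log n) the logarithm of the left side is Ln - (L' + Lm)/2. With r = (L' - Lm)/(Ln - Lm)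
the exponent is 1 - r/2, and (1 - r/2)(Ln - Lm) is the same number. Monotonicity gives 0 ≤ r ≤ 1, so
the error in `classicalTime` is not magnified. -/
theorem choose_div_sqrt_le {n k ω : ℕ} {R τ δ : ℝ} (hn : 3 ≤ n) (hk : (k : ℝ) = R * n)
    (hω : (ω : ℝ) = τ * n) (h1 : 1 ≤ ω) (hk1 : 1 ≤ k) (hωm : ω + k < n)
    (hδ : δ ∈ Set.Icc (0 : ℝ) 1) :
    (n.choose ω : ℝ) / Real.sqrt ((shortLength n k δ).choose ω * (n - k).choose ω) ≤
      n ^ 9 * classicalTime n k ω ^ tExp R τ δ := by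
  have hn0 : (0 : ℝ) < n := by exact_mod_cast (by omega : 0 < n)
  have hk0 : (0 : ℝ) < k := by exact_mod_cast hk1
  have hω0 : (0 : ℝ) < ω := by exact_mod_cast h1
  have hτ : 0 < τ := by
    rw [hω] at hω0
    exact pos_of_mul_pos_left hω0 hn0.le
  have hωm' : (ω : ℝ) + k + 1 ≤ n := by exact_mod_cast hωm
  set N := shortLength n k δ with hN
  set m := n - k with hm
  have hmr : (m : ℝ) = n - k := by rw [hm, Nat.cast_sub (by omega)]
  have hmN : m ≤ N := sub_le_shortLength (by omega) hδ
  have hNn : N ≤ n := shortLength_le n k δ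
  have hmN' : (m : ℝ) ≤ N := by exact_mod_cast hmN
  obtain ⟨hN1, hN2⟩ := shortLength_bounds (n := n) (k := k) (by omega) (by omega) hδ
  set N' : ℝ := n - (1 - δ) * k with hN'
  have hk' : (1 - δ) * k ≤ k := by nlinarith [hδ.1]
  have hk'' : 0 ≤ (1 - δ) * k := mul_nonneg (by linarith [hδ.2]) hk0.le
  have x1 : (1 - (1 - δ) * R) * n = N' := by rw [hN', hk]; ring
  have x2 : (1 - R) * n = m := by rw [hmr, hk]; ring
  have lt_of : ∀ x : ℝ, (ω : ℝ) < x * n → τ < x := fun x hx => by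
    rw [hω] at hx
    exact lt_of_mul_lt_mul_right hx hn0.le
  have t1 : τ < 1 - (1 - δ) * R := lt_of _ (by rw [x1]; linarith)
  have t2 : τ < 1 - R := lt_of _ (by rw [x2]; linarith)
  have t3 : τ < 1 := lt_of _ (by linarith)
  set Ln := entropyExp ω n with hLn
  set Lm := entropyExp ω m with hLm
  set L' := entropyExp ω N' with hL'
  have hmono := entropyExp_strictMonoOn hω0
  have m1 : Lm < Ln := hmono (show (ω : ℝ) < m by linarith) (show (ω : ℝ) < n by linarith)
    (by linarith)
  have m2 : Lm ≤ L' := hmono.monotoneOn (show (ω : ℝ) < m by linarith)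
    (show (ω : ℝ) < N' by linarith) (by linarith)
  have m3 : L' ≤ Ln := hmono.monotoneOn (show (ω : ℝ) < N' by linarith)
    (show (ω : ℝ) < n by linarith) (by linarith)
  have ht : tExp R τ δ = 1 - 1 / 2 * ((L' - Lm) / (Ln - Lm)) := by
    have hH := mul_H₂_eq hn0 hτ t3
    rw [div_one, one_mul, one_mul] at hH
    unfold tExp
    dsimp only
    rw [mul_H₂_eq hn0 hτ t1, mul_H₂_eq hn0 hτ t2, hH, x1, x2, ← hω, ← hLn, ← hLm, ← hL',
      ← sub_div, ← sub_div, mul_div_assoc]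
    have hc : (n : ℝ) * Real.log 2 ≠ 0 :=
      mul_ne_zero hn0.ne' (Real.log_pos (by norm_num)).ne'
    rw [div_div_div_cancel_right₀ hc]
  set r := (L' - Lm) / (Ln - Lm) with hr
  have r0 : 0 ≤ r := div_nonneg (by linarith) (by linarith)
  have r1 : r ≤ 1 := (div_le_one (by linarith)).2 (by linarith)
  have rr : r * (Ln - Lm) = L' - Lm := div_mul_cancel₀ _ (by linarith)
  -- The number of guessed zeros is rounded up, so `N` lies below the real length `N'` by at most
  -- one.
  have hstep : L' - entropyExp ω N ≤ Real.log n := by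
    have := entropyExp_add_sub_le (ω := ω) (y := N) (h := N' - N) (b := n) hω0.le (by linarith)
      (by linarith) (by linarith) (by linarith)
    rwa [add_sub_cancel] at this
  obtain ⟨a1, a2⟩ := abs_le.1 (abs_log_choose_sub_le hn le_rfl h1 (by omega))
  obtain ⟨b1, b2⟩ := abs_le.1 (abs_log_choose_sub_le (x := m) hn (by omega) h1 (by omega))
  obtain ⟨c1, c2⟩ := abs_le.1 (abs_log_choose_sub_le (x := N) hn hNn h1 (by omega))
  have hlog : 0 ≤ Real.log n := Real.log_nonneg (by linarith)
  have pn : (0 : ℝ) < n.choose ω := by exact_mod_cast Nat.choose_pos (by omega)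
  have pm : (0 : ℝ) < m.choose ω := by exact_mod_cast Nat.choose_pos (by omega)
  have pN : (0 : ℝ) < N.choose ω := by exact_mod_cast Nat.choose_pos (by omega)
  have hT : 0 < classicalTime n k ω := div_pos pn pm
  have hTl : Real.log (classicalTime n k ω) =
      Real.log (n.choose ω) - Real.log (m.choose ω) := Real.log_div pn.ne' pm.ne'
  rw [← Real.log_le_log_iff (by positivity) (by positivity),
    Real.log_div pn.ne' (by positivity), Real.log_sqrt (by positivity),
    Real.log_mul pN.ne' pm.ne', Real.log_mul (by positivity) (by positivity), Real.log_pow,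
    Real.log_rpow hT, hTl, ht]
  have key : r * (Real.log (n.choose ω) - Real.log (m.choose ω)) ≤
      L' - Lm + 8 * Real.log n := by
    rw [← rr]
    have : Real.log (n.choose ω) - Real.log (m.choose ω) ≤ Ln - Lm + 8 * Real.log n := by linarith
    calc _ ≤ r * (Ln - Lm + 8 * Real.log n) := by gcongr
      _ ≤ _ := by nlinarith
  -- The errors sum to 8.5 log n: 4 from half of `key`, 2 each from C(m, ω) and C(N, ω) under the
  -- root, and 1/2 from rounding. Hence the power 9.
  push_cast
  linarith

end ISD

namespace ISD

/-! ### The number of qubits -/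

theorem ncard_mat (m κ : ℕ) :
    Set.ncard {w : Wire m κ | ∃ r c, w = Wire.mat r c} = m * κ := by
  have : {w : Wire m κ | ∃ r c, w = Wire.mat r c} =
      (fun p : Fin m × Fin κ => (Wire.mat p.1 p.2 : Wire m κ)) '' Set.univ := by
    ext w
    constructor
    · rintro ⟨r, c, rfl⟩
      exact ⟨(r, c), trivial, rfl⟩
    · rintro ⟨⟨r, c⟩, -, rfl⟩
      exact ⟨r, c, rfl⟩
  rw [this, Set.ncard_image_of_injective, Set.ncard_univ, Nat.card_prod, Nat.card_fin, Nat.card_fin]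
  rintro ⟨r, c⟩ ⟨r', c'⟩ h
  simpa using h

theorem card_wire_le (m κ : ℕ) : Fintype.card (Wire m κ) ≤ m * κ + (9 * m + 2 * κ + 3) := by
  let g : (Fin m × Fin κ) ⊕ (Fin m ⊕ Fin κ) ⊕ Fin m ⊕ Fin (m + 1) ⊕ Fin m ⊕ Fin m ⊕ Fin m ⊕
      Fin (m + 1) ⊕ Fin m ⊕ Fin κ ⊕ Fin (m + 1) → Wire m κ :=
    Sum.elim (fun p => .mat p.1 p.2) <| Sum.elim .sel <| Sum.elim .syn <| Sum.elim .cnt <|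
      Sum.elim .taken <| Sum.elim .used <| Sum.elim .piv <| Sum.elim .seek <| Sum.elim .src <|
      Sum.elim .bad .wt
  have hg : Function.Surjective g := by
    rintro (i | ⟨r, c⟩ | i | i | i | i | i | i | i | i | i)
    · exact ⟨.inr (.inl i), rfl⟩
    · exact ⟨.inl (r, c), rfl⟩
    · exact ⟨.inr (.inr (.inl i)), rfl⟩
    · exact ⟨.inr (.inr (.inr (.inl i))), rfl⟩
    · exact ⟨.inr (.inr (.inr (.inr (.inl i)))), rfl⟩
    · exact ⟨.inr (.inr (.inr (.inr (.inr (.inl i))))), rfl⟩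
    · exact ⟨.inr (.inr (.inr (.inr (.inr (.inr (.inl i)))))), rfl⟩
    · exact ⟨.inr (.inr (.inr (.inr (.inr (.inr (.inr (.inl i))))))), rfl⟩
    · exact ⟨.inr (.inr (.inr (.inr (.inr (.inr (.inr (.inr (.inl i)))))))), rfl⟩
    · exact ⟨.inr (.inr (.inr (.inr (.inr (.inr (.inr (.inr (.inr (.inl i))))))))), rfl⟩
    · exact ⟨.inr (.inr (.inr (.inr (.inr (.inr (.inr (.inr (.inr (.inr i))))))))), rfl⟩
  refine (Fintype.card_le_of_surjective g hg).trans (le_of_eq ?_)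
  simp only [Fintype.card_sum, Fintype.card_prod, Fintype.card_fin]
  ring

theorem matrixQubits_eq {n k : ℕ} {δ : ℝ} (hn : 0 < n) (hk : k ≤ n)
    (hδ : δ ∈ Set.Icc (0 : ℝ) 1) :
    (matrixQubits n k δ : ℝ) = (n - k) * (k - ⌈(1 - δ) * k⌉₊) := by
  have h1 := guessed_le (k := k) hn hδ
  have h2 : shortLength n k δ - (n - k) = k - guessed n k δ := by
    unfold shortLength
    omega
  unfold matrixQubits
  rw [ncard_mat, h2, Nat.cast_mul, Nat.cast_sub hk, Nat.cast_sub h1, guessed_eq hn]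

theorem qubits_bounds {n k : ℕ} {R δ : ℝ} (hn : 0 < n) (hk : k ≤ n) (hR : (k : ℝ) = R * n)
    (hδ : δ ∈ Set.Icc (0 : ℝ) 1) :
    (matrixQubits n k δ : ℝ) ≤ δ * (1 - R) * R * n ^ 2 ∧
      ((∃ a : ℕ, (1 - δ) * R * n = a) →
        (matrixQubits n k δ : ℝ) = δ * (1 - R) * R * n ^ 2) ∧
      Fintype.card (HybridWire n k δ) ≤ matrixQubits n k δ + 12 * n := by
  have hkn : (k : ℝ) ≤ n := by exact_mod_cast hk
  have e : δ * (1 - R) * R * (n : ℝ) ^ 2 = (n - k) * (k - (1 - δ) * k) := by rw [hR]; ring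
  refine ⟨?_, ?_, ?_⟩
  · rw [matrixQubits_eq hn hk hδ, e]
    have := Nat.le_ceil ((1 - δ) * (k : ℝ))
    have h0 : (0 : ℝ) ≤ n - k := by linarith
    gcongr
  · rintro ⟨a, ha⟩
    have h1 : (1 - δ) * (k : ℝ) = a := by rw [← ha, hR]; ring
    rw [matrixQubits_eq hn hk hδ, e, h1, Nat.ceil_natCast]
  · have h1 := card_wire_le (n - k) (shortLength n k δ - (n - k))
    have h2 := sub_le_shortLength (k := k) hn hδ
    have h3 := shortLength_le n k δ
    have h4 : matrixQubits n k δ = (n - k) * (shortLength n k δ - (n - k)) := ncard_mat _ _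
    rw [h4]
    -- The further registers have 9m + 2κ + 3 qubits, where m + κ ≤ n and n ≥ 1.
    refine h1.trans (Nat.add_le_add_left ?_ _)
    omega

/-! ### The expected time -/

/-- The success probability is at least p = C(N, ω) / (32 C(n, ω)) and a pass costs at most 170 n⁴ ·
3/a. So 16320 = 170 · 3 · 32, and n¹³ is n⁴ times the n⁹ of the entropy estimate. -/
theorem hybridSolves_of_infoSets {n k ω : ℕ} {R τ δ : ℝ} (hn : 3 ≤ n) (hk : (k : ℝ) = R * n)
    (hω : (ω : ℝ) = τ * n) (h1 : 1 ≤ ω) (hk1 : 1 ≤ k) (hωm : ω + k < n)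
    (hδ : δ ∈ Set.Icc (0 : ℝ) 1) {H : Matrix (Fin (n - k)) (Fin n) (ZMod 2)}
    {e : Fin n → ZMod 2} (he : hammingNorm e = ω)
    (hH : 1 / 8 ≤ ((infoSets H e).card / ((n - ω).choose (n - k - ω) : ℝ))) :
    HybridSolves H (H.mulVec e) ω δ
      (16320 * (n : ℝ) ^ 13 * classicalTime n k ω ^ tExp R τ δ) := by
  have hmN := sub_le_shortLength (k := k) (n := n) (by omega) hδ
  have hNn := shortLength_le n k δ
  have hc := choose_div_sqrt_le hn hk hω h1 hk1 hωm hδ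
  have hs := le_success H δ (by omega) (by omega) hmN he
  have hM := maxSteps_add_one_le (m := n - k) (κ := shortLength n k δ - (n - k)) (ω := ω)
    (by omega)
  rw [show n - k + (shortLength n k δ - (n - k)) = shortLength n k δ by omega] at hM
  set N := shortLength n k δ
  have pn : (0 : ℝ) < n.choose ω := by exact_mod_cast Nat.choose_pos (by omega)
  have pm : (0 : ℝ) < (n - k).choose ω := by exact_mod_cast Nat.choose_pos (by omega)
  have pN : (0 : ℝ) < N.choose ω := by exact_mod_cast Nat.choose_pos (by omega)
  set p : ℝ := 1 / 4 * (1 / 8 * ((N.choose ω : ℝ) / n.choose ω)) with hp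
  have hp0 : 0 < p := by positivity
  refine hybridSolves_of (by omega) hmN hp0
    ((ENNReal.ofReal_le_ofReal ?_).trans hs) ?_
  · rw [hp]
    gcongr
  · rw [div_le_iff₀ hp0]
    have hsq : (N.choose ω : ℝ) / Real.sqrt (N.choose ω * (n - k).choose ω) =
        1 / Real.sqrt ((n - k).choose ω / N.choose ω) := by
      rw [Real.sqrt_div' _ pN.le, Real.sqrt_mul pN.le, one_div_div,
        div_eq_div_iff (by positivity) (by positivity)]
      have := Real.mul_self_sqrt pN.le
      linear_combination (-Real.sqrt ((n - k).choose ω : ℝ)) * this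
    calc ((170 * n ^ 4 * (maxSteps (n - k) (N - (n - k)) ω + 1) : ℕ) : ℝ)
        = 170 * (n : ℝ) ^ 4 * ((maxSteps (n - k) (N - (n - k)) ω + 1 : ℕ) : ℝ) := by
          push_cast; ring
      _ ≤ 170 * (n : ℝ) ^ 4 * (3 / Real.sqrt ((n - k).choose ω / N.choose ω)) := by gcongr
      _ = 16320 * (n : ℝ) ^ 4 * ((n.choose ω : ℝ) /
            Real.sqrt (N.choose ω * (n - k).choose ω)) * p := by
          have h3 : (3 : ℝ) / Real.sqrt ((n - k).choose ω / N.choose ω) =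
              3 * (1 / Real.sqrt ((n - k).choose ω / N.choose ω)) := by ring
          rw [h3, ← hsq, hp]
          field_simp
          norm_num
      _ ≤ 16320 * (n : ℝ) ^ 4 * ((n : ℝ) ^ 9 * classicalTime n k ω ^ tExp R τ δ) * p := by
          gcongr
      _ = _ := by ring

end ISD
theorem mainTheorem1 :
    ∃ C d : ℕ,
      -- qubits
      (∀ (n k : ℕ) (R δ : ℝ), 0 < n → k ≤ n → (k : ℝ) = R * n → δ ∈ Set.Icc (0 : ℝ) 1 →
        (ISD.matrixQubits n k δ : ℝ) ≤ δ * (1 - R) * R * n ^ 2 ∧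
        ((∃ a : ℕ, (1 - δ) * R * n = a) →
          (ISD.matrixQubits n k δ : ℝ) = δ * (1 - R) * R * n ^ 2) ∧
        Fintype.card (ISD.HybridWire n k δ) ≤ ISD.matrixQubits n k δ + C * n) ∧
      -- correctness and time
      (∀ η : ℝ, 0 < η → ∀ ε : ℝ, 0 < ε → ∃ n₀ : ℕ, ∀ (n k ω : ℕ) (R τ δ : ℝ),
        n₀ ≤ n → (k : ℝ) = R * n → (ω : ℝ) = τ * n →
        η ≤ R → 0 < τ → τ + R ≤ 1 - η → δ ∈ Set.Icc (0 : ℝ) 1 →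
        ∀ e : Fin n → ZMod 2, hammingNorm e = ω →
          (1 - ε) * (Set.ncard {H : Matrix (Fin (n - k)) (Fin n) (ZMod 2) |
              H.rank = n - k} : ℝ) ≤
            (Set.ncard {H : Matrix (Fin (n - k)) (Fin n) (ZMod 2) |
              H.rank = n - k ∧
              ISD.HybridSolves H (H.mulVec e) ω δ
                (C * (n : ℝ) ^ d * ISD.classicalTime n k ω ^ ISD.tExp R τ δ)} : ℝ)) := by
  -- Both constants come from the time bound; for the additional qubits 12 would be enough.
  refine ⟨16320, 13, fun n k R δ hn hk hR hδ => ?_, fun η hη ε hε => ?_⟩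
  · obtain ⟨h1, h2, h3⟩ := ISD.qubits_bounds hn hk hR hδ
    exact ⟨h1, h2, h3.trans (by omega)⟩
  obtain ⟨n₀, -, hn₀⟩ := ISD.exists_forall_most_matrices hη hε
  refine ⟨max 3 n₀, fun n k ω R τ δ hn hk hω hR hτ hτR hδ e he => ?_⟩
  have hn3 : 3 ≤ n := (le_max_left _ _).trans hn
  have hn0 : (0 : ℝ) < n := by exact_mod_cast (by omega : 0 < n)
  have hsum : (ω : ℝ) + k + η * n ≤ n := by rw [hk, hω]; nlinarith
  have hηn : 0 < η * n := by positivity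
  have hωk : ω + k < n := by
    have : (ω : ℝ) + k < n := by linarith
    exact_mod_cast this
  have hω1 : 1 ≤ ω := by
    have : (0 : ℝ) < ω := by rw [hω]; positivity
    exact_mod_cast this
  have hηk : η * n ≤ k := by rw [hk]; gcongr
  have hk1 : 1 ≤ k := by
    have : (0 : ℝ) < k := hηn.trans_le hηk
    exact_mod_cast this
  have hm : ((n - k : ℕ) : ℝ) = n - k := Nat.cast_sub (by omega)
  -- The margin η enters twice: τ + R ≤ 1 - η gives m - ω ≥ ηn, and R ≥ η gives n - m = k ≥ ηn.
  -- Together they make the number of sets around the support exponential.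
  refine (hn₀ n (n - k) ω ((le_max_right _ _).trans hn) (by rw [hm]; linarith)
    (by rw [hm]; linarith) e he).trans (Nat.cast_le.2 (Set.ncard_le_ncard ?_ (Set.toFinite _)))
  rintro H ⟨hrank, hH⟩
  refine ⟨hrank, ?_⟩
  have := ISD.hybridSolves_of_infoSets hn3 hk hω hω1 hk1 hωk hδ he hH
  exact_mod_cast this
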